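/- A \emph{constraint} of arity $k\ge 0$ is a function $f:\{0,1\}^k\to\mathbb{R}^{\ge0}$; let $\mathcal{U}$ be the set of all unary constraints. \textbf{Constructibility.} A constraint $f$ is \emph{T$_{\max}$-constructible} from a set $\mathcal{G}$ of constraints, written $f\le_{con}^{max}\mathcal{G}$, if it is obtained from constraints in $\mathcal{G}$ by finitely many (possibly zero) applications of: \emph{permutation} (exchange two arguments $x_i,x_j$); \emph{pinning} (replace $x_i$ by a constant $c\in\{0,1\}$, removing the argument $x_i$); \emph{linking} (replace $x_i$ by $x_j$, $j\ne i$, removing the argument $x_i$); \emph{expansion} (insert a new dummy argument directly after some $x_i$); \emph{multiplication} (from $g_1,g_2$ of the same arity form $g_1(x_1,\dots,x_k)\,g_2(x_1,\dots,x_k)$); \emph{maximization} (from $g$ form $\max_{y\in\{0,1\}^d}g(x_1,\dots,x_k,y_1,\dots,y_d)$); \emph{normalization} (from $g$ form $\lambda\cdot g$ with a real $\lambda>0$). \textbf{Problems.} For a set $\mathcal{F}$ of constraints, an instance of the maximization problem $\mathrm{MAX\text{-}PROD\text{-}CSP}(\mathcal{F})$ is a number $n$ of Boolean variables $x_1,\dots,x_n$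 and a finite set $H$ of elements $\langle h,(x_{i_1},\dots,x_{i_k})\rangle$ with $h\in\mathcal{F}$ of arity $k$ and $i_1,\dots,i_k\in[n]$ (indices may repeat); the solutions are the assignments $\sigma:\{x_1,\dots,x_n\}\to\{0,1\}$, and the measure of $\sigma$ is $\prod_{\langle h,(x_{i_1},\dots,x_{i_k})\rangle\in H}h(\sigma(x_{i_1}),\dots,\sigma(x_{i_k}))$. Put $\mathrm{MAX\text{-}PROD\text{-}CSP}^*(\mathcal{F})=\mathrm{MAX\text{-}PROD\text{-}CSP}(\mathcal{F}\cup\mathcal{U})$, and write $(f,\mathcal{F})$ for $\{f\}\cup\mathcal{F}$ and $(\mathcal{G},\mathcal{F})$ for $\mathcal{G}\cup\mathcal{F}$. \textbf{Reductions.} Algorithms are randomized machines over the real numbers: a program with finitely many real constants works on finitely many stacks of reals, with unit-cost exact arithmetic, comparisons, fair coins and oracle calls. Instances are given as words of reals ($n$ in unary, and each element of $H$ by its arity, its variable indices and the table of the $2^k$ values of its constraint), and the size $|x|$ of an instance $x$ is the length of its word. Let $m^*(x)$ be the maximal measure. A solution $y$ of $x$ is \emph{$\alpha$-approximate} if $1/\alpha\le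 m(x,y)/m^*(x)\le\alpha$, respectively $m(x,y)=0$ when $m^*(x)=0$. A \emph{randomized approximation scheme} for a problem outputs, for every instance $x$ and every $\varepsilon\in(0,1)$, a $2^{\varepsilon}$-approximate solution of $x$ with probability at least $3/4$. A problem $P$ is \emph{APT-reducible} to a problem $Q$ if there are a randomized oracle machine $N$ and polynomials $p,q$ in two variables such that for every randomized approximation scheme $M$ for $Q$ used as oracle (with arbitrary resources, each call being answered by a fresh random outcome of $M$), every instance $x$ of $P$ and every $\varepsilon\in(0,1)$: (i) $N$ with oracle $M$ on input $(x,\varepsilon)$ outputs a $2^{\varepsilon}$-approximate solution of $x$ with probability at least $3/4$; (ii) each oracle call is of the form $(w,\delta)$ with $w$ an instance of $Q$, $\delta\in(0,1)$ and $1/\delta\le p(|x|,1/\varepsilon)$; (iii) $N$ halts after at most $q(|x|,1/\varepsilon)$ steps. \textbf{Lemma.} Let $f$ be a constraint and $\mathcal{G}$ a set of constraints with $f\le_{con}^{max}\mathcal{G}$. Then, for every set $\mathcal{F}$ of constraints, $\mathrm{MAX\text{-}PROD\text{-}CSP}^*(f,\mathcal{F})$ is APT-reducible to $\mathrm{MAX\text{-}PROD\text{-}CSP}^*(\mathcal{G},\mathcal{F})$.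 -/

import Mathlib

open scoped NNReal ENNReal

noncomputable section

namespace ProdCSP

/-! ### Constraints and T_max-constructibility -/

/-- Constraints of arity `k`: functions `{0,1}^k → ℝ≥0`. -/
abbrev Con (k : ℕ) : Type := (Fin k → Bool) → ℝ≥0

/-- A constraint together with its arity. -/
abbrev Constraint : Type := Σ k : ℕ, Con k

/-- The set of all unary constraints. -/
def unary : Set Constraint := {f | f.1 = 1}

/-- `TMaxCon G f`: the constraint `f` can be obtained from constraints in `G` by finitely many
applications of the seven operations. -/
inductive TMaxCon (G : Set Constraint) : {k : ℕ} → Con k → Prop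
  /-- Start from a constraint in `G`. -/
  | base {k : ℕ} (g : Con k) (hg : (⟨k, g⟩ : Constraint) ∈ G) : TMaxCon G g
  /-- Permutation: exchange the columns `x_i` and `x_j`. -/
  | perm {k : ℕ} (g : Con k) (i j : Fin k) (hij : i < j) (hg : TMaxCon G g) :
      TMaxCon G (fun x : Fin k → Bool => g (fun t => x (Equiv.swap i j t)))
  /-- Pinning `x_i = c`. -/
  | pin {k : ℕ} (g : Con (k + 1)) (i : Fin (k + 1)) (c : Bool) (hg : TMaxCon G g) :
      TMaxCon G (fun x : Fin k → Bool => g (i.insertNth c x))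
  /-- Linking `x_i = x_j`, where `j ≠ i` is the position `i.succAbove j'`, i.e. the position
  `j'` once `x_i` has been removed. -/
  | link {k : ℕ} (g : Con (k + 1)) (i : Fin (k + 1)) (j' : Fin k) (hg : TMaxCon G g) :
      TMaxCon G (fun x : Fin k → Bool => g (i.insertNth (x j') x))
  /-- Expansion: a new free variable is inserted directly after `x_i`. -/
  | expand {k : ℕ} (g : Con k) (i : Fin k) (hg : TMaxCon G g) :
      TMaxCon G (fun x : Fin (k + 1) → Bool => g (fun t => x (i.succ.succAbove t)))
  /-- Multiplication. -/
  | mul {k : ℕ} (g₁ g₂ : Con k) (h₁ : TMaxCon G g₁) (h₂ : TMaxCon G g₂) :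
      TMaxCon G (fun x : Fin k → Bool => g₁ x * g₂ x)
  /-- Maximization over the last `d` variables. -/
  | maximize {k d : ℕ} (g : Con (k + d)) (hg : TMaxCon G g) :
      TMaxCon G (fun x : Fin k → Bool =>
        Finset.univ.sup (fun y : Fin d → Bool => g (Fin.append x y)))
  /-- Normalization by a positive constant. -/
  | normalize {k : ℕ} (g : Con k) (c : ℝ≥0) (hc : 0 < c) (hg : TMaxCon G g) :
      TMaxCon G (fun x : Fin k → Bool => c * g x)

/-! ### Maximization problems -/

/-- A maximization problem. Real numbers are treated as atomic objects, so instances and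
solutions are written as words over `ℝ`; the size of an instance is the length of its word. -/
structure MaxProblem where
  Inst : Type
  Sol : Inst → Type
  measure : (x : Inst) → Sol x → ℝ≥0
  encInst : Inst → List ℝ
  encSol : (x : Inst) → Sol x → List ℝ
  encInst_injective : Function.Injective encInst
  encSol_injective : ∀ x, Function.Injective (encSol x)

/-- The size `|x|` of an instance. -/
def MaxProblem.size (P : MaxProblem) (x : P.Inst) : ℕ := (P.encInst x).length

/-- The word `v` is (the code of) an `α`-approximate solution for the instance `x`. -/
def MaxProblem.IsApprox (P : MaxProblem) (α : ℝ) (x : P.Inst) (v : List ℝ) : Prop :=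
  ∃ y : P.Sol x, P.encSol x y = v ∧
    ∃ opt : ℝ≥0, IsGreatest (Set.range (P.measure x)) opt ∧
      (opt = 0 → P.measure x y = 0) ∧
      (opt ≠ 0 → 1 / α ≤ |(P.measure x y : ℝ) / (opt : ℝ)| ∧
        |(P.measure x y : ℝ) / (opt : ℝ)| ≤ α)

/-! ### The problem MAX-PROD-CSP -/

/-- An element `⟨h, (x_{i_1}, …, x_{i_k})⟩` over the variables indexed by `Fin n`;
indices may repeat. -/
structure App (n : ℕ) where
  con : Constraint
  vars : Fin con.1 → Fin n

/-- An instance of MAX-PROD-CSP(`F`): a number `n` of variables and a finite set `H` of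
constraint applications with constraints from `F`, given by a list without repetitions. -/
structure CSPInst (F : Set Constraint) where
  n : ℕ
  apps : List (App n)
  nodup : apps.Nodup
  mem : ∀ a ∈ apps, a.con ∈ F

/-- All elements of `{0,1}^k` in lexicographic order. -/
def boolTuples : (k : ℕ) → List (Fin k → Bool)
  | 0 => [Fin.elim0]
  | k + 1 => (boolTuples k).map (Fin.cons (α := fun _ => Bool) false) ++
      (boolTuples k).map (Fin.cons (α := fun _ => Bool) true)

/-- The code of a constraint application: arity, variable indices, table of values. -/
def encApp {n : ℕ} (a : App n) : List ℝ :=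
  (a.con.1 : ℝ) :: (List.ofFn (fun t => ((a.vars t : ℕ) : ℝ)) ++
    (boolTuples a.con.1).map (fun x => (a.con.2 x : ℝ)))

/-- The code of an instance: the number of variables in unary, a separator, and the codes of
the constraint applications. -/
def encCSP {F : Set Constraint} (H : CSPInst F) : List ℝ :=
  List.replicate H.n (1 : ℝ) ++ (0 : ℝ) :: H.apps.flatMap encApp

/-- The code of a truth assignment: the series of its values. -/
def encAssign {n : ℕ} (σ : Fin n → Bool) : List ℝ :=
  List.ofFn (fun i => if σ i then (1 : ℝ) else 0)

theorem mem_boolTuples : ∀ (k : ℕ) (x : Fin k → Bool), x ∈ boolTuples k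
  | 0, x => by simp [boolTuples, Subsingleton.elim x Fin.elim0]
  | k + 1, x => by
    have ht := mem_boolTuples k (Fin.tail x)
    have hx : Fin.cons (α := fun _ => Bool) (x 0) (Fin.tail x) = x := Fin.cons_self_tail x
    simp only [boolTuples, List.mem_append, List.mem_map]
    cases h : x 0
    · exact Or.inl ⟨_, ht, by rw [← h]; exact hx⟩
    · exact Or.inr ⟨_, ht, by rw [← h]; exact hx⟩

theorem encApp_append_inj {n : ℕ} {a b : App n} {l l' : List ℝ}
    (h : encApp a ++ l = encApp b ++ l') : a = b ∧ l = l' := by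
  obtain ⟨⟨k, f⟩, v⟩ := a
  obtain ⟨⟨m, g⟩, w⟩ := b
  simp only [encApp, List.cons_append, List.append_assoc, List.cons.injEq, Nat.cast_inj] at h
  obtain ⟨hk, h⟩ := h
  subst hk
  obtain ⟨h1, h2⟩ := List.append_inj h (by simp)
  obtain ⟨h3, h4⟩ := List.append_inj h2 (by simp)
  have hv : v = w := by
    funext t
    have := congrFun (List.ofFn_injective h1) t
    exact Fin.ext (by exact_mod_cast this)
  have hf : f = g := by
    funext x
    have := List.map_inj_left.1 h3 x (mem_boolTuples _ x)
    exact_mod_cast this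
  subst hv
  subst hf
  exact ⟨rfl, h4⟩

theorem flatMap_encApp_inj {n : ℕ} : ∀ {l l' : List (App n)},
    l.flatMap encApp = l'.flatMap encApp → l = l'
  | [], [], _ => rfl
  | [], b :: l', h => by simp [encApp] at h
  | a :: l, [], h => by simp [encApp] at h
  | a :: l, b :: l', h => by
    simp only [List.flatMap_cons] at h
    obtain ⟨h1, h2⟩ := encApp_append_inj h
    rw [h1, flatMap_encApp_inj h2]

theorem replicate_inj : ∀ {n m : ℕ} {l l' : List ℝ},
    List.replicate n (1 : ℝ) ++ (0 : ℝ) :: l = List.replicate m (1 : ℝ) ++ (0 : ℝ) :: l' →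
      n = m ∧ l = l'
  | 0, 0, _, _, h => by simpa using h
  | 0, m + 1, _, _, h => by simp [List.replicate_succ] at h
  | n + 1, 0, _, _, h => by simp [List.replicate_succ] at h
  | n + 1, m + 1, _, _, h => by
    simp only [List.replicate_succ, List.cons_append, List.cons.injEq, true_and] at h
    obtain ⟨h1, h2⟩ := replicate_inj h
    exact ⟨by rw [h1], h2⟩

theorem encCSP_injective (F : Set Constraint) :
    Function.Injective (encCSP : CSPInst F → List ℝ) := by
  rintro ⟨n, l, hn, hl⟩ ⟨m, l', hn', hl'⟩ h
  obtain ⟨h1, h2⟩ := replicate_inj h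
  change n = m at h1
  subst h1
  obtain rfl : l = l' := flatMap_encApp_inj h2
  rfl

theorem encAssign_injective (n : ℕ) :
    Function.Injective (encAssign : (Fin n → Bool) → List ℝ) := by
  intro σ τ h
  funext i
  have := congrFun (List.ofFn_injective h) i
  cases hs : σ i <;> cases ht : τ i <;> simp_all

/-- MAX-PROD-CSP(`F`): solutions are the truth assignments to the variables, the measure is the
product of the values of all constraint applications. -/
def maxProdCSP (F : Set Constraint) : MaxProblem where
  Inst := CSPInst F
  Sol H := Fin H.n → Bool
  measure H σ := (H.apps.map (fun a => a.con.2 (fun t => σ (a.vars t)))).prod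
  encInst := encCSP
  encSol _ := encAssign
  encInst_injective := encCSP_injective F
  encSol_injective H := encAssign_injective H.n

/-- MAX-PROD-CSP*(`F`): unary constraints are free. -/
def maxProdCSPStar (F : Set Constraint) : MaxProblem := maxProdCSP (F ∪ unary)

/-! ### Randomized oracle machines over the reals

Programs over finitely many stacks of real numbers, with real constants, exact
field operations and comparisons, fair coins and oracle calls, all at unit cost. -/

inductive ArithOp
  | add | sub | mul | div

def ArithOp.eval : ArithOp → ℝ → ℝ → ℝ
  | add, a, b => a + b
  | sub, a, b => a - b
  | mul, a, b => a * b
  | div, a, b => a / b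

inductive Instr
  /-- Push the constant `c` on stack `i`. -/
  | const (i : ℕ) (c : ℝ)
  /-- Remove the top of stack `i`. -/
  | pop (i : ℕ)
  /-- Push the top of stack `i` on stack `j`. -/
  | copy (i j : ℕ)
  /-- Push the result of an operation on the tops of stacks `i` and `j` on stack `l`. -/
  | arith (o : ArithOp) (i j l : ℕ)
  /-- Push a fair random bit on stack `i`. -/
  | coin (i : ℕ)
  /-- Call the oracle. -/
  | query

inductive Test
  /-- Stack `i` is not empty. -/
  | nonempty (i : ℕ)
  /-- The top of stack `i` is smaller than the top of stack `j`. -/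
  | lt (i j : ℕ)
  /-- The tops of stacks `i` and `j` are equal. -/
  | eq (i j : ℕ)

inductive Prog
  | instr (a : Instr)
  | seq (p q : Prog)
  | ite (c : Test) (p q : Prog)
  | loop (c : Test) (p : Prog)

/-- The contents of the stacks; the head of a list is the top. -/
abbrev Store : Type := ℕ → List ℝ

/-- The top of stack `i`, and `0` if the stack is empty. -/
def Store.top (s : Store) (i : ℕ) : ℝ := (s i).headD 0

def Store.push (s : Store) (i : ℕ) (a : ℝ) : Store := Function.update s i (a :: s i)

def Test.holds : Test → Store → Prop
  | nonempty i, s => s i ≠ []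
  | lt i j, s => s.top i < s.top j
  | eq i j, s => s.top i = s.top j

/-- Stacks for communication: the input word and the error tolerance, the queried word and its
tolerance, the oracle's answer, and the output. -/
def inStack : ℕ := 0
def epsStack : ℕ := 1
def queryStack : ℕ := 2
def tolStack : ℕ := 3
def answerStack : ℕ := 4
def outStack : ℕ := 5

/-- A randomized oracle: for each word and tolerance a distribution of answers. -/
abbrev Oracle : Type := List ℝ → ℝ → PMF (List ℝ)

/-- The effect of one instruction. An oracle call puts a fresh random answer to the query
on the answer stack (in place of its previous contents). -/
def Instr.exec (M : Oracle) : Instr → Store → PMF Store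
  | const i c, s => PMF.pure (s.push i c)
  | pop i, s => PMF.pure (Function.update s i (s i).tail)
  | copy i j, s => PMF.pure (s.push j (s.top i))
  | arith o i j l, s => PMF.pure (s.push l (o.eval (s.top i) (s.top j)))
  | coin i, s => (PMF.uniformOfFintype Bool).map (fun b => s.push i (if b then 1 else 0))
  | query, s => (M (s queryStack) (s.top tolStack)).map
      (fun v => Function.update s answerStack v)

/-- A configuration: the programs still to be run, in order, and the store. The machine has
halted if no program is left. -/
abbrev Config : Type := List Prog × Store

open Classical in
/-- One step of the computation. -/
def step (M : Oracle) : Config → PMF Config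
  | ([], s) => PMF.pure ([], s)
  | (.instr a :: r, s) => (a.exec M s).map (fun s' => (r, s'))
  | (.seq p q :: r, s) => PMF.pure (p :: q :: r, s)
  | (.ite c p q :: r, s) => PMF.pure (if c.holds s then (p :: r, s) else (q :: r, s))
  | (.loop c p :: r, s) => PMF.pure (if c.holds s then (p :: .loop c p :: r, s) else (r, s))

/-- The distribution of the configuration after `t` steps. -/
def run (M : Oracle) : ℕ → Config → PMF Config
  | 0, c => PMF.pure c
  | t + 1, c => (run M t c).bind (step M)

/-- The initial configuration of program `N` on input word `w` and tolerance `ε`. -/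
def initial (N : Prog) (w : List ℝ) (ε : ℝ) : Config :=
  ([N], fun i => if i = inStack then w else if i = epsStack then [ε] else [])

/-! ### APT-reducibility -/

/-- `M` is a randomized approximation scheme for `Q` (without a bound on its resources). -/
def IsRandApproxScheme (Q : MaxProblem) (M : Oracle) : Prop :=
  ∀ (w : Q.Inst) (δ : ℝ), 0 < δ → δ < 1 →
    (3 / 4 : ℝ≥0∞) ≤ (M (Q.encInst w) δ).toOuterMeasure {v | Q.IsApprox ((2 : ℝ) ^ δ) w v}

/-- If an oracle call is due in configuration `c`, then it is of the form `(w, δ)` with an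
instance `w` of `Q`, `0 < δ < 1` and `1 / δ ≤ B`. -/
def QueryOK (Q : MaxProblem) (B : ℝ) (c : Config) : Prop :=
  c.1.head? = some (.instr .query) →
    ∃ (w : Q.Inst) (δ : ℝ), c.2 queryStack = Q.encInst w ∧ c.2 tolStack = [δ] ∧
      0 < δ ∧ δ < 1 ∧ 1 / δ ≤ B

/-- `P` is APT-reducible to `Q`. The machine and both polynomials are chosen before the oracle;
time and query bounds hold on every computation path that has positive probability. -/
def APTReduces (P Q : MaxProblem) : Prop :=
  ∃ (N : Prog) (p q : MvPolynomial (Fin 2) ℝ),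
    ∀ M : Oracle, IsRandApproxScheme Q M →
      ∀ (x : P.Inst) (ε : ℝ), 0 < ε → ε < 1 →
        (∃ T : ℕ, (T : ℝ) ≤ MvPolynomial.eval ![(P.size x : ℝ), 1 / ε] q ∧
          (∀ c ∈ (run M T (initial N (P.encInst x) ε)).support, c.1 = []) ∧
          (3 / 4 : ℝ≥0∞) ≤ (run M T (initial N (P.encInst x) ε)).toOuterMeasure
            {c | P.IsApprox ((2 : ℝ) ^ ε) x (c.2 outStack)}) ∧
        (∀ t : ℕ, ∀ c ∈ (run M t (initial N (P.encInst x) ε)).support,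
          QueryOK Q (MvPolynomial.eval ![(P.size x : ℝ), 1 / ε] p) c)

end ProdCSP

end

/-! The classical reduction replaces each application of `f` by the product of constraints from `G`
that defines it, with fresh variables for the maximized arguments. The obstacle is that an instance
holds a set of applications: if two of the new applications coincide with each other or with an old
one, a factor of the product is lost. Two devices keep them distinct. Unary weights are free, so
they can be scaled by pairwise different constants, which changes all measures by one common factor.
Every other application inside a gadget is made to contain an auxiliary variable private to that
gadget.

The second device needs a copy of an argument of `g ∈ G` that behaves like the original, and `g`
itself has to enforce this. Fix an argument and regard `g` as a family of vectors of length two, its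
columns. If any two columns are proportional, for every argument, then `g` is a product of unary
functions and unary weights suffice. Otherwise take two independent columns as close to each other
as possible. Unary weights confine private arguments to these two columns, and after rescaling, two
applications that share the private arguments form a soft equality: the best value is the same at
both points of the diagonal and smaller by a factor `t < 1` off the diagonal
(`eqGadget_simulatesAt_of_columns`). If one of the columns has a zero, `t` can be made proportional
to a given threshold `η`. If no independent column has a zero, the support of `g` is a product set,
and a number of pairs that depends only on `g` pushes the error below the least positive value of
`g`. So each `g ∈ G` is simulated up to a constant factor and an error `η` (`softDefinable_of_mem`),
and all operations preserve this property (`TMaxCon.softDefinable`).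

It remains to choose `η` for a given instance. A positive measure is at least `wordGap` times an a
priori upper bound for all measures, so `η = wordGap / 4` keeps the total error below a quarter of
the optimum, and `2 ^ ε < 4`. Hence approximate solutions of the new instance restrict to
approximate solutions of the old one (`exists_reduced_instance`). An explicit program writes the new
instance in linear time and makes one oracle call with the same `ε` (`aptReduces_of_single_query`).
-/

noncomputable section

namespace ProdCSP

/-! ### Gadgets with private auxiliary variables -/

/-- A constraint applied to variables from `V`. -/
structure Atom (V : Type) where
  con : Constraint
  vars : Fin con.1 → V

namespace Atom

variable {V W : Type}

def val (a : Atom V) (ρ : V → Bool) : ℝ≥0 := a.con.2 (fun t => ρ (a.vars t))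

def map (φ : V → W) (a : Atom V) : Atom W := ⟨a.con, fun t => φ (a.vars t)⟩

theorem val_map (φ : V → W) (a : Atom V) (ρ : W → Bool) :
    (a.map φ).val ρ = a.val (fun v => ρ (φ v)) := rfl

theorem map_map {X : Type} (φ : V → W) (ψ : W → X) (a : Atom V) :
    (a.map φ).map ψ = a.map (fun v => ψ (φ v)) := rfl

end Atom

/-- A unary weight with value `1` at `dir` and `coef * η ^ exp` at the other value, where `η` is a
parameter. -/
structure Soft (V : Type) where
  slot : V
  dir : Bool
  coef : ℝ≥0
  exp : ℕ

namespace Soft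

variable {V W : Type}

def wt (u : Soft V) (η : ℝ≥0) (b : Bool) : ℝ≥0 := if b = u.dir then 1 else u.coef * η ^ u.exp

def val (u : Soft V) (η : ℝ≥0) (ρ : V → Bool) : ℝ≥0 := u.wt η (ρ u.slot)

def map (φ : V → W) (u : Soft V) : Soft W := ⟨φ u.slot, u.dir, u.coef, u.exp⟩

/-- Passing from the parameter `η` to `κ * η` only changes the coefficient, so a threshold can be
sharpened by a constant factor while the program still works with the same `η`. -/
def rescale (κ : ℝ≥0) (u : Soft V) : Soft V := ⟨u.slot, u.dir, u.coef * κ ^ u.exp, u.exp⟩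

theorem val_map (φ : V → W) (u : Soft V) (η : ℝ≥0) (ρ : W → Bool) :
    (u.map φ).val η ρ = u.val η (fun v => ρ (φ v)) := rfl

theorem val_rescale (κ : ℝ≥0) (u : Soft V) (η : ℝ≥0) (ρ : V → Bool) :
    (u.rescale κ).val η ρ = u.val (κ * η) ρ := by
  simp [val, wt, rescale, mul_pow, mul_assoc]

end Soft

/-- A gadget with `k` terminals and auxiliary variables indexed by `ι`. -/
structure Gadget (k : ℕ) (ι : Type) where
  atoms : List (Atom (Fin k ⊕ ι))
  softs : List (Soft (Fin k ⊕ ι))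

namespace Gadget

variable {k : ℕ} {ι : Type}

def val (Γ : Gadget k ι) (η : ℝ≥0) (x : Fin k → Bool) (τ : ι → Bool) : ℝ≥0 :=
  (Γ.atoms.map (fun a => a.val (Sum.elim x τ))).prod *
    (Γ.softs.map (fun u => u.val η (Sum.elim x τ))).prod

/-- The atoms use constraints from `G` and stay pairwise distinct, whatever the terminals are
identified with. -/
structure Valid (G : Set Constraint) (Γ : Gadget k ι) : Prop where
  mem : ∀ a ∈ Γ.atoms, a.con ∈ G
  -- Unary constraints of `G` are never used as atoms; they become weights. So an atom cannot
  -- coincide with a unary weight.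
  arity : ∀ a ∈ Γ.atoms, a.con.1 ≠ 1
  fresh : ∀ a ∈ Γ.atoms, ∃ t j, a.vars t = Sum.inr j
  -- `Sum.getRight?` erases all terminals, the strongest possible identification.
  nodup : (Γ.atoms.map (Atom.map Sum.getRight?)).Nodup
  -- The maximum of each weight is then exactly `1`, so a scaling factor can be read off from the
  -- scaled weight.
  coef_le : ∀ u ∈ Γ.softs, u.coef ≤ 1

/-- With parameter `η`, the gadget has the effect of `f`, up to a constant factor and an error
below the threshold `η`. -/
def SimulatesAt (Γ : Gadget k ι) (f : Con k) (η θ : ℝ≥0) : Prop :=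
  ∃ c : ℝ≥0, 0 < c ∧ (∀ x, ∃ τ, c * f x ≤ Γ.val η x τ) ∧
    ∀ x τ, Γ.val η x τ ≤ c * max (f x) θ

end Gadget

/-- `f` is simulated by a gadget over `G` for all thresholds. -/
def SoftDefinable (G : Set Constraint) {k : ℕ} (f : Con k) : Prop :=
  ∃ (ι : Type) (_ : Fintype ι) (Γ : Gadget k ι), Γ.Valid G ∧
    ∀ η, 0 < η → η ≤ 1 → Γ.SimulatesAt f η η

/-! ### Operations on gadgets: rescaling, substitution, juxtaposition -/

namespace Gadget

variable {k : ℕ} {ι : Type} {G : Set Constraint}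

def rescale (κ : ℝ≥0) (Γ : Gadget k ι) : Gadget k ι := ⟨Γ.atoms, Γ.softs.map (Soft.rescale κ)⟩

theorem val_rescale (κ : ℝ≥0) (Γ : Gadget k ι) (η : ℝ≥0) (x τ) :
    (Γ.rescale κ).val η x τ = Γ.val (κ * η) x τ := by
  simp [val, rescale, List.map_map, Function.comp_def, Soft.val_rescale]

theorem Valid.rescale {Γ : Gadget k ι} (h : Γ.Valid G) {κ : ℝ≥0} (hκ : κ ≤ 1) :
    (Γ.rescale κ).Valid G where
  mem := h.mem
  arity := h.arity
  fresh := h.fresh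
  nodup := h.nodup
  coef_le := by
    intro u hu
    simp only [Gadget.rescale, List.mem_map] at hu
    obtain ⟨u, hu, rfl⟩ := hu
    exact mul_le_one' (h.coef_le u hu) (pow_le_one' hκ _)

/-- Replace terminals by new terminals or new auxiliary variables, and add unary weights on the
latter. -/
def subst {k' : ℕ} {κ : Type} (φ : Fin k → Fin k' ⊕ κ) (pins : List (κ × Bool))
    (Γ : Gadget k ι) : Gadget k' (κ ⊕ ι) where
  atoms := Γ.atoms.map (Atom.map (Sum.elim (fun i => (φ i).map id Sum.inl) (Sum.inr ∘ Sum.inr)))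
  softs := pins.map (fun p => ⟨Sum.inr (Sum.inl p.1), p.2, 0, 0⟩) ++
    Γ.softs.map (Soft.map (Sum.elim (fun i => (φ i).map id Sum.inl) (Sum.inr ∘ Sum.inr)))

theorem sumElim_comp_subst {k' : ℕ} {κ : Type} (φ : Fin k → Fin k' ⊕ κ) (x : Fin k' → Bool)
    (τ : κ ⊕ ι → Bool) :
    (fun v => Sum.elim x τ
      ((Sum.elim (fun i => (φ i).map id Sum.inl) (Sum.inr ∘ Sum.inr) : Fin k ⊕ ι → _) v)) =
      Sum.elim (fun i => Sum.elim x (τ ∘ Sum.inl) (φ i)) (τ ∘ Sum.inr) := by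
  funext v
  rcases v with i | j
  · cases h : φ i <;> simp [h]
  · rfl

theorem val_subst {k' : ℕ} {κ : Type} (φ : Fin k → Fin k' ⊕ κ) (pins : List (κ × Bool))
    (Γ : Gadget k ι) (η : ℝ≥0) (x : Fin k' → Bool) (τ : κ ⊕ ι → Bool) :
    (Γ.subst φ pins).val η x τ =
      (pins.map (fun p => if τ (Sum.inl p.1) = p.2 then (1 : ℝ≥0) else 0)).prod *
        Γ.val η (fun i => Sum.elim x (τ ∘ Sum.inl) (φ i)) (τ ∘ Sum.inr) := by
  have h := sumElim_comp_subst φ x τ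
  simp only [val, subst, List.map_append, List.map_map, List.prod_append, Function.comp_def,
    Atom.val_map, Soft.val_map] at h ⊢
  rw [h, mul_left_comm]
  simp only [Soft.val, Soft.wt, Sum.elim_inr, zero_mul]

theorem Valid.subst {k' : ℕ} {κ : Type} {Γ : Gadget k ι} (h : Γ.Valid G)
    (φ : Fin k → Fin k' ⊕ κ) (pins : List (κ × Bool)) : (Γ.subst φ pins).Valid G where
  mem := by
    intro a ha
    simp only [Gadget.subst, List.mem_map] at ha
    obtain ⟨a, ha, rfl⟩ := ha
    exact h.mem a ha
  arity := by
    intro a ha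
    simp only [Gadget.subst, List.mem_map] at ha
    obtain ⟨a, ha, rfl⟩ := ha
    exact h.arity a ha
  fresh := by
    intro a ha
    simp only [Gadget.subst, List.mem_map] at ha
    obtain ⟨a, ha, rfl⟩ := ha
    obtain ⟨t, j, e⟩ := h.fresh a ha
    exact ⟨t, Sum.inr j, by simp [Atom.map, e]⟩
  nodup := by
    simp only [Gadget.subst, List.map_map]
    -- Forgetting the new auxiliary variables of type `κ` gives back the erased atoms of `Γ`, so
    -- distinctness is inherited.
    refine List.Nodup.of_map (Atom.map (fun o : Option (κ ⊕ ι) => o.bind Sum.getRight?)) ?_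
    rw [List.map_map]
    convert h.nodup using 2
    funext a
    simp only [Function.comp_apply, Atom.map_map]
    congr 1
    funext v
    rcases v with i | j
    · cases φ i <;> simp
    · simp
  coef_le := by
    intro u hu
    simp only [Gadget.subst, List.mem_append, List.mem_map] at hu
    rcases hu with ⟨p, _, rfl⟩ | ⟨u, hu, rfl⟩
    · exact zero_le_one
    · exact h.coef_le u hu

/-- Juxtaposition of two gadgets on the same terminals. -/
def mul {ι' : Type} (Γ : Gadget k ι) (Δ : Gadget k ι') : Gadget k (ι ⊕ ι') where
  atoms := Γ.atoms.map (Atom.map (Sum.map id Sum.inl)) ++ Δ.atoms.map (Atom.map (Sum.map id Sum.inr))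
  softs := Γ.softs.map (Soft.map (Sum.map id Sum.inl)) ++ Δ.softs.map (Soft.map (Sum.map id Sum.inr))

theorem val_mul {ι' : Type} (Γ : Gadget k ι) (Δ : Gadget k ι') (η : ℝ≥0) (x τ) :
    (Γ.mul Δ).val η x τ = Γ.val η x (τ ∘ Sum.inl) * Δ.val η x (τ ∘ Sum.inr) := by
  have h1 : (fun v => Sum.elim x τ (Sum.map id Sum.inl v : Fin k ⊕ (ι ⊕ ι'))) =
      Sum.elim x (τ ∘ Sum.inl) := by funext v; cases v <;> rfl
  have h2 : (fun v => Sum.elim x τ (Sum.map id Sum.inr v : Fin k ⊕ (ι ⊕ ι'))) =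
      Sum.elim x (τ ∘ Sum.inr) := by funext v; cases v <;> rfl
  simp only [val, mul, List.map_append, List.map_map, List.prod_append, Function.comp_def,
    Atom.val_map, Soft.val_map] at *
  simp only [h1, h2]
  ring

theorem Valid.mul {ι' : Type} {Γ : Gadget k ι} {Δ : Gadget k ι'} (hΓ : Γ.Valid G)
    (hΔ : Δ.Valid G) : (Γ.mul Δ).Valid G where
  mem := by
    intro a ha
    simp only [Gadget.mul, List.mem_append, List.mem_map] at ha
    rcases ha with ⟨a, ha, rfl⟩ | ⟨a, ha, rfl⟩
    exacts [hΓ.mem a ha, hΔ.mem a ha]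
  arity := by
    intro a ha
    simp only [Gadget.mul, List.mem_append, List.mem_map] at ha
    rcases ha with ⟨a, ha, rfl⟩ | ⟨a, ha, rfl⟩
    exacts [hΓ.arity a ha, hΔ.arity a ha]
  fresh := by
    intro a ha
    simp only [Gadget.mul, List.mem_append, List.mem_map] at ha
    rcases ha with ⟨a, ha, rfl⟩ | ⟨a, ha, rfl⟩
    · obtain ⟨t, j, e⟩ := hΓ.fresh a ha
      exact ⟨t, Sum.inl j, by simp [Atom.map, e]⟩
    · obtain ⟨t, j, e⟩ := hΔ.fresh a ha
      exact ⟨t, Sum.inr j, by simp [Atom.map, e]⟩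
  nodup := by
    simp only [Gadget.mul, List.map_append, List.map_map]
    refine List.Nodup.append ?_ ?_ ?_
    · refine List.Nodup.of_map (Atom.map (fun o : Option (ι ⊕ ι') => o.bind Sum.getLeft?)) ?_
      rw [List.map_map]
      convert hΓ.nodup using 2
      funext a
      simp only [Function.comp_apply, Atom.map_map]
      congr 1
      funext v
      rcases v with i | j <;> simp
    · refine List.Nodup.of_map (Atom.map (fun o : Option (ι ⊕ ι') => o.bind Sum.getRight?)) ?_
      rw [List.map_map]
      convert hΔ.nodup using 2
      funext a
      simp only [Function.comp_apply, Atom.map_map]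
      congr 1
      funext v
      rcases v with i | j <;> simp
    -- An atom of `Γ` contains an auxiliary variable from `ι`, which survives the erasure of
    -- terminals; no atom of `Δ` contains one.
    · intro p hp hq
      simp only [List.mem_map, Function.comp_apply, Atom.map_map] at hp hq
      obtain ⟨a, ha, rfl⟩ := hp
      obtain ⟨b, hb, e⟩ := hq
      obtain ⟨t, j, ht⟩ := hΓ.fresh a ha
      obtain ⟨ac, av⟩ := a
      obtain ⟨bc, bv⟩ := b
      simp only [Atom.map, Atom.mk.injEq] at e
      obtain ⟨rfl, e⟩ := e
      have := congrFun (eq_of_heq e) t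
      simp only at ht
      rw [ht] at this
      cases h : bv t <;> simp [h] at this
  coef_le := by
    intro u hu
    simp only [Gadget.mul, List.mem_append, List.mem_map] at hu
    rcases hu with ⟨u, hu, rfl⟩ | ⟨u, hu, rfl⟩
    exacts [hΓ.coef_le u hu, hΔ.coef_le u hu]

end Gadget

/-! ### Closure of soft definability under the operations -/

section Closure

variable {G : Set Constraint} {k : ℕ}

/-- Covers at once all operations that rename, pin or maximize arguments: `hlow` and `hup` say that
`f'` is the maximum of `f` over those `z` that respect the pins. A pin is a weight with coefficient
and exponent `0`, so violating it gives the value `0`. -/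
theorem SoftDefinable.subst {k' : ℕ} {κ : Type} [Fintype κ] {f : Con k} (hf : SoftDefinable G f)
    (φ : Fin k → Fin k' ⊕ κ) (pins : List (κ × Bool)) (f' : Con k')
    (hlow : ∀ x, ∃ z : κ → Bool, (∀ p ∈ pins, z p.1 = p.2) ∧
      f' x ≤ f (fun i => Sum.elim x z (φ i)))
    (hup : ∀ x (z : κ → Bool), (∀ p ∈ pins, z p.1 = p.2) →
      f (fun i => Sum.elim x z (φ i)) ≤ f' x) : SoftDefinable G f' := by
  obtain ⟨ι, _, Γ, hΓ, hs⟩ := hf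
  refine ⟨κ ⊕ ι, inferInstance, Γ.subst φ pins, hΓ.subst φ pins, fun η h0 h1 => ?_⟩
  obtain ⟨c, hc, hl, hu⟩ := hs η h0 h1
  have hone : ∀ z : κ → Bool, (∀ p ∈ pins, z p.1 = p.2) →
      (pins.map (fun p => if z p.1 = p.2 then (1 : ℝ≥0) else 0)).prod = 1 := by
    intro z hz
    apply List.prod_eq_one
    simp only [List.mem_map]
    rintro _ ⟨p, hp, rfl⟩
    simp [hz p hp]
  refine ⟨c, hc, fun x => ?_, fun x τ => ?_⟩
  · obtain ⟨z, hz, hle⟩ := hlow x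
    obtain ⟨τ, hτ⟩ := hl (fun i => Sum.elim x z (φ i))
    refine ⟨Sum.elim z τ, ?_⟩
    have e : (pins.map (fun p => if Sum.elim z τ (Sum.inl p.1) = p.2 then (1 : ℝ≥0) else 0)).prod
        = 1 := hone z hz
    rw [Gadget.val_subst, e, one_mul]
    exact (mul_le_mul_right hle c).trans hτ
  · rw [Gadget.val_subst]
    by_cases hz : ∀ p ∈ pins, (τ ∘ Sum.inl) p.1 = p.2
    · have := hone _ hz
      simp only [Function.comp_apply] at this
      rw [this, one_mul]
      exact (hu _ _).trans (mul_le_mul_right (max_le_max (hup x _ hz) le_rfl) c)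
    · push Not at hz
      obtain ⟨p, hp, hne⟩ := hz
      have : (pins.map (fun p => if τ (Sum.inl p.1) = p.2 then (1 : ℝ≥0) else 0)).prod = 0 := by
        rw [List.prod_eq_zero_iff, List.mem_map]
        exact ⟨p, hp, by simpa using hne⟩
      rw [this, zero_mul]
      exact zero_le

theorem SoftDefinable.comp {k' : ℕ} {f : Con k} (hf : SoftDefinable G f) (φ : Fin k → Fin k') :
    SoftDefinable G (fun x : Fin k' → Bool => f (fun i => x (φ i))) :=
  hf.subst (κ := Empty) (fun i => Sum.inl (φ i)) [] _
    (fun _ => ⟨fun e => e.elim, by simp, le_rfl⟩) (fun _ _ _ => le_rfl)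

theorem SoftDefinable.pin {f : Con (k + 1)} (hf : SoftDefinable G f) (i : Fin (k + 1)) (c : Bool) :
    SoftDefinable G (fun x : Fin k → Bool => f (i.insertNth c x)) := by
  have key : ∀ (x : Fin k → Bool) (z : Unit → Bool), z () = c →
      (fun j => Sum.elim x z ((i.insertNth (Sum.inr ()) Sum.inl : Fin (k + 1) → Fin k ⊕ Unit) j)) =
        i.insertNth (α := fun _ => Bool) c x := by
    intro x z hz
    funext j
    induction j using Fin.succAboveCases i <;> simp [hz]
  refine hf.subst (κ := Unit) (i.insertNth (Sum.inr ()) Sum.inl) [((), c)] _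
    (fun x => ⟨fun _ => c, by simp, ?_⟩) (fun x z hz => ?_)
  · rw [key x _ rfl]
  · rw [key x z (hz ((), c) (by simp))]

theorem SoftDefinable.maximize {d : ℕ} {f : Con (k + d)} (hf : SoftDefinable G f) :
    SoftDefinable G (fun x : Fin k → Bool =>
      Finset.univ.sup (fun y : Fin d → Bool => f (Fin.append x y))) := by
  have key : ∀ (x : Fin k → Bool) (z : Fin d → Bool),
      (fun j => Sum.elim x z ((Fin.addCases Sum.inl Sum.inr : Fin (k + d) → Fin k ⊕ Fin d) j)) =
        Fin.append x z := by
    intro x z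
    funext j
    refine Fin.addCases (fun j => ?_) (fun j => ?_) j <;> simp
  refine hf.subst (κ := Fin d) (Fin.addCases Sum.inl Sum.inr) [] _ (fun x => ?_) (fun x z _ => ?_)
  · obtain ⟨z, -, hz⟩ := Finset.exists_mem_eq_sup Finset.univ Finset.univ_nonempty
      (fun y : Fin d → Bool => f (Fin.append x y))
    refine ⟨z, by simp, ?_⟩
    rw [key, hz]
  · rw [key]
    exact Finset.le_sup (f := fun y : Fin d → Bool => f (Fin.append x y)) (Finset.mem_univ z)

/-- The threshold may be made smaller by a constant factor. -/
theorem SoftDefinable.exists_rescale {f : Con k} (hf : SoftDefinable G f) {κ : ℝ≥0}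
    (h0 : 0 < κ) (h1 : κ ≤ 1) :
    ∃ (ι : Type) (_ : Fintype ι) (Γ : Gadget k ι), Γ.Valid G ∧
      ∀ η, 0 < η → η ≤ 1 → Γ.SimulatesAt f η (κ * η) := by
  obtain ⟨ι, hι, Γ, hΓ, hs⟩ := hf
  refine ⟨ι, hι, Γ.rescale κ, hΓ.rescale h1, fun η hη0 hη1 => ?_⟩
  obtain ⟨c, hc, hl, hu⟩ := hs (κ * η) (mul_pos h0 hη0) (mul_le_one' h1 hη1)
  exact ⟨c, hc, fun x => by simpa only [Gadget.val_rescale] using hl x,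
    fun x τ => by simpa only [Gadget.val_rescale] using hu x τ⟩

/-- Both error terms of a product are bounded by one threshold times an upper bound for the other
factor, which is why each threshold must later be divided by the bound of the other constraint. -/
theorem max_mul_max_le {a b η θ P Q : ℝ≥0} (ha : a ≤ P) (hb : b ≤ Q) (hQ : 1 ≤ Q) (hθ : θ ≤ 1) :
    max a η * max b θ ≤ max (a * b) (max (η * Q) (P * θ)) := by
  rcases le_total a η with h | h <;> rcases le_total b θ with h' | h'
  · rw [max_eq_right h, max_eq_right h']
    exact le_max_of_le_right (le_max_of_le_left (mul_le_mul_right (hθ.trans hQ) η))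
  · rw [max_eq_right h, max_eq_left h']
    exact le_max_of_le_right (le_max_of_le_left (mul_le_mul_right hb η))
  · rw [max_eq_left h, max_eq_right h']
    exact le_max_of_le_right (le_max_of_le_right (mul_le_mul_left ha θ))
  · rw [max_eq_left h, max_eq_left h']
    exact le_max_left _ _

theorem exists_bound (f : Con k) : ∃ M : ℝ≥0, 1 ≤ M ∧ ∀ x, f x ≤ M :=
  ⟨max 1 (Finset.univ.sup f), le_max_left _ _,
    fun x => le_max_of_le_right (Finset.le_sup (Finset.mem_univ x))⟩

theorem SoftDefinable.mul {f g : Con k} (hf : SoftDefinable G f) (hg : SoftDefinable G g) :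
    SoftDefinable G (fun x => f x * g x) := by
  obtain ⟨P, hP, hfP⟩ := exists_bound f
  obtain ⟨Q, hQ, hgQ⟩ := exists_bound g
  have hQ0 : 0 < Q := zero_lt_one.trans_le hQ
  have hP0 : 0 < P := zero_lt_one.trans_le hP
  -- With thresholds `η / Q` for `f ≤ P` and `η / P` for `g ≤ Q`, each error term of the product is
  -- at most `η`.
  obtain ⟨ι, _, Γ, hΓ, hs⟩ := hf.exists_rescale (inv_pos.2 hQ0) (inv_le_one_of_one_le₀ hQ)
  obtain ⟨ι', _, Δ, hΔ, hs'⟩ := hg.exists_rescale (inv_pos.2 hP0) (inv_le_one_of_one_le₀ hP)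
  refine ⟨ι ⊕ ι', inferInstance, Γ.mul Δ, hΓ.mul hΔ, fun η h0 h1 => ?_⟩
  obtain ⟨c, hc, hl, hu⟩ := hs η h0 h1
  obtain ⟨c', hc', hl', hu'⟩ := hs' η h0 h1
  refine ⟨c * c', mul_pos hc hc', fun x => ?_, fun x τ => ?_⟩
  · obtain ⟨τ, hτ⟩ := hl x
    obtain ⟨τ', hτ'⟩ := hl' x
    refine ⟨Sum.elim τ τ', ?_⟩
    rw [Gadget.val_mul, mul_mul_mul_comm]
    exact mul_le_mul' hτ hτ'
  · rw [Gadget.val_mul]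
    refine (mul_le_mul' (hu x _) (hu' x _)).trans ?_
    rw [mul_mul_mul_comm]
    refine mul_le_mul_right ?_ _
    refine (max_mul_max_le (hfP x) (hgQ x) hQ
      (mul_le_one' (inv_le_one_of_one_le₀ hP) h1)).trans (max_le_max le_rfl (max_le ?_ ?_))
    · rw [mul_right_comm, inv_mul_cancel₀ hQ0.ne', one_mul]
    · rw [mul_inv_cancel_left₀ hP0.ne']

theorem SoftDefinable.normalize {f : Con k} (hf : SoftDefinable G f) {l : ℝ≥0} (hl0 : 0 < l) :
    SoftDefinable G (fun x => l * f x) := by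
  -- A factor at most `l⁻¹` absorbs the normalization constant; a factor at most `1` is required for
  -- rescaling.
  obtain ⟨ι, hι, Γ, hΓ, hs⟩ := hf.exists_rescale (κ := min 1 l⁻¹)
    (lt_min zero_lt_one (inv_pos.2 hl0)) (min_le_left _ _)
  refine ⟨ι, hι, Γ, hΓ, fun η h0 h1 => ?_⟩
  obtain ⟨c, hc, hl, hu⟩ := hs η h0 h1
  refine ⟨c * l⁻¹, mul_pos hc (inv_pos.2 hl0), fun x => ?_, fun x τ => ?_⟩
  · obtain ⟨τ, hτ⟩ := hl x
    exact ⟨τ, by rwa [mul_assoc, inv_mul_cancel_left₀ hl0.ne']⟩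
  · refine (hu x τ).trans ?_
    rw [mul_assoc]
    refine mul_le_mul_right ?_ c
    rw [mul_max_of_nonneg _ _ zero_le, inv_mul_cancel_left₀ hl0.ne']
    exact max_le_max le_rfl (mul_le_mul_left (min_le_right _ _) η)

end Closure

/-! ### Constraints without interaction between their arguments -/

section Base

variable {G : Set Constraint} {k : ℕ}

/-- Division by the larger of the two values gives the normal form with maximum `1`. The exponent is
`0`, so the weight does not depend on `η`. -/
theorem exists_soft_proportional (w : Bool → ℝ≥0) (d : Bool) (hd : w d ≠ 0) :
    ∃ (u : Soft Unit) (l : ℝ≥0), u.coef ≤ 1 ∧ 0 < l ∧ ∀ η b, u.wt η b * l = w b := by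
  obtain ⟨e, he⟩ : ∃ e, ∀ b, w b ≤ w e := by
    rcases le_total (w false) (w true) with h | h
    · exact ⟨true, by rintro (_ | _) <;> simp [h]⟩
    · exact ⟨false, by rintro (_ | _) <;> simp [h]⟩
  have he0 : 0 < w e := (pos_iff_ne_zero.2 hd).trans_le (he d)
  refine ⟨⟨(), e, w (!e) / w e, 0⟩, w e, div_le_one_of_le₀ (he _) zero_le, he0, fun η b => ?_⟩
  by_cases hb : b = e
  · simp [Soft.wt, hb]
  · have : b = !e := by cases b <;> cases e <;> simp_all
    subst this
    simp [Soft.wt, div_mul_cancel₀ _ he0.ne']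

/-- Move from `z` to `x` one coordinate at a time: by the vanishing minor, changing coordinate `i`
multiplies the value by `g (update z i (x i)) / g z`, independently of the other coordinates. The
identity is written without division. -/
theorem prod_update_of_minors {g : Con k} (z : Fin k → Bool)
    (h : ∀ i x, g x * g z = g (Function.update x i (z i)) * g (Function.update z i (x i)))
    (x : Fin k → Bool) (s : Finset (Fin k)) :
    g (s.piecewise x z) * g z ^ s.card = g z * ∏ i ∈ s, g (Function.update z i (x i)) := by
  induction s using Finset.induction_on with
  | empty => simp
  | insert i s hi ih =>
    have h1 := h i (Function.update (s.piecewise x z) i (x i))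
    have h2 : Function.update (s.piecewise x z) i (z i) = s.piecewise x z := by
      rw [Function.update_eq_self_iff]
      simp [hi]
    rw [Function.update_idem, h2, Function.update_self] at h1
    rw [Finset.piecewise_insert, Finset.card_insert_of_notMem hi, Finset.prod_insert hi, pow_succ',
      ← mul_assoc, h1, mul_right_comm, ih]
    ring

/-- Vanishing minors make `g` a multiple of a product of unary functions, so a gadget without atoms
is enough. -/
theorem softDefinable_of_minors {g : Con k}
    (h : ∀ i x z, g x * g z = g (Function.update x i (z i)) * g (Function.update z i (x i))) :
    SoftDefinable G g := by
  by_cases hg : ∃ z, g z ≠ 0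
  · obtain ⟨z, hz⟩ := hg
    have hw : ∀ i : Fin k, ∃ (u : Soft Unit) (l : ℝ≥0), u.coef ≤ 1 ∧ 0 < l ∧
        ∀ η b, u.wt η b * l = g (Function.update z i b) := fun i =>
      exists_soft_proportional (fun b => g (Function.update z i b)) (z i) (by simpa using hz)
    choose u l hu hl hul using hw
    have hL : 0 < ∏ i, l i := Finset.prod_pos (fun i _ => hl i)
    have hval : ∀ η (x : Fin k → Bool), (∏ i, (u i).wt η (x i)) =
        g z ^ k * (g z * ∏ i, l i)⁻¹ * g x := by
      intro η x
      have h1 := prod_update_of_minors z (fun i x => h i x z) x Finset.univ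
      simp only [Finset.piecewise_univ, Finset.card_univ, Fintype.card_fin, ← hul _ η,
        Finset.prod_mul_distrib] at h1
      have hne : g z * ∏ i, l i ≠ 0 := mul_ne_zero hz hL.ne'
      rw [mul_right_comm, ← div_eq_mul_inv, eq_div_iff hne, mul_comm (g z ^ k), h1]
      ring
    have hv : ∀ η x τ, Gadget.val (⟨[], (List.finRange k).map
        (fun i => (u i).map (fun _ => Sum.inl i))⟩ : Gadget k Empty) η x τ =
          ∏ i, (u i).wt η (x i) := by
      intro η x τ
      simp [Gadget.val, Fin.prod_univ_def, Function.comp_def, Soft.val_map]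
      simp [Soft.val]
    refine ⟨Empty, inferInstance, ⟨[], (List.finRange k).map
        (fun i => (u i).map (fun _ => Sum.inl i))⟩, ⟨by simp, by simp, by simp, by simp, ?_⟩,
        fun η _ _ => ⟨g z ^ k * (g z * ∏ i, l i)⁻¹, ?_, fun x => ⟨Empty.elim, ?_⟩, fun x τ => ?_⟩⟩
    · simp only [List.mem_map, List.mem_finRange, true_and]
      rintro _ ⟨i, rfl⟩
      exact hu i
    · have := pos_iff_ne_zero.2 hz
      positivity
    · rw [hv, hval]
    · rw [hv, hval]
      exact mul_le_mul_right (le_max_left _ _) _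
  · push Not at hg
    -- The zero constraint: two contradictory pins on one auxiliary variable.
    refine ⟨Unit, inferInstance, ⟨[], [⟨Sum.inr (), false, 0, 0⟩, ⟨Sum.inr (), true, 0, 0⟩]⟩,
      ⟨by simp, by simp, by simp, by simp, by simp⟩,
      fun η _ _ => ⟨1, zero_lt_one, fun x => ⟨fun _ => false, by simp [hg x]⟩, fun x τ => ?_⟩⟩
    cases h : τ () <;> simp [Gadget.val, Soft.val, Soft.wt, h]

/-! ### Soft equality -/

/-- The values of `g` when the `i`-th argument varies and the other ones are given by `y`. -/
def column (g : Con k) (i : Fin k) (y : Fin k → Bool) (b : Bool) : ℝ≥0 := g (Function.update y i b)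

/-- The vectors `a` and `a'` are linearly independent. -/
def Indep (a a' : Bool → ℝ≥0) : Prop := a false * a' true ≠ a true * a' false

/-- In the plane, proportionality is transitive through a nonzero vector: if `c` were proportional
to both, `a` and `a'` would be proportional to each other. -/
theorem Indep.indep_or {a a' : Bool → ℝ≥0} (h : Indep a a') {c : Bool → ℝ≥0} (hc : c ≠ 0) :
    Indep a c ∨ Indep c a' := by
  by_contra hcon
  simp only [Indep, not_or, not_not] at hcon h
  obtain ⟨h1, h2⟩ := hcon
  by_cases h0 : c false = 0
  · have h3 : c true ≠ 0 := fun h3 => hc (by funext b; cases b <;> simp [h0, h3])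
    simp_all
  · apply h
    have : c false * (a false * a' true) = c false * (a true * a' false) := by
      rw [mul_left_comm, h2, ← mul_assoc, h1]; ring
    exact mul_left_cancel₀ h0 this

/-- Among the pairs of columns that are independent and have the property `A`, a closest one has
only vanishing columns in between. -/
theorem exists_isolated_pair (v : (Fin k → Bool) → Bool → ℝ≥0) (A : (Bool → ℝ≥0) → Prop)
    (hA : ∀ a c, a ≠ 0 → c ≠ 0 → ¬ Indep a c → A a → A c) :
    ∀ (n : ℕ) (y y' : Fin k → Bool), hammingDist y y' ≤ n → Indep (v y) (v y') → A (v y) →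
      ∃ y y', Indep (v y) (v y') ∧ A (v y) ∧
        ∀ z, (∀ j, z j = y j ∨ z j = y' j) → z = y ∨ z = y' ∨ v z = 0 := by
  intro n
  induction n with
  | zero =>
    intro y y' hd hi _
    obtain rfl : y = y' := by simpa using hd
    exact absurd (mul_comm _ _) hi
  | succ n ih =>
    intro y y' hd hi ha
    by_cases hz : ∀ z, (∀ j, z j = y j ∨ z j = y' j) → z = y ∨ z = y' ∨ v z = 0
    · exact ⟨y, y', hi, ha, hz⟩
    push Not at hz
    obtain ⟨z, hz, hzy, hzy', hvz⟩ := hz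
    have hlt1 : hammingDist y z < hammingDist y y' := by
      apply Finset.card_lt_card
      refine ⟨fun j hj => ?_, fun hsub => hzy' ?_⟩
      · simp only [Finset.mem_filter, Finset.mem_univ, true_and] at hj ⊢
        rcases hz j with h | h
        · exact absurd h.symm hj
        · rwa [← h]
      · funext j
        by_contra hj
        have h1 := (hz j).resolve_right hj
        have : j ∈ Finset.univ.filter (fun j => y j ≠ y' j) := by
          simp only [Finset.mem_filter, Finset.mem_univ, true_and]
          rwa [← h1]
        have := hsub this
        simp only [Finset.mem_filter, Finset.mem_univ, true_and] at this
        exact this h1.symm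
    have hlt2 : hammingDist z y' < hammingDist y y' := by
      apply Finset.card_lt_card
      refine ⟨fun j hj => ?_, fun hsub => hzy ?_⟩
      · simp only [Finset.mem_filter, Finset.mem_univ, true_and] at hj ⊢
        rcases hz j with h | h
        · rwa [← h]
        · exact absurd h hj
      · funext j
        by_contra hj
        have h1 := (hz j).resolve_left hj
        have : j ∈ Finset.univ.filter (fun j => y j ≠ y' j) := by
          simp only [Finset.mem_filter, Finset.mem_univ, true_and]
          rw [← h1]
          exact fun h => hj h.symm
        have := hsub this
        simp only [Finset.mem_filter, Finset.mem_univ, true_and] at this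
        exact this h1
    -- A nonzero column strictly in between is independent of one of the two ends, and both new
    -- pairs are closer. If it replaces `y`, it is proportional to `v y` and inherits `A`.
    by_cases h : Indep (v y) (v z)
    · exact ih y z (by omega) h ha
    · exact ih z y' (by omega) ((hi.indep_or hvz).resolve_left h) (hA _ _ (fun h0 => hi (by simp [h0])) hvz h ha)

/-- The constraint `g` with a fresh copy of the `i`-th argument, and `N` pairs of atoms that make
the copy equal to the argument. -/
def eqGadget (g : Con k) (i : Fin k) (N : ℕ) (pins : List (Soft (Fin k))) (row : Soft Unit)
    (col : Fin k → Soft Unit) : Gadget k (Option (Fin N × Fin k)) where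
  atoms := ⟨⟨k, g⟩, fun t => if t = i then Sum.inr none else Sum.inl t⟩ ::
    (List.finRange N).flatMap (fun m =>
      [⟨⟨k, g⟩, fun t => if t = i then Sum.inl i else Sum.inr (some (m, t))⟩,
        ⟨⟨k, g⟩, fun t => if t = i then Sum.inr none else Sum.inr (some (m, t))⟩])
  softs := pins.map (Soft.map Sum.inl) ++ (List.finRange N).flatMap (fun m =>
    row.map (fun _ => Sum.inl i) :: row.map (fun _ => Sum.inr none) ::
      (List.finRange k).map (fun j => (col j).map (fun _ => Sum.inr (some (m, j)))))

/-- The contribution of one pair of atoms and its unary weights, where `a` is the original argument,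
`b` its copy and `Y` the private arguments. The entry `Y i` is overwritten in `column` and only
meets its own weight. -/
def pairWeight (g : Con k) (i : Fin k) (row : Soft Unit) (col : Fin k → Soft Unit) (η : ℝ≥0)
    (a b : Bool) (Y : Fin k → Bool) : ℝ≥0 :=
  column g i Y a * column g i Y b * (row.wt η a * row.wt η b * ∏ j, (col j).wt η (Y j))

theorem prod_map_flatMap {α β : Type*} (l : List α) (f : α → List β) (h : β → ℝ≥0) :
    ((l.flatMap f).map h).prod = (l.map (fun a => ((f a).map h).prod)).prod := by
  induction l with
  | nil => simp
  | cons a l ih => simp [List.flatMap_cons, ih]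

theorem eqGadget_val (g : Con k) (i : Fin k) (N : ℕ) (pins : List (Soft (Fin k))) (row : Soft Unit)
    (col : Fin k → Soft Unit) (η : ℝ≥0) (x : Fin k → Bool) (τ : Option (Fin N × Fin k) → Bool) :
    (eqGadget g i N pins row col).val η x τ =
      g (Function.update x i (τ none)) * (pins.map (fun u => u.val η x)).prod *
        ∏ m, pairWeight g i row col η (x i) (τ none) (fun j => τ (some (m, j))) := by
  have h1 : ∀ (m : Fin N) (z : Fin k ⊕ Option (Fin N × Fin k)),
      (fun t => Sum.elim x τ (if t = i then z else Sum.inr (some (m, t)))) =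
        Function.update (fun j => τ (some (m, j))) i (Sum.elim x τ z) := by
    intro m z
    funext t
    by_cases ht : t = i
    · subst ht; simp
    · simp [ht]
  have h2 : (fun t => Sum.elim x τ (if t = i then Sum.inr none else Sum.inl t)) =
      Function.update x i (τ none) := by
    funext t
    by_cases ht : t = i
    · subst ht; simp
    · simp [ht]
  simp only [Gadget.val, eqGadget, List.map_cons, List.prod_cons, prod_map_flatMap,
    List.map_append, List.prod_append, List.map_map, List.map_nil, List.prod_nil, mul_one]
  simp only [Atom.val, h1, h2, Function.comp_def, Soft.val_map, ← Fin.prod_univ_def, pairWeight,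
    Finset.prod_mul_distrib, column]
  simp only [Soft.val, Sum.elim_inl, Sum.elim_inr]
  ring

/-- The private variable at position `i' ≠ i` separates different pairs from each other and from the
first atom. Inside a pair, position `i` holds a terminal in one atom and the copy in the other. A
second position also means that `g` is not unary. -/
theorem eqGadget_valid {g : Con k} (hg : (⟨k, g⟩ : Constraint) ∈ G) {i i' : Fin k} (hi : i' ≠ i)
    (N : ℕ) {pins : List (Soft (Fin k))} {row : Soft Unit} {col : Fin k → Soft Unit}
    (hp : ∀ u ∈ pins, u.coef ≤ 1) (hr : row.coef ≤ 1) (hc : ∀ j, (col j).coef ≤ 1) :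
    (eqGadget g i N pins row col).Valid G := by
  have hform : ∀ a ∈ (eqGadget g i N pins row col).atoms, a.con = ⟨k, g⟩ := by
    intro a ha
    simp only [eqGadget, List.mem_cons, List.mem_flatMap, List.not_mem_nil, or_false] at ha
    rcases ha with rfl | ⟨m, -, rfl | rfl⟩ <;> rfl
  have hne : ∀ {v w : Fin k → Option (Option (Fin N × Fin k))},
      (⟨⟨k, g⟩, v⟩ : Atom (Option (Option (Fin N × Fin k)))) = ⟨⟨k, g⟩, w⟩ → v = w := by
    intro v w h
    simpa using h
  refine ⟨fun a ha => (hform a ha).symm ▸ hg, fun a ha => ?_, ?_, ?_, ?_⟩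
  · rw [hform a ha]
    rintro (rfl : k = 1)
    exact hi (Subsingleton.elim _ _)
  · intro a ha
    simp only [eqGadget, List.mem_cons, List.mem_flatMap, List.not_mem_nil, or_false] at ha
    rcases ha with rfl | ⟨m, -, rfl | rfl⟩
    · exact ⟨i, none, by simp⟩
    · exact ⟨i', some (m, i'), by simp [hi]⟩
    · exact ⟨i, none, by simp⟩
  · simp only [eqGadget, List.map_cons, List.map_flatMap, List.nodup_cons, List.map_nil]
    constructor
    · simp only [List.mem_flatMap, List.mem_cons, List.not_mem_nil, or_false, not_exists, not_and]
      rintro m -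
      rintro (h | h)
      all_goals
        have := congrFun (hne h) i'
        simp [hi] at this
    · rw [List.nodup_flatMap]
      refine ⟨fun m _ => ?_, ?_⟩
      · simp only [List.nodup_cons, List.mem_cons, List.not_mem_nil, or_false, not_false_eq_true,
          List.nodup_nil, and_true]
        intro h
        have := congrFun (hne h) i
        simp at this
      · refine (List.nodup_finRange N).imp ?_
        intro m m' hm a ha ha'
        simp only [List.mem_cons, List.not_mem_nil, or_false] at ha ha'
        rcases ha with rfl | rfl <;> rcases ha' with h | h <;>
        · have := congrFun (hne h) i'
          simp [hi] at this
          exact hm this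
  · intro u hu
    simp only [eqGadget, List.mem_append, List.mem_map, List.mem_flatMap, List.mem_cons,
      List.mem_finRange, true_and] at hu
    rcases hu with ⟨u, hu, rfl⟩ | ⟨m, rfl | rfl | ⟨j, rfl⟩⟩
    exacts [hp u hu, hr, hr, hc j]

/-- Maximized over the private arguments, a pair contributes `e` if the copy agrees with the
original and at most `t * e` if not. So agreement yields `e ^ N * g x`, and disagreement costs a
factor `t ^ N`, which by `hsmall` is enough to bring any other value of `g` below `max (g x) η`. -/
theorem eqGadget_simulatesAt {g : Con k} {i : Fin k} {N : ℕ} {pins : List (Soft (Fin k))}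
    {row : Soft Unit} {col : Fin k → Soft Unit} {η e t : ℝ≥0} (he : 0 < e)
    (hlow : ∀ a, ∃ Y, e ≤ pairWeight g i row col η a a Y)
    (hup : ∀ a b Y, pairWeight g i row col η a b Y ≤ if a = b then e else t * e)
    (hpin : ∀ x, g x ≠ 0 → (pins.map (fun u => u.val η x)).prod = 1)
    (hpin' : ∀ x, (pins.map (fun u => u.val η x)).prod ≤ 1)
    (hsmall : ∀ x b, g (Function.update x i b) * (pins.map (fun u => u.val η x)).prod * t ^ N ≤
      max (g x) η) : (eqGadget g i N pins row col).SimulatesAt g η η := by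
  refine ⟨e ^ N, pow_pos he N, fun x => ?_, fun x τ => ?_⟩
  · obtain ⟨Y, hY⟩ := hlow (x i)
    refine ⟨fun o => o.elim (x i) (fun p => Y p.2), ?_⟩
    rw [eqGadget_val]
    simp only [Option.elim, Function.update_eq_self]
    by_cases hx : g x = 0
    · simp [hx]
    · rw [hpin x hx, mul_one, mul_comm]
      refine mul_le_mul_right ?_ _
      rw [Finset.prod_const, Finset.card_univ, Fintype.card_fin]
      exact pow_le_pow_left' hY N
  · rw [eqGadget_val]
    have hprod := Finset.prod_le_pow_card (N := ℝ≥0) Finset.univ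
      (fun m : Fin N => pairWeight g i row col η (x i) (τ none) (fun j => τ (some (m, j)))) _
      (fun m _ => hup (x i) (τ none) (fun j => τ (some (m, j))))
    rw [Finset.card_univ, Fintype.card_fin] at hprod
    refine (mul_le_mul_right hprod _).trans ?_
    by_cases hx : x i = τ none
    · rw [if_pos hx, ← hx, Function.update_eq_self, mul_comm]
      refine mul_le_mul_right ?_ _
      exact (mul_le_of_le_one_right' (hpin' x)).trans (le_max_left _ _)
    · rw [if_neg hx, mul_pow, ← mul_assoc, mul_comm]
      exact mul_le_mul_right (hsmall x _) _

/-- The weights on the auxiliary variables that single out the columns `y` and `y'`. -/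
def columnSofts (y y' : Fin k → Bool) (j₀ : Fin k) (w : Soft Unit) (j : Fin k) : Soft Unit :=
  if y j = y' j then ⟨(), y j, 0, 0⟩ else if j = j₀ then w else ⟨(), true, 1, 0⟩

theorem columnSofts_coef_le {y y' : Fin k → Bool} {j₀ : Fin k} {w : Soft Unit} (hw : w.coef ≤ 1)
    (j : Fin k) : (columnSofts y y' j₀ w j).coef ≤ 1 := by
  unfold columnSofts
  split_ifs
  exacts [zero_le_one, hw, le_rfl]

theorem prod_columnSofts_of_mem {y y' : Fin k → Bool} {j₀ : Fin k} (hj : y j₀ ≠ y' j₀)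
    (w : Soft Unit) (η : ℝ≥0) {Y : Fin k → Bool} (hY : Y = y ∨ Y = y') :
    ∏ j, (columnSofts y y' j₀ w j).wt η (Y j) = w.wt η (Y j₀) := by
  rw [Finset.prod_eq_single j₀]
  · simp [columnSofts, hj]
  · intro j _ hjj
    by_cases h : y j = y' j
    · have : Y j = y j := by rcases hY with rfl | rfl <;> simp [h]
      simp [columnSofts, h, Soft.wt, this]
    · simp [columnSofts, h, hjj, Soft.wt]
  · simp

/-- The weights vanish unless `Y` lies in the subcube spanned by `y` and `y'`, and there `hiso`
leaves only the two end points. -/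
theorem pairWeight_columnSofts_le {g : Con k} {i : Fin k} {y y' : Fin k → Bool}
    (hiso : ∀ z, (∀ j, z j = y j ∨ z j = y' j) → z = y ∨ z = y' ∨ column g i z = 0)
    {j₀ : Fin k} (hj : y j₀ ≠ y' j₀) (row w : Soft Unit) (η : ℝ≥0) (a b : Bool)
    (Y : Fin k → Bool) :
    pairWeight g i row (columnSofts y y' j₀ w) η a b Y ≤
      row.wt η a * row.wt η b * max (w.wt η (y j₀) * (column g i y a * column g i y b))
        (w.wt η (y' j₀) * (column g i y' a * column g i y' b)) := by
  by_cases hY : ∀ j, Y j = y j ∨ Y j = y' j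
  · rcases hiso Y hY with rfl | rfl | h0
    · rw [pairWeight, prod_columnSofts_of_mem hj w η (Or.inl rfl)]
      calc _ = row.wt η a * row.wt η b * (w.wt η (Y j₀) * (column g i Y a * column g i Y b)) := by
            ring
        _ ≤ _ := mul_le_mul_right (le_max_left _ _) _
    · rw [pairWeight, prod_columnSofts_of_mem hj w η (Or.inr rfl)]
      calc _ = row.wt η a * row.wt η b * (w.wt η (Y j₀) * (column g i Y a * column g i Y b)) := by
            ring
        _ ≤ _ := mul_le_mul_right (le_max_right _ _) _
    · simp [pairWeight, h0]
  · push Not at hY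
    obtain ⟨j, hj1, hj2⟩ := hY
    have : ∏ j, (columnSofts y y' j₀ w j).wt η (Y j) = 0 := by
      apply Finset.prod_eq_zero (Finset.mem_univ j)
      -- Over two values, an entry different from both `y j` and `y' j` forces these to agree.
      have : y j = y' j := by
        cases h : Y j <;> cases h1 : y j <;> cases h2 : y' j <;> simp_all
      rw [columnSofts, if_pos this]
      simp [Soft.wt, hj1]
    simp [pairWeight, this]

/-- Soft equality from two independent columns `y` and `y'`, after a suitable scaling. -/
theorem eqGadget_simulatesAt_of_columns {g : Con k} {i : Fin k} {y y' : Fin k → Bool}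
    (hiso : ∀ z, (∀ j, z j = y j ∨ z j = y' j) → z = y ∨ z = y' ∨ column g i z = 0)
    {j₀ : Fin k} (hj : y j₀ ≠ y' j₀) {c : Bool} {μ t η l l' : ℝ≥0}
    (hp : 0 < column g i y c) (hs : 0 < column g i y' (!c)) (hμ : 0 < μ) (ht : t ≤ 1)
    (hr : column g i y (!c) ≤ t * (column g i y c * column g i y' (!c) * μ))
    (hq : μ * column g i y' c ≤ t) {row w : Soft Unit} (hl : 0 < l) (hl' : 0 < l')
    (hrow : row.wt η c * l = column g i y' (!c) * μ) (hrow' : row.wt η (!c) * l = 1)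
    (hw : w.wt η (y j₀) * l' = 1) (hw' : w.wt η (y' j₀) * l' = (column g i y c * μ) ^ 2)
    {N : ℕ} {pins : List (Soft (Fin k))}
    (hpin : ∀ x, g x ≠ 0 → (pins.map (fun u => u.val η x)).prod = 1)
    (hpin' : ∀ x, (pins.map (fun u => u.val η x)).prod ≤ 1)
    (hsmall : ∀ x b, g (Function.update x i b) * (pins.map (fun u => u.val η x)).prod * t ^ N ≤
      max (g x) η) : (eqGadget g i N pins row (columnSofts y y' j₀ w)).SimulatesAt g η η := by
  -- The columns are `(p, r)` for `y` and `(q, s)` for `y'`, at the arguments `c` and `!c`. Weight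
  -- `s * μ` on `c` and `1` on `!c`, and weight `1` on `y` and `(p * μ) ^ 2` on `y'`, make both
  -- diagonal entries equal to `(p * s * μ) ^ 2`: `y` is best at `c` since `μ * q ≤ 1`, and `y'` is
  -- best at `!c` since `r ≤ p * s * μ`. The factors `l` and `l'` only normalize the weights.
  set p := column g i y c with hp_def
  set q := column g i y' c with hq_def
  set r := column g i y (!c) with hr_def
  set s := column g i y' (!c) with hs_def
  have hL : 0 < l ^ 2 * l' := by positivity
  have h1 : r ≤ p * s * μ := hr.trans (mul_le_of_le_one_left' ht)
  have h2 : μ * q ≤ 1 := hq.trans ht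
  refine eqGadget_simulatesAt (e := (p * s * μ) ^ 2 * (l ^ 2 * l')⁻¹) (t := t) (by positivity)
    ?_ ?_ hpin hpin' hsmall
  · intro a
    by_cases ha : a = c
    · subst ha
      refine ⟨y, le_of_eq ?_⟩
      rw [pairWeight, prod_columnSofts_of_mem hj w η (Or.inl rfl), ← div_eq_mul_inv,
        div_eq_iff hL.ne']
      calc (p * s * μ) ^ 2 = p * p * ((s * μ) * (s * μ) * 1) := by ring
        _ = _ := by rw [← hw, ← hrow]; ring
    · obtain rfl : a = !c := by cases a <;> cases c <;> simp_all
      refine ⟨y', le_of_eq ?_⟩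
      rw [pairWeight, prod_columnSofts_of_mem hj w η (Or.inr rfl), ← div_eq_mul_inv,
        div_eq_iff hL.ne']
      calc (p * s * μ) ^ 2 = s * s * (1 * 1 * (p * μ) ^ 2) := by ring
        _ = _ := by rw [← hw', ← hrow']; ring
  · intro a b Y
    refine (pairWeight_columnSofts_le hiso hj row w η a b Y).trans ?_
    have key : ∀ A B C D : ℝ≥0, A * B * max (w.wt η (y j₀) * C) (w.wt η (y' j₀) * D) =
        (A * l) * (B * l) * max C ((p * μ) ^ 2 * D) * (l ^ 2 * l')⁻¹ := by
      intro A B C D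
      have : max C ((p * μ) ^ 2 * D) = l' * max (w.wt η (y j₀) * C) (w.wt η (y' j₀) * D) := by
        rw [mul_max_of_nonneg _ _ zero_le, ← hw', ← mul_assoc, mul_comm l', hw, one_mul]
        congr 1
        ring
      rw [← div_eq_mul_inv, eq_div_iff hL.ne', this]
      ring
    rw [key]
    -- Off the diagonal, the loss relative to the diagonal is `r / (p * s * μ)` through `y` and `μ *
    -- q` through `y'`; both are at most `t`.
    have hcross : s * μ * max (p * r) ((p * μ) ^ 2 * (q * s)) ≤ t * (p * s * μ) ^ 2 := by
      calc _ ≤ s * μ * (t * (p * (p * s * μ))) := by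
            refine mul_le_mul_right (max_le ?_ ?_) _
            · calc p * r ≤ p * (t * (p * s * μ)) := mul_le_mul_right hr p
                _ = _ := by ring
            · calc (p * μ) ^ 2 * (q * s) = p * (p * s * μ) * (μ * q) := by ring
                _ ≤ p * (p * s * μ) * t := mul_le_mul_right hq _
                _ = _ := by ring
        _ = _ := by ring
    have hcb : ∀ b : Bool, b = c ∨ b = !c := by intro b; cases b <;> cases c <;> simp
    rcases hcb a with ha | ha <;> rcases hcb b with hb | hb <;> rw [ha, hb]
    · rw [if_pos rfl, hrow]
      refine mul_le_mul_left ?_ _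
      calc _ ≤ s * μ * (s * μ) * (p * p) := by
            refine mul_le_mul_right (max_le le_rfl ?_) _
            calc (p * μ) ^ 2 * (q * q) = p * p * ((μ * q) * (μ * q)) := by ring
              _ ≤ p * p := mul_le_of_le_one_right' (mul_le_one' h2 h2)
        _ = _ := by ring
    · rw [if_neg (by simp), hrow, hrow', mul_one, ← mul_assoc t]
      exact mul_le_mul_left hcross _
    · rw [if_neg (by simp), hrow, hrow', one_mul, ← mul_assoc t,
        mul_comm (column g i y (!c)), mul_comm (column g i y' (!c)) (column g i y' c)]
      exact mul_le_mul_left hcross _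
    · rw [if_pos rfl, hrow']
      refine mul_le_mul_left ?_ _
      rw [one_mul, one_mul]
      refine max_le ?_ (le_of_eq (by ring))
      calc r * r ≤ (p * s * μ) * (p * s * μ) := mul_le_mul' h1 h1
        _ = _ := by ring

/-! ### All constraints of `G` are soft definable -/

theorem Indep.exists_lt {a a' : Bool → ℝ≥0} (h : Indep a a') :
    ∃ c, a' c * a (!c) < a c * a' (!c) := by
  rcases lt_or_gt_of_ne h with h | h
  · exact ⟨true, by simpa [mul_comm] using h⟩
  · exact ⟨false, by simpa [mul_comm] using h⟩

theorem column_congr (g : Con k) (i : Fin k) {y y' : Fin k → Bool} (h : ∀ j, j ≠ i → y j = y' j) :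
    column g i y = column g i y' := by
  funext b
  simp only [column]
  congr 1
  funext j
  by_cases hj : j = i
  · subst hj; simp
  · simp [hj, h j hj]

theorem Indep.exists_ne {g : Con k} {i : Fin k} {y y' : Fin k → Bool}
    (h : Indep (column g i y) (column g i y')) : ∃ j, j ≠ i ∧ y j ≠ y' j := by
  by_contra hcon
  push Not at hcon
  rw [column_congr g i hcon] at h
  exact h (mul_comm _ _)

/-- Soft equality of arbitrary strength: one of the two columns has a zero. -/
theorem softDefinable_of_zero_column {g : Con k} (hg : (⟨k, g⟩ : Constraint) ∈ G) {i : Fin k}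
    {y y' : Fin k → Bool} (hi : Indep (column g i y) (column g i y'))
    (hz : column g i y false = 0 ∨ column g i y true = 0) : SoftDefinable G g := by
  obtain ⟨y, y', hi, hz, hiso⟩ := exists_isolated_pair (column g i)
    (fun a => a false = 0 ∨ a true = 0)
    (by
      intro a c ha0 hc hn ha
      simp only [Indep, not_not] at hn
      by_contra hcon
      push Not at hcon
      apply ha0
      rcases ha with ha | ha
      · rw [ha, zero_mul] at hn
        have h3 := (mul_eq_zero.1 hn.symm).resolve_right hcon.1
        funext b; cases b <;> simp [ha, h3]
      · rw [ha, zero_mul] at hn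
        have h3 := (mul_eq_zero.1 hn).resolve_right hcon.2
        funext b; cases b <;> simp [ha, h3])
    _ y y' le_rfl hi hz
  obtain ⟨j₀, hj₀, hj⟩ := hi.exists_ne
  obtain ⟨c, hc⟩ := hi.exists_lt
  obtain ⟨M, hM, hgM⟩ := exists_bound g
  have hpos : 0 < column g i y c * column g i y' (!c) := zero_le.trans_lt hc
  have hp : 0 < column g i y c := pos_of_mul_pos_left hpos zero_le
  have hs : 0 < column g i y' (!c) := pos_of_mul_pos_right hpos zero_le
  -- The column of `y` has a zero and its entry `p` at `c` is positive.
  have hr : column g i y (!c) = 0 := by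
    cases c
    · exact hz.resolve_left hp.ne'
    · exact hz.resolve_right hp.ne'
  set p := column g i y c with hp_def
  set q := column g i y' c with hq_def
  set s := column g i y' (!c) with hs_def
  have hM0 : 0 < M := zero_lt_one.trans_le hM
  -- The first two bounds keep the coefficients of the weights at most `1`; the third gives `κ * η *
  -- q ≤ η / M`.
  obtain ⟨κ, hκ0, hκp, hκs, hκq⟩ : ∃ κ : ℝ≥0, 0 < κ ∧ p * κ ≤ 1 ∧ s * κ ≤ 1 ∧ κ * q ≤ 1 / M := by
    refine ⟨min (1 / p) (min (1 / s) (1 / (M * (q + 1)))), by positivity, ?_, ?_, ?_⟩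
    · rw [mul_comm, ← le_div_iff₀ hp]
      exact min_le_left _ _
    · rw [mul_comm, ← le_div_iff₀ hs]
      exact (min_le_right _ _).trans (min_le_left _ _)
    · refine (mul_le_mul' ((min_le_right _ _).trans (min_le_right _ _))
        (le_add_of_nonneg_right zero_le_one : q ≤ q + 1)).trans (le_of_eq ?_)
      have : q + 1 ≠ 0 := by positivity
      field_simp
  refine ⟨_, inferInstance, eqGadget g i 1 [] ⟨(), !c, s * κ, 1⟩
    (columnSofts y y' j₀ ⟨(), y j₀, (p * κ) ^ 2, 2⟩),
    eqGadget_valid hg hj₀ 1 (by simp) hκs (columnSofts_coef_le (pow_le_one' hκp 2)),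
    fun η hη0 hη1 => ?_⟩
  -- As `r = 0`, nothing bounds `μ` from below, so `μ = κ * η` may shrink with `η`. A single pair
  -- then has loss `η / M`, and `g ≤ M` gives an error of at most `η`.
  refine eqGadget_simulatesAt_of_columns (c := c) (μ := κ * η) (t := η / M) (l := 1) (l' := 1)
    hiso hj hp hs (mul_pos hκ0 hη0) (div_le_one_of_le₀ (hη1.trans hM) zero_le) ?_ ?_
    zero_lt_one zero_lt_one ?_ ?_ ?_ ?_ (by simp) (by simp) (fun x b => ?_)
  · rw [hr]
    exact zero_le
  · calc κ * η * q = η * (κ * q) := by ring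
      _ ≤ η * (1 / M) := mul_le_mul_right hκq η
      _ = η / M := by ring
  · simp [Soft.wt, hs_def, mul_assoc]
  · simp [Soft.wt]
  · simp [Soft.wt]
  · simp [Soft.wt, hj.symm, mul_pow, ← mul_assoc, hp_def]
  · refine le_max_of_le_right ?_
    simp only [List.map_nil, List.prod_nil, mul_one, pow_one]
    calc _ ≤ M * (η / M) := mul_le_mul_left (hgM _) _
      _ = η := mul_div_cancel₀ _ hM0.ne'

/-- The condition is `r / (p * s) < μ < 1 / q`, a nonempty interval by `h` (unbounded above for `q =
0`); `t` is the larger of the two losses. -/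
theorem exists_scaling {p q r s : ℝ≥0} (h : q * r < p * s) :
    ∃ μ t : ℝ≥0, 0 < μ ∧ t < 1 ∧ r ≤ t * (p * s * μ) ∧ μ * q ≤ t := by
  have hps : 0 < p * s := zero_le.trans_lt h
  obtain ⟨μ, hμ0, hμr, hμq⟩ : ∃ μ : ℝ≥0, 0 < μ ∧ r < p * s * μ ∧ μ * q < 1 := by
    rcases eq_or_ne q 0 with rfl | hq
    · refine ⟨r / (p * s) + 1, by positivity, ?_, by simp⟩
      rw [mul_add, mul_div_cancel₀ _ hps.ne']
      simpa using hps
    · have hq0 := pos_iff_ne_zero.2 hq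
      obtain ⟨μ, h1, h2⟩ := exists_between (show r / (p * s) < 1 / q by
        rw [div_lt_div_iff₀ hps hq0, one_mul, mul_comm]; exact h)
      refine ⟨μ, zero_le.trans_lt h1, ?_, (lt_div_iff₀ hq0).1 h2⟩
      rw [mul_comm]
      exact (div_lt_iff₀ hps).1 h1
  have hpos : 0 < p * s * μ := mul_pos hps hμ0
  refine ⟨μ, max (r / (p * s * μ)) (μ * q), hμ0, max_lt ((div_lt_one hpos).2 hμr) hμq, ?_,
    le_max_right _ _⟩
  rw [← div_le_iff₀ hpos]
  exact le_max_left _ _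

/-- If no column with a zero is independent of another one, the support is a product set. -/
theorem ne_zero_of_forall_exists {g : Con k}
    (h : ∀ i y y', Indep (column g i y) (column g i y') →
      ¬ (column g i y false = 0 ∨ column g i y true = 0))
    {z : Fin k → Bool} (hz : g z ≠ 0) {x : Fin k → Bool}
    (hx : ∀ i, ∃ x', x' i = x i ∧ g x' ≠ 0) : g x ≠ 0 := by
  have key : ∀ s : Finset (Fin k), g (s.piecewise x z) ≠ 0 := by
    intro s
    induction s using Finset.induction_on with
    | empty => simpa using hz
    | insert i s hi ih =>
      rw [Finset.piecewise_insert]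
      intro h0
      -- If changing coordinate `i` left the support, the column of `Z` would vanish at `x i` but
      -- not at `Z i`. The column of `x'` does not vanish at `x i`, so the two would be independent,
      -- and one of them has a zero.
      set Z := s.piecewise x z with hZ
      obtain ⟨x', hxi, hx'⟩ := hx i
      have e1 : column g i Z (Z i) ≠ 0 := by simpa [column] using ih
      have e2 : column g i Z (x i) = 0 := h0
      have e3 : column g i x' (x i) ≠ 0 := by simpa [column, ← hxi] using hx'
      refine h i Z x' ?_ ?_
      · unfold Indep
        cases h1 : Z i <;> cases h2 : x i <;> simp_all
      · cases h2 : x i <;> simp_all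
  simpa using key Finset.univ

/-- Here `t` is a constant of `g` and cannot be made small with `η`. On the support, enough pairs
bring the error below the least positive value of `g`; off the support, the error is removed by
pins, since the support is a product set. The gadget works with no error at all. -/
theorem softDefinable_of_box {g : Con k} (hg : (⟨k, g⟩ : Constraint) ∈ G)
    (h : ∀ i y y', Indep (column g i y) (column g i y') →
      ¬ (column g i y false = 0 ∨ column g i y true = 0)) {i : Fin k} {y y' : Fin k → Bool}
    (hi : Indep (column g i y) (column g i y')) : SoftDefinable G g := by
  classical
  obtain ⟨y, y', hi, -, hiso⟩ := exists_isolated_pair (column g i) (fun _ => True)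
    (fun _ _ _ _ _ _ => trivial) _ y y' le_rfl hi trivial
  obtain ⟨j₀, hj₀, hj⟩ := hi.exists_ne
  obtain ⟨c, hc⟩ := hi.exists_lt
  have hpos : 0 < column g i y c * column g i y' (!c) := zero_le.trans_lt hc
  have hp : 0 < column g i y c := pos_of_mul_pos_left hpos zero_le
  have hs : 0 < column g i y' (!c) := pos_of_mul_pos_right hpos zero_le
  obtain ⟨μ, t, hμ, ht, hr, hq⟩ := exists_scaling hc
  obtain ⟨M, hM, hgM⟩ := exists_bound g
  have hz : g (Function.update y i c) ≠ 0 := hp.ne'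
  set z := Function.update y i c with hz_def
  obtain ⟨x₀, hx₀, hmin⟩ := Finset.exists_min_image (Finset.univ.filter (fun x => g x ≠ 0)) g
    ⟨z, by simpa using hz⟩
  simp only [Finset.mem_filter, Finset.mem_univ, true_and] at hx₀ hmin
  have hM0 : 0 < M := zero_lt_one.trans_le hM
  -- With `t ^ N < g x₀ / M`, an error is below `g x₀`, the least positive value.
  obtain ⟨N, hN⟩ := exists_pow_lt_of_lt_one (div_pos (pos_iff_ne_zero.2 hx₀) hM0) ht
  obtain ⟨row, l, hrow1, hl, hrow⟩ := exists_soft_proportional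
    (fun b => if b = c then column g i y' (!c) * μ else 1) (!c) (by simp)
  obtain ⟨w, l', hw1, hl', hw⟩ := exists_soft_proportional
    (fun b => if b = y j₀ then 1 else (column g i y c * μ) ^ 2) (y j₀) (by simp)
  -- The value of argument `j` other than `z j` is allowed exactly if it occurs in the support.
  set pins : List (Soft (Fin k)) := (List.finRange k).map (fun j =>
    ⟨j, z j, if ∃ x, x j = !(z j) ∧ g x ≠ 0 then 1 else 0, 0⟩) with hpins
  have hpv : ∀ η x, (pins.map (fun u => u.val η x)).prod =
      ∏ j, if x j = z j ∨ ∃ x, x j = !(z j) ∧ g x ≠ 0 then (1 : ℝ≥0) else 0 := by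
    intro η x
    simp only [hpins, List.map_map, Function.comp_def, ← Fin.prod_univ_def, Soft.val, Soft.wt,
      pow_zero, mul_one]
    refine Finset.prod_congr rfl fun j _ => ?_
    by_cases h1 : x j = z j <;> simp [h1]
  have hpin_one : ∀ η x, g x ≠ 0 → (pins.map (fun u => u.val η x)).prod = 1 := by
    intro η x hx
    rw [hpv]
    refine Finset.prod_eq_one fun j _ => if_pos ?_
    by_cases h1 : x j = z j
    · exact Or.inl h1
    · exact Or.inr ⟨x, by cases h2 : x j <;> cases h3 : z j <;> simp_all, hx⟩
  have hpin_zero : ∀ η x, g x = 0 → (pins.map (fun u => u.val η x)).prod = 0 := by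
    intro η x hx
    rw [hpv]
    by_contra hne
    rw [← ne_eq, Finset.prod_ne_zero_iff] at hne
    refine ne_zero_of_forall_exists h hz (fun j => ?_) hx
    have h1 := hne j (Finset.mem_univ j)
    have h2 : x j = z j ∨ ∃ x, x j = !(z j) ∧ g x ≠ 0 := by
      by_contra hcon
      exact h1 (if_neg hcon)
    by_cases h3 : x j = z j
    · exact ⟨z, h3.symm, hz⟩
    · obtain ⟨x', hx', hgx'⟩ := h2.resolve_left h3
      exact ⟨x', by cases h4 : x j <;> cases h5 : z j <;> simp_all, hgx'⟩
  refine ⟨_, inferInstance, eqGadget g i N pins row (columnSofts y y' j₀ w),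
    eqGadget_valid hg hj₀ N ?_ hrow1 (columnSofts_coef_le hw1), fun η _ _ =>
      eqGadget_simulatesAt_of_columns hiso hj hp hs hμ ht.le hr hq hl hl'
        (by rw [hrow]; simp) (by rw [hrow]; simp) (by rw [hw]; simp)
        (by rw [hw, if_neg hj.symm]) (hpin_one η) (fun x => ?_) (fun x b => ?_)⟩
  · simp only [hpins, List.mem_map]
    rintro _ ⟨j, -, rfl⟩
    dsimp only
    split_ifs <;> simp
  · by_cases hx : g x = 0
    · simp [hpin_zero η x hx]
    · rw [hpin_one η x hx]
  · by_cases hx : g x = 0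
    · simp [hpin_zero η x hx]
    · rw [hpin_one η x hx, mul_one]
      refine le_max_of_le_left ((mul_le_mul' (hgM _) hN.le).trans ?_)
      rw [mul_div_cancel₀ _ hM0.ne']
      exact hmin x hx

/-- Three cases: an independent pair of columns with a zero, independent pairs but none with a zero,
and no independent pair. In the last case the `2 × 2` minors vanish, which includes every unary `g`.
-/
theorem softDefinable_of_mem {g : Con k} (hg : (⟨k, g⟩ : Constraint) ∈ G) : SoftDefinable G g := by
  by_cases h1 : ∃ i y y', Indep (column g i y) (column g i y') ∧
      (column g i y false = 0 ∨ column g i y true = 0)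
  · obtain ⟨i, y, y', hi, hz⟩ := h1
    exact softDefinable_of_zero_column hg hi hz
  by_cases h2 : ∃ i y y', Indep (column g i y) (column g i y')
  · obtain ⟨i, y, y', hi⟩ := h2
    refine softDefinable_of_box hg (fun i y y' hi hz => h1 ⟨i, y, y', hi, hz⟩) hi
  refine softDefinable_of_minors fun i x z => ?_
  push Not at h2
  have h3 := h2 i x z
  simp only [Indep, not_not, column] at h3
  have e1 : g x = g (Function.update x i (x i)) := by simp
  have e2 : g z = g (Function.update z i (z i)) := by simp
  rw [e1, e2, Function.update_eq_self, Function.update_eq_self, e1, e2]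
  cases h4 : x i <;> cases h5 : z i
  · rfl
  · exact h3
  · exact h3.symm
  · rfl

theorem TMaxCon.softDefinable {f : Con k} (hf : TMaxCon G f) : SoftDefinable G f := by
  induction hf with
  | base g hg => exact softDefinable_of_mem hg
  | perm g i j _ _ ih => exact ih.comp (Equiv.swap i j)
  | pin g i c _ ih => exact ih.pin i c
  | link g i j' _ ih =>
    convert ih.comp (i.insertNth j' id) using 3 with x
    funext t
    induction t using Fin.succAboveCases i <;> simp
  | expand g i _ ih => exact ih.comp i.succ.succAbove
  | mul g₁ g₂ _ _ ih₁ ih₂ => exact ih₁.mul ih₂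
  | maximize g _ ih => exact ih.maximize
  | normalize g c hc _ ih => exact ih.normalize hc

end Base

/-! ### Replacing the applications of a constraint by gadgets -/

section Block

variable {G : Set Constraint} {k A : ℕ} {ι : Type}

/-- The value of a list of constraint applications. -/
def listVal {V : Type} (l : List (Atom V)) (ρ : V → Bool) : ℝ≥0 := (l.map (fun a => a.val ρ)).prod

theorem listVal_cons {V : Type} (a : Atom V) (l : List (Atom V)) (ρ : V → Bool) :
    listVal (a :: l) ρ = a.val ρ * listVal l ρ := by simp [listVal]

theorem listVal_append {V : Type} (l l' : List (Atom V)) (ρ : V → Bool) :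
    listVal (l ++ l') ρ = listVal l ρ * listVal l' ρ := by simp [listVal]

theorem listVal_congr {l : List (Atom ℕ)} {ρ ρ' : ℕ → Bool}
    (h : ∀ a ∈ l, ∀ t, ρ (a.vars t) = ρ' (a.vars t)) : listVal l ρ = listVal l ρ' := by
  unfold listVal
  congr 1
  refine List.map_congr_left fun a ha => ?_
  simp only [Atom.val, h a ha]

/-- The variables of a gadget whose terminals are `vars` and whose auxiliary variables are the
ones from `cnt` on. -/
def place (e : ι ≃ Fin A) (cnt : ℕ) (vars : Fin k → ℕ) : Fin k ⊕ ι → ℕ :=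
  Sum.elim vars (fun j => cnt + e j)

/-- A unary weight, scaled by `l`, as a constraint application. -/
def softAtom (η l : ℝ≥0) (u : Soft ℕ) : Atom ℕ := ⟨⟨1, fun x => l * u.wt η (x 0)⟩, fun _ => u.slot⟩

/-- Unary weights, made distinct by scaling with `η⁻¹ + m`, `η⁻¹ + m + 1`, … -/
def softAtoms (η : ℝ≥0) : ℕ → List (Soft ℕ) → List (Atom ℕ)
  | _, [] => []
  | m, u :: us => softAtom η (η⁻¹ + m) u :: softAtoms η (m + 1) us

def block (Γ : Gadget k ι) (e : ι ≃ Fin A) (η : ℝ≥0) (cnt : ℕ) (vars : Fin k → ℕ) :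
    List (Atom ℕ) :=
  Γ.atoms.map (Atom.map (place e cnt vars)) ++
    softAtoms η cnt (Γ.softs.map (Soft.map (place e cnt vars)))

/-- The number of fresh variables for one gadget. -/
def stride (A : ℕ) (Γ : Gadget k ι) : ℕ := A + Γ.softs.length

theorem mem_softAtoms {η : ℝ≥0} {us : List (Soft ℕ)} {m : ℕ} {a : Atom ℕ}
    (h : a ∈ softAtoms η m us) :
    ∃ m' u, m ≤ m' ∧ m' < m + us.length ∧ u ∈ us ∧ a = softAtom η (η⁻¹ + (m' : ℕ)) u := by
  induction us generalizing m with
  | nil => simp [softAtoms] at h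
  | cons u us ih =>
    simp only [softAtoms, List.mem_cons] at h
    rcases h with rfl | h
    · exact ⟨m, u, le_rfl, by simp, by simp, rfl⟩
    · obtain ⟨m', u', h1, h2, h3, h4⟩ := ih h
      exact ⟨m', u', by omega, by simp only [List.length_cons]; omega, by simp [h3], h4⟩

theorem Soft.wt_le_one {V : Type} {u : Soft V} (hu : u.coef ≤ 1) {η : ℝ≥0} (hη : η ≤ 1)
    (b : Bool) : u.wt η b ≤ 1 := by
  unfold Soft.wt
  split_ifs
  exacts [le_rfl, mul_le_one' hu (pow_le_one' hη _)]

/-- At the preferred value of `u` the left weight is `l`, while the right one is nowhere above `l'`.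
-/
theorem softAtom_scale_le {η l l' : ℝ≥0} {u u' : Soft ℕ} (hη : η ≤ 1) (hu' : u'.coef ≤ 1)
    (h : softAtom η l u = softAtom η l' u') : l ≤ l' := by
  simp only [softAtom, Atom.mk.injEq, Sigma.mk.injEq, heq_eq_eq, true_and] at h
  have := congrFun h.1 (fun _ => u.dir)
  have h1 : u.wt η u.dir = 1 := by simp [Soft.wt]
  rw [h1, mul_one] at this
  rw [this]
  exact mul_le_of_le_one_right' (Soft.wt_le_one hu' hη _)

theorem nodup_softAtoms {η : ℝ≥0} (hη : η ≤ 1) {us : List (Soft ℕ)} (m : ℕ)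
    (hus : ∀ u ∈ us, u.coef ≤ 1) : (softAtoms η m us).Nodup := by
  induction us generalizing m with
  | nil => simp [softAtoms]
  | cons u us ih =>
    rw [softAtoms, List.nodup_cons]
    refine ⟨fun h => ?_, ih _ (fun u hu => hus u (by simp [hu]))⟩
    obtain ⟨m', u', h1, -, h3, h4⟩ := mem_softAtoms h
    have := softAtom_scale_le hη (hus u (by simp)) h4.symm
    have : m' ≤ m := by simpa using this
    omega

theorem exists_listVal_softAtoms (η : ℝ≥0) (hη : 0 < η) (us : List (Soft ℕ)) (m : ℕ) :
    ∃ L : ℝ≥0, 0 < L ∧ ∀ ρ, listVal (softAtoms η m us) ρ =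
      L * (us.map (fun u => u.val η ρ)).prod := by
  induction us generalizing m with
  | nil => exact ⟨1, zero_lt_one, by simp [softAtoms, listVal]⟩
  | cons u us ih =>
    obtain ⟨L, hL, h⟩ := ih (m + 1)
    refine ⟨(η⁻¹ + m) * L, by positivity, fun ρ => ?_⟩
    rw [softAtoms, listVal_cons, h, List.map_cons, List.prod_cons]
    simp only [softAtom, Atom.val, Soft.val]
    ring

theorem exists_listVal_block (Γ : Gadget k ι) (e : ι ≃ Fin A) (η : ℝ≥0) (hη : 0 < η) (cnt : ℕ)
    (vars : Fin k → ℕ) :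
    ∃ L : ℝ≥0, 0 < L ∧ ∀ ρ, listVal (block Γ e η cnt vars) ρ =
      L * Γ.val η (fun t => ρ (vars t)) (fun j => ρ (cnt + e j)) := by
  obtain ⟨L, hL, h⟩ := exists_listVal_softAtoms η hη
    (Γ.softs.map (Soft.map (place e cnt vars))) cnt
  refine ⟨L, hL, fun ρ => ?_⟩
  have hp : (fun v => ρ (place e cnt vars v)) =
      Sum.elim (fun t => ρ (vars t)) (fun j => ρ (cnt + e j)) := by
    funext v; cases v <;> rfl
  rw [block, listVal_append, h, Gadget.val]
  simp only [listVal, List.map_map, Function.comp_def, Atom.val_map, Soft.val_map, hp]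
  ring

/-- Applications on variables below `c`, or unary with values below `η⁻¹ + c`. -/
def OldAtom (η : ℝ≥0) (c : ℕ) (a : Atom ℕ) : Prop :=
  (a.con.1 ≠ 1 → ∀ t, a.vars t < c) ∧ (a.con.1 = 1 → ∀ x, a.con.2 x < η⁻¹ + c)

/-- One counter serves variables and scaling factors. Since `stride` adds the number of weights to
the number of auxiliary variables, everything in a block is new for the counter at its start and old
for the counter at its end. -/
def NewAtom (η : ℝ≥0) (c : ℕ) (a : Atom ℕ) : Prop :=
  (a.con.1 ≠ 1 → ∃ t, c ≤ a.vars t) ∧ (a.con.1 = 1 → ∃ x, η⁻¹ + c ≤ a.con.2 x)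

theorem NewAtom.mono {η : ℝ≥0} {c c' : ℕ} (h : c' ≤ c) {a : Atom ℕ} (ha : NewAtom η c a) :
    NewAtom η c' a :=
  ⟨fun h1 => (ha.1 h1).imp fun _ h2 => h.trans h2, fun h1 => (ha.2 h1).imp fun _ h2 =>
    (add_le_add_right (Nat.cast_le.2 h) _).trans h2⟩

theorem OldAtom.not_new {η : ℝ≥0} {c : ℕ} {a : Atom ℕ} (h : OldAtom η c a) : ¬ NewAtom η c a := by
  intro h'
  by_cases ha : a.con.1 = 1
  · obtain ⟨x, hx⟩ := h'.2 ha
    exact absurd (h.2 ha x) (not_lt.2 hx)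
  · obtain ⟨t, ht⟩ := h'.1 ha
    exact absurd (h.1 ha t) (not_lt.2 ht)

variable {Γ : Gadget k ι} {e : ι ≃ Fin A} {η : ℝ≥0} {cnt : ℕ} {vars : Fin k → ℕ}

theorem place_lt (hvars : ∀ t, vars t < cnt) (v : Fin k ⊕ ι) :
    place e cnt vars v < cnt + stride A Γ := by
  unfold stride
  rcases v with t | j
  · have := hvars t
    simp only [place, Sum.elim_inl]
    omega
  · have := (e j).2
    simp only [place, Sum.elim_inr]
    omega

theorem vars_block_lt (hvars : ∀ t, vars t < cnt) {a : Atom ℕ} (ha : a ∈ block Γ e η cnt vars)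
    (t : Fin a.con.1) : a.vars t < cnt + stride A Γ := by
  rw [block, List.mem_append] at ha
  rcases ha with ha | ha
  · obtain ⟨a, -, rfl⟩ := List.mem_map.1 ha
    exact place_lt hvars _
  · obtain ⟨m, u, -, -, hu, rfl⟩ := mem_softAtoms ha
    obtain ⟨u, -, rfl⟩ := List.mem_map.1 hu
    exact place_lt hvars _

theorem coef_le_of_mem_map (hΓ : Γ.Valid G) {φ : Fin k ⊕ ι → ℕ} :
    ∀ u ∈ Γ.softs.map (Soft.map φ), u.coef ≤ 1 := by
  intro u hu
  obtain ⟨w, hw, rfl⟩ := List.mem_map.1 hu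
  exact hΓ.coef_le w hw

theorem old_of_mem_block (hΓ : Γ.Valid G) (hη1 : η ≤ 1) (hvars : ∀ t, vars t < cnt) {a : Atom ℕ}
    (ha : a ∈ block Γ e η cnt vars) : OldAtom η (cnt + stride A Γ) a := by
  refine ⟨fun _ => vars_block_lt hvars ha, fun h1 => ?_⟩
  rw [block, List.mem_append] at ha
  rcases ha with ha | ha
  · obtain ⟨b, hb, rfl⟩ := List.mem_map.1 ha
    exact absurd h1 (hΓ.arity b hb)
  · obtain ⟨m, u, -, hm, hu, rfl⟩ := mem_softAtoms ha
    intro x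
    refine (mul_le_of_le_one_right' (Soft.wt_le_one (coef_le_of_mem_map hΓ u hu) hη1 _)).trans_lt ?_
    have : m < cnt + stride A Γ := by
      rw [List.length_map] at hm
      unfold stride
      omega
    exact add_lt_add_right (Nat.cast_lt.2 this) _

theorem new_of_mem_block (hΓ : Γ.Valid G) {a : Atom ℕ} (ha : a ∈ block Γ e η cnt vars) :
    NewAtom η cnt a := by
  rw [block, List.mem_append] at ha
  rcases ha with ha | ha
  · obtain ⟨b, hb, rfl⟩ := List.mem_map.1 ha
    refine ⟨fun _ => ?_, fun h => absurd h (hΓ.arity b hb)⟩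
    obtain ⟨t, j, h⟩ := hΓ.fresh b hb
    exact ⟨t, by simp [Atom.map, h, place]⟩
  · obtain ⟨m, u, hm, -, hu, rfl⟩ := mem_softAtoms ha
    refine ⟨fun h => absurd rfl h, fun _ => ⟨fun _ => u.dir, ?_⟩⟩
    simp [softAtom, Soft.wt, hm]

theorem nodup_block (hΓ : Γ.Valid G) (hη1 : η ≤ 1) (hvars : ∀ t, vars t < cnt) :
    (block Γ e η cnt vars).Nodup := by
  refine List.Nodup.append ?_ (nodup_softAtoms hη1 _ (coef_le_of_mem_map hΓ)) ?_
  -- Decoding the numbers from `cnt` on and forgetting the smaller ones, which are terminals, gives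
  -- the erased atoms of `Γ`.
  · refine List.Nodup.of_map (Atom.map (fun v => if h : v - cnt < A ∧ cnt ≤ v then
      some (e.symm ⟨v - cnt, h.1⟩) else none)) ?_
    rw [List.map_map]
    convert hΓ.nodup using 2
    funext a
    simp only [Function.comp_apply, Atom.map_map]
    congr 1
    funext v
    rcases v with t | j
    · exact dif_neg fun h => absurd h.2 (not_le.2 (hvars t))
    · simp [place]
  · intro a ha ha'
    obtain ⟨b, hb, rfl⟩ := List.mem_map.1 ha
    obtain ⟨m, u, -, -, -, h⟩ := mem_softAtoms ha'
    refine hΓ.arity b hb ?_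
    have := congrArg (fun a : Atom ℕ => a.con.1) h
    exact this

/-- The list of applications in which every application of `f` is replaced by a gadget with fresh
variables from `cnt` on. -/
def expandApps (f : Con k) (Γ : Gadget k ι) (e : ι ≃ Fin A) (η : ℝ≥0) : ℕ → List (Atom ℕ) →
    List (Atom ℕ)
  | _, [] => []
  | cnt, a :: l =>
    open Classical in
    if h : a.con = ⟨k, f⟩ then
      -- Later applications come first, because the program writes the result on a stack.
      expandApps f Γ e η (cnt + stride A Γ) l ++
        block Γ e η cnt (fun t => a.vars (Fin.cast (congrArg Sigma.fst h).symm t))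
    else expandApps f Γ e η cnt l ++ [a]

/-- The number of variables after the replacement. -/
def expandCount (f : Con k) (s : ℕ) : ℕ → List (Atom ℕ) → ℕ
  | cnt, [] => cnt
  | cnt, a :: l =>
    open Classical in
    if a.con = ⟨k, f⟩ then expandCount f s (cnt + s) l else expandCount f s cnt l

variable {f : Con k}

theorem le_expandCount (s cnt : ℕ) (l : List (Atom ℕ)) : cnt ≤ expandCount f s cnt l := by
  induction l generalizing cnt with
  | nil => exact le_rfl
  | cons a l ih =>
    rw [expandCount]
    split_ifs
    exacts [(Nat.le_add_right _ _).trans (ih _), ih _]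

theorem expandCount_le (s cnt : ℕ) (l : List (Atom ℕ)) :
    expandCount f s cnt l ≤ cnt + s * l.length := by
  induction l generalizing cnt with
  | nil => simp [expandCount]
  | cons a l ih =>
    rw [expandCount, List.length_cons, mul_add, mul_one]
    split_ifs
    exacts [(ih _).trans (by omega), (ih _).trans (by omega)]

theorem mem_expandApps (hΓ : Γ.Valid G) {l : List (Atom ℕ)} {a : Atom ℕ}
    (ha : a ∈ expandApps f Γ e η cnt l) : (a ∈ l ∧ a.con ≠ ⟨k, f⟩) ∨ NewAtom η cnt a := by
  induction l generalizing cnt with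
  | nil => simp [expandApps] at ha
  | cons b l ih =>
    rw [expandApps] at ha
    split_ifs at ha with h
    · rcases List.mem_append.1 ha with ha | ha
      · rcases ih ha with h' | h'
        exacts [Or.inl ⟨by simp [h'.1], h'.2⟩, Or.inr (h'.mono (Nat.le_add_right _ _))]
      · exact Or.inr (new_of_mem_block hΓ ha)
    · rcases List.mem_append.1 ha with ha | ha
      · rcases ih ha with h' | h'
        exacts [Or.inl ⟨by simp [h'.1], h'.2⟩, Or.inr h']
      · rw [List.mem_singleton] at ha
        subst ha
        exact Or.inl ⟨by simp, h⟩

/-- The original applications are old for every counter in use: their variables are below `cnt`, and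
their values are below `η⁻¹`, hence below every scaling factor. Blocks are separated from them and
from each other by the counter. -/
theorem nodup_expandApps (hΓ : Γ.Valid G) (hη1 : η ≤ 1) {l : List (Atom ℕ)} (hl : l.Nodup)
    (hvars : ∀ a ∈ l, ∀ t, a.vars t < cnt) (hcon : ∀ a ∈ l, ∀ x, a.con.2 x < η⁻¹) :
    (expandApps f Γ e η cnt l).Nodup := by
  have hold : ∀ a ∈ l, ∀ c, cnt ≤ c → OldAtom η c a := fun a ha c hc =>
    ⟨fun _ t => (hvars a ha t).trans_le hc, fun _ x =>
      (hcon a ha x).trans_le (le_add_of_nonneg_right zero_le)⟩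
  induction l generalizing cnt with
  | nil => simp [expandApps]
  | cons a l ih =>
    rw [List.nodup_cons] at hl
    have hsub : ∀ b ∈ l, b ∈ a :: l := fun b hb => by simp [hb]
    rw [expandApps]
    split_ifs with h
    · refine List.Nodup.append (ih hl.2 (fun b hb t => ?_) (fun b hb => hcon b (hsub b hb))
        (fun b hb c hc => hold b (hsub b hb) c (by omega)))
        (nodup_block hΓ hη1 fun t => hvars a (by simp) _) ?_
      · exact (hvars b (hsub b hb) t).trans_le (Nat.le_add_right _ _)
      · intro b hb hb'
        rcases mem_expandApps hΓ hb with h1 | h1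
        · exact (hold b (hsub b h1.1) cnt le_rfl).not_new (new_of_mem_block hΓ hb')
        · exact (old_of_mem_block hΓ hη1 (fun t => hvars a (by simp) _) hb').not_new h1
    · refine List.Nodup.append (ih hl.2 (fun b hb => hvars b (hsub b hb))
        (fun b hb => hcon b (hsub b hb)) (fun b hb => hold b (hsub b hb))) (by simp) ?_
      intro b hb hb'
      rw [List.mem_singleton] at hb'
      subst hb'
      rcases mem_expandApps hΓ hb with h1 | h1
      · exact hl.1 h1.1
      · exact (hold b (by simp) cnt le_rfl).not_new h1

theorem vars_expandApps_lt {l : List (Atom ℕ)} (hvars : ∀ a ∈ l, ∀ t, a.vars t < cnt)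
    {a : Atom ℕ} (ha : a ∈ expandApps f Γ e η cnt l) (t : Fin a.con.1) :
    a.vars t < expandCount f (stride A Γ) cnt l := by
  induction l generalizing cnt with
  | nil => simp [expandApps] at ha
  | cons b l ih =>
    have hsub : ∀ c ∈ l, c ∈ b :: l := fun c hc => by simp [hc]
    rw [expandApps] at ha
    rw [expandCount]
    split_ifs at ha ⊢ with h
    · rcases List.mem_append.1 ha with ha | ha
      · exact ih (fun c hc t => (hvars c (hsub c hc) t).trans_le (Nat.le_add_right _ _)) ha
      · exact (vars_block_lt (fun t => hvars b (by simp) _) ha t).trans_le (le_expandCount _ _ _)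
    · rcases List.mem_append.1 ha with ha | ha
      · exact ih (fun c hc => hvars c (hsub c hc)) ha
      · rw [List.mem_singleton] at ha
        subst ha
        exact (hvars a (by simp) t).trans_le (le_expandCount _ _ _)

theorem con_expandApps (hΓ : Γ.Valid G) {F : Set Constraint} {l : List (Atom ℕ)}
    (hF : ∀ a ∈ l, a.con ∈ {(⟨k, f⟩ : Constraint)} ∪ F ∪ unary) {a : Atom ℕ}
    (ha : a ∈ expandApps f Γ e η cnt l) : a.con ∈ G ∪ F ∪ unary := by
  induction l generalizing cnt with
  | nil => simp [expandApps] at ha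
  | cons b l ih =>
    have hsub : ∀ c ∈ l, c ∈ b :: l := fun c hc => by simp [hc]
    rw [expandApps] at ha
    split_ifs at ha with h
    · rcases List.mem_append.1 ha with ha | ha
      · exact ih (fun c hc => hF c (hsub c hc)) ha
      · rw [block, List.mem_append] at ha
        rcases ha with ha | ha
        · obtain ⟨b, hb, rfl⟩ := List.mem_map.1 ha
          exact Or.inl (Or.inl (hΓ.mem b hb))
        · obtain ⟨m, u, -, -, -, rfl⟩ := mem_softAtoms ha
          exact Or.inr rfl
    · rcases List.mem_append.1 ha with ha | ha
      · exact ih (fun c hc => hF c (hsub c hc)) ha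
      · rw [List.mem_singleton] at ha
        subst ha
        rcases hF a (by simp) with (h' | h') | h'
        exacts [absurd h' h, Or.inl (Or.inr h'), Or.inr h']

theorem listVal_le_prod {l : List (Atom ℕ)} {U : Atom ℕ → ℝ≥0} (hU : ∀ a ∈ l, ∀ x, a.con.2 x ≤ U a)
    (ρ : ℕ → Bool) : listVal l ρ ≤ (l.map U).prod := by
  induction l with
  | nil => simp [listVal]
  | cons a l ih =>
    rw [listVal_cons, List.map_cons, List.prod_cons]
    exact mul_le_mul' (hU a (by simp) _) (ih fun b hb => hU b (by simp [hb]))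

/-- The replacement preserves the values up to a constant factor and an error that is small
compared with `η`. -/
theorem exists_expandApps_bounds (hf : Γ.SimulatesAt f η η) (hη0 : 0 < η) (hη1 : η ≤ 1)
    {U : Atom ℕ → ℝ≥0} {l : List (Atom ℕ)} (hvars : ∀ a ∈ l, ∀ t, a.vars t < cnt)
    (hU1 : ∀ a, 1 ≤ U a) (hU : ∀ a ∈ l, ∀ x, a.con.2 x ≤ U a) :
    ∃ C : ℝ≥0, 0 < C ∧
      (∀ ρ, ∃ ρ', (∀ v < cnt, ρ' v = ρ v) ∧
        C * listVal l ρ ≤ listVal (expandApps f Γ e η cnt l) ρ') ∧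
      ∀ ρ, listVal (expandApps f Γ e η cnt l) ρ ≤
        C * max (listVal l ρ) (η * (l.map U).prod) := by
  induction l generalizing cnt with
  | nil =>
    exact ⟨1, zero_lt_one, fun ρ => ⟨ρ, fun _ _ => rfl, by simp [listVal, expandApps]⟩,
      fun ρ => by simp [listVal, expandApps]⟩
  | cons a l ih =>
    have hsub : ∀ c ∈ l, c ∈ a :: l := fun c hc => by simp [hc]
    have hQ1 : ∀ l : List (Atom ℕ), 1 ≤ (l.map U).prod := fun l =>
      List.one_le_prod (by simpa using fun a _ => hU1 a)
    by_cases h : a.con = ⟨k, f⟩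
    · obtain ⟨c, hc, hlow, hup⟩ := hf
      obtain ⟨C, hC, hl, hu⟩ := ih (cnt := cnt + stride A Γ)
        (fun c hc t => (hvars c (hsub c hc) t).trans_le (Nat.le_add_right _ _))
        (fun c hc => hU c (hsub c hc))
      obtain ⟨ac, av⟩ := a
      dsimp only at h
      subst h
      simp only [expandApps, dif_pos, Fin.cast_refl, id]
      obtain ⟨L, hL, hb⟩ := exists_listVal_block Γ e η hη0 cnt av
      have hav : ∀ t, av t < cnt := hvars ⟨⟨k, f⟩, av⟩ (by simp)
      refine ⟨C * (L * c), by positivity, fun ρ => ?_, fun ρ => ?_⟩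
      · obtain ⟨τ, hτ⟩ := hlow (fun t => ρ (av t))
        -- The best auxiliary values for this gadget, stored at its private variables before the
        -- later gadgets are filled in.
        set ρ₁ : ℕ → Bool := fun v => if h : v - cnt < A ∧ cnt ≤ v then
          τ (e.symm ⟨v - cnt, h.1⟩) else ρ v with hρ₁
        have h1 : ∀ v < cnt, ρ₁ v = ρ v := by
          intro v hv
          simp only [hρ₁]
          rw [dif_neg (by omega)]
        obtain ⟨ρ', hρ', hle⟩ := hl ρ₁
        refine ⟨ρ', fun v hv => (hρ' v (by omega)).trans (h1 v hv), ?_⟩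
        have e1 : (fun t => ρ' (av t)) = fun t => ρ (av t) := by
          funext t
          rw [hρ' _ ((hav t).trans_le (Nat.le_add_right _ _)), h1 _ (hav t)]
        have e2 : (fun j => ρ' (cnt + e j)) = τ := by
          funext j
          rw [hρ' _ (by have := (e j).2; unfold stride; omega)]
          simp [hρ₁]
        have e3 : listVal l ρ₁ = listVal l ρ :=
          listVal_congr fun b hb t => h1 _ (hvars b (hsub b hb) t)
        rw [listVal_append, hb, e1, e2, listVal_cons]
        calc _ = C * listVal l ρ * (L * (c * f (fun t => ρ (av t)))) := by
              simp only [Atom.val]; ring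
          _ ≤ _ := mul_le_mul' (e3 ▸ hle) (mul_le_mul_right hτ L)
      · rw [listVal_append, hb, listVal_cons, List.map_cons, List.prod_cons]
        calc _ ≤ C * max (listVal l ρ) (η * (l.map U).prod) *
              (L * (c * max (f (fun t => ρ (av t))) η)) :=
              mul_le_mul' (hu ρ) (mul_le_mul_right (hup _ _) L)
          _ = C * (L * c) * (max (f (fun t => ρ (av t))) η *
              max (listVal l ρ) (η * (l.map U).prod)) := by ring
          _ ≤ _ := by
            refine mul_le_mul_right ?_ _
            have hQ := hQ1 l
            have hf1 : f (fun t => ρ (av t)) ≤ U ⟨⟨k, f⟩, av⟩ := hU ⟨⟨k, f⟩, av⟩ (by simp) _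
            have hlQ := listVal_le_prod (fun b hb => hU b (hsub b hb)) ρ
            have hU1' := hU1 ⟨⟨k, f⟩, av⟩
            simp only [Atom.val]
            generalize f (fun t => ρ (av t)) = x at *
            generalize (l.map U).prod = Q at *
            generalize listVal l ρ = y at *
            generalize U ⟨⟨k, f⟩, av⟩ = P at *
            -- If the value of `f` is below `η`, the factor `η` already gives an error term and the
            -- rest is bounded by `Q`. Otherwise the earlier error term is multiplied by a value of
            -- at most `P`.
            rcases le_total x η with hx | hx
            · rw [max_eq_right hx]
              refine le_max_of_le_right (mul_le_mul_right ?_ η)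
              refine (max_le hlQ (mul_le_of_le_one_left' hη1)).trans ?_
              exact le_mul_of_one_le_left' hU1'
            · rw [max_eq_left hx, mul_max_of_nonneg _ _ zero_le]
              refine max_le_max le_rfl ?_
              rw [mul_left_comm]
              exact mul_le_mul_right (mul_le_mul_left hf1 Q) η
    · obtain ⟨C, hC, hl, hu⟩ := ih (cnt := cnt) (fun c hc => hvars c (hsub c hc))
        (fun c hc => hU c (hsub c hc))
      simp only [expandApps, dif_neg h]
      refine ⟨C, hC, fun ρ => ?_, fun ρ => ?_⟩
      · obtain ⟨ρ', hρ', hle⟩ := hl ρ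
        refine ⟨ρ', hρ', ?_⟩
        have e1 : a.val ρ' = a.val ρ := by
          simp only [Atom.val, fun t => hρ' _ (hvars a (by simp) t)]
        rw [listVal_append, listVal_cons, listVal_cons, e1]
        calc _ = C * listVal l ρ * a.val ρ := by ring
          _ ≤ _ := by
            simp only [listVal, List.map_nil, List.prod_nil, mul_one] at hle ⊢
            exact mul_le_mul_left hle _
      · rw [listVal_append, listVal_cons, listVal_cons, List.map_cons, List.prod_cons]
        have ha : a.val ρ ≤ U a := hU a (by simp) _
        calc _ ≤ C * max (listVal l ρ) (η * (l.map U).prod) * a.val ρ := by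
              simpa [listVal] using mul_le_mul_left (hu ρ) (a.val ρ)
          _ = C * (a.val ρ * max (listVal l ρ) (η * (l.map U).prod)) := by ring
          _ ≤ _ := by
            refine mul_le_mul_right ?_ _
            rw [mul_max_of_nonneg _ _ zero_le]
            refine max_le_max le_rfl ?_
            rw [mul_left_comm]
            exact mul_le_mul_right (mul_le_mul_left ha _) η

end Block

/-! ### The threshold computed from the word of an instance -/

/-- `min v v⁻¹` for positive `v`, and `1` otherwise. -/
def shrink (v : ℝ) : ℝ≥0 := if 0 < v then min v.toNNReal v.toNNReal⁻¹ else 1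

/-- A positive lower bound for the ratio of any two positive products of entries of a word. -/
def wordGap (w : List ℝ) : ℝ≥0 := (w.map shrink).prod

theorem shrink_pos (v : ℝ) : 0 < shrink v := by
  unfold shrink
  split_ifs with h
  · have := Real.toNNReal_pos.2 h
    positivity
  · exact zero_lt_one

theorem shrink_le_one (v : ℝ) : shrink v ≤ 1 := by
  unfold shrink
  split_ifs with h
  · rcases le_total v.toNNReal 1 with h1 | h1
    · exact (min_le_left _ _).trans h1
    · exact (min_le_right _ _).trans (inv_le_one_of_one_le₀ h1)
  · exact le_rfl

theorem wordGap_pos (w : List ℝ) : 0 < wordGap w :=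
  List.prod_induction (0 < ·) (fun _ _ => mul_pos) zero_lt_one (by simpa using fun v _ => shrink_pos v)

theorem wordGap_le_one (w : List ℝ) : wordGap w ≤ 1 :=
  List.prod_induction (· ≤ 1) (fun _ _ => mul_le_one') le_rfl (by simpa using fun v _ => shrink_le_one v)

theorem wordGap_append (w w' : List ℝ) : wordGap (w ++ w') = wordGap w * wordGap w' := by
  simp [wordGap]

theorem prod_map_le_of_mem {α : Type*} {l : List α} {h : α → ℝ≥0} (hle : ∀ a ∈ l, h a ≤ 1)
    {a : α} (ha : a ∈ l) : (l.map h).prod ≤ h a := by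
  induction l with
  | nil => simp at ha
  | cons b l ih =>
    rw [List.map_cons, List.prod_cons]
    rcases List.mem_cons.1 ha with rfl | ha
    · exact mul_le_of_le_one_right' (List.prod_induction (· ≤ 1) (fun _ _ => mul_le_one') le_rfl (by simpa using fun c hc => hle c (by simp [hc])))
    · exact (mul_le_of_le_one_left' (hle b (by simp))).trans (ih (fun c hc => hle c (by simp [hc])) ha)

/-- This keeps the given constraints below all scaling factors; the division by `4` makes the
inequality strict. -/
theorem lt_of_mem_word {w : List ℝ} {v : ℝ≥0} (hv : (v : ℝ) ∈ w) : v < (wordGap w / 4)⁻¹ := by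
  have hpos := wordGap_pos w
  rcases eq_or_ne v 0 with rfl | h0
  · positivity
  have hv0 := pos_iff_ne_zero.2 h0
  have h1 : wordGap w ≤ v⁻¹ := by
    refine (prod_map_le_of_mem (fun a _ => shrink_le_one a) hv).trans ?_
    rw [shrink, if_pos (NNReal.coe_pos.2 hv0), Real.toNNReal_coe]
    exact min_le_right _ _
  rw [lt_inv_comm₀ hv0 (by positivity)]
  exact (div_lt_self hpos (by norm_num)).trans_le h1

/-- The code of a constraint application. -/
def encAtom (a : Atom ℕ) : List ℝ :=
  (a.con.1 : ℝ) :: (List.ofFn (fun t => ((a.vars t : ℕ) : ℝ)) ++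
    (boolTuples a.con.1).map (fun x => (a.con.2 x : ℝ)))

/-- A product over the whole table instead of a maximum, so that it can be compared with `wordGap`
entry by entry. -/
def atomBound (a : Atom ℕ) : ℝ≥0 := ((boolTuples a.con.1).map (fun x => max 1 (a.con.2 x))).prod

theorem one_le_atomBound (a : Atom ℕ) : 1 ≤ atomBound a :=
  List.one_le_prod (by simp)

theorem le_atomBound (a : Atom ℕ) (x : Fin a.con.1 → Bool) : a.con.2 x ≤ atomBound a := by
  refine (le_max_right 1 _).trans (List.single_le_prod ?_ _ ?_)
  · simp
  · exact List.mem_map.2 ⟨x, mem_boolTuples _ x, rfl⟩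

theorem shrink_mul_max_le (v : ℝ≥0) : shrink v * max 1 v ≤ 1 ∧ (v ≠ 0 → shrink v * max 1 v ≤ v) := by
  rcases eq_or_ne v 0 with rfl | h0
  · simp [shrink]
  have hv0 := pos_iff_ne_zero.2 h0
  rw [shrink, if_pos (NNReal.coe_pos.2 hv0), Real.toNNReal_coe]
  rcases le_total v 1 with h1 | h1
  · rw [max_eq_left h1, mul_one]
    exact ⟨(min_le_left _ _).trans h1, fun _ => min_le_left _ _⟩
  · rw [max_eq_right h1]
    have : min v v⁻¹ * v ≤ 1 := by
      refine (mul_le_mul_left (min_le_right v v⁻¹) v).trans ?_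
      rw [inv_mul_cancel₀ h0]
    exact ⟨this, fun _ => this.trans h1⟩

/-- For each entry `v` of the table, `shrink v * max 1 v` is at most `1`, and for the chosen nonzero
entry it is at most that entry. The arity and the variable indices only decrease the gap. -/
theorem wordGap_mul_atomBound_le (a : Atom ℕ) {x : Fin a.con.1 → Bool} (hx : a.con.2 x ≠ 0) :
    wordGap (encAtom a) * atomBound a ≤ a.con.2 x := by
  have h1 : wordGap (encAtom a) ≤ wordGap ((boolTuples a.con.1).map (fun x => (a.con.2 x : ℝ))) := by
    rw [encAtom, ← List.singleton_append, ← List.append_assoc, wordGap_append]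
    exact mul_le_of_le_one_left' (wordGap_le_one _)
  refine (mul_le_mul_left h1 _).trans ?_
  rw [wordGap, atomBound, List.map_map, ← List.prod_map_mul]
  refine (prod_map_le_of_mem (h := fun x => shrink (a.con.2 x) * max 1 (a.con.2 x))
    (fun x _ => (shrink_mul_max_le _).1) (mem_boolTuples _ x)).trans ?_
  exact (shrink_mul_max_le _).2 hx

theorem wordGap_mul_prod_le {l : List (Atom ℕ)} {ρ : ℕ → Bool} (h : listVal l ρ ≠ 0) :
    wordGap (l.flatMap encAtom) * (l.map atomBound).prod ≤ listVal l ρ := by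
  induction l with
  | nil => simp [wordGap, listVal]
  | cons a l ih =>
    rw [listVal_cons] at h ⊢
    rw [List.flatMap_cons, wordGap_append, List.map_cons, List.prod_cons, mul_mul_mul_comm]
    exact mul_le_mul' (wordGap_mul_atomBound_le a (left_ne_zero_of_mul h))
      (ih (right_ne_zero_of_mul h))

/-! ### The instance produced by the reduction -/

def App.toAtom {n : ℕ} (a : App n) : Atom ℕ := ⟨a.con, fun t => a.vars t⟩

theorem App.toAtom_injective {n : ℕ} : Function.Injective (App.toAtom (n := n)) := by
  rintro ⟨c, v⟩ ⟨c', v'⟩ h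
  simp only [App.toAtom, Atom.mk.injEq] at h
  obtain ⟨rfl, h⟩ := h
  congr 1
  funext t
  exact Fin.ext (congrFun (eq_of_heq h) t)

theorem encAtom_toAtom {n : ℕ} (a : App n) : encAtom a.toAtom = encApp a := rfl

theorem exists_map_toAtom {n : ℕ} {l : List (Atom ℕ)} (h : ∀ a ∈ l, ∀ t, a.vars t < n) :
    ∃ L : List (App n), L.map App.toAtom = l := by
  induction l with
  | nil => exact ⟨[], rfl⟩
  | cons a l ih =>
    obtain ⟨L, hL⟩ := ih fun b hb => h b (by simp [hb])
    exact ⟨⟨a.con, fun t => ⟨a.vars t, h a (by simp) t⟩⟩ :: L, by rw [List.map_cons, hL]; rfl⟩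

theorem prod_map_eq_listVal {n : ℕ} (L : List (App n)) {σ : Fin n → Bool} {ρ : ℕ → Bool}
    (h : ∀ i : Fin n, ρ i = σ i) :
    (L.map (fun a => a.con.2 (fun t => σ (a.vars t)))).prod = listVal (L.map App.toAtom) ρ := by
  simp only [listVal, List.map_map, Function.comp_def, App.toAtom, Atom.val, h]

theorem takeD_encAssign {n n' : ℕ} (h : n ≤ n') (σ : Fin n' → Bool) :
    (encAssign σ).takeD n 0 = encAssign (fun i : Fin n => σ (Fin.castLE h i)) := by
  rw [List.takeD_eq_take 0 (by simpa [encAssign] using h)]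
  apply List.ext_getElem
  · simp [encAssign, h]
  · intro i h1 h2
    simp [encAssign]

variable {G F : Set Constraint} {k A : ℕ} {ι : Type}

/-- The applications of an instance, with natural numbers as variables. -/
def CSPInst.atoms (H : CSPInst F) : List (Atom ℕ) := H.apps.map App.toAtom

/-- The threshold used for an instance. -/
def CSPInst.threshold (H : CSPInst F) : ℝ≥0 := wordGap (encCSP H) / 4

theorem CSPInst.threshold_pos (H : CSPInst F) : 0 < H.threshold :=
  div_pos (wordGap_pos _) (by norm_num)

theorem CSPInst.threshold_le_one (H : CSPInst F) : H.threshold ≤ 1 :=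
  div_le_one_of_le₀ ((wordGap_le_one _).trans (by norm_num)) zero_le

theorem encCSP_eq (H : CSPInst F) :
    encCSP H = List.replicate H.n (1 : ℝ) ++ (0 : ℝ) :: H.atoms.flatMap encAtom := by
  simp only [encCSP, CSPInst.atoms, List.flatMap_map, encAtom_toAtom]

theorem CSPInst.atoms_vars_lt (H : CSPInst F) : ∀ a ∈ H.atoms, ∀ t, a.vars t < H.n := by
  intro a ha t
  obtain ⟨b, -, rfl⟩ := List.mem_map.1 ha
  exact (b.vars t).2

theorem isApprox_zero {P : MaxProblem} {α : ℝ} {x : P.Inst} {y : P.Sol x}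
    (h : ∀ y, P.measure x y = 0) : P.IsApprox α x (P.encSol x y) :=
  ⟨y, rfl, 0, ⟨⟨y, h y⟩, by rintro _ ⟨z, rfl⟩; rw [h z]⟩, fun _ => h y, fun h0 => absurd rfl h0⟩

theorem exists_isGreatest_measure (H : CSPInst F) :
    ∃ opt, IsGreatest (Set.range ((maxProdCSP F).measure H)) opt := by
  obtain ⟨σ, hσ⟩ := Finite.exists_max (α := Fin H.n → Bool) ((maxProdCSP F).measure H)
  exact ⟨_, ⟨σ, rfl⟩, by rintro _ ⟨τ, rfl⟩; exact hσ τ⟩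

/-- The instance in which all applications of `f` are replaced by gadgets; approximate solutions
restrict to approximate solutions. -/
theorem exists_reduced_instance {f : Con k} {Γ : Gadget k ι} (e : ι ≃ Fin A) (hΓ : Γ.Valid G)
    (hf : ∀ η, 0 < η → η ≤ 1 → Γ.SimulatesAt f η η)
    (H : CSPInst ({(⟨k, f⟩ : Constraint)} ∪ F ∪ unary)) :
    ∃ H' : CSPInst (G ∪ F ∪ unary),
      encCSP H' = List.replicate (expandCount f (stride A Γ) H.n H.atoms) (1 : ℝ) ++
        (0 : ℝ) :: (expandApps f Γ e H.threshold H.n H.atoms).flatMap encAtom ∧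
      ∀ ε : ℝ, 0 < ε → ε < 1 → ∀ v, (maxProdCSP _).IsApprox ((2 : ℝ) ^ ε) H' v →
        (maxProdCSP _).IsApprox ((2 : ℝ) ^ ε) H (v.takeD H.n 0) := by
  set η := H.threshold with hη
  set n' := expandCount f (stride A Γ) H.n H.atoms with hn'
  have hnn : H.n ≤ n' := le_expandCount _ _ _
  obtain ⟨L, hL⟩ := exists_map_toAtom (fun a ha t =>
    vars_expandApps_lt (f := f) (Γ := Γ) (e := e) (η := η) H.atoms_vars_lt ha t)
  have hnodup : H.atoms.Nodup := H.nodup.map App.toAtom_injective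
  have hcon : ∀ a ∈ H.atoms, ∀ x, a.con.2 x < η⁻¹ := by
    intro a ha x
    apply lt_of_mem_word
    rw [encCSP_eq]
    refine List.mem_append_right _ (List.mem_cons_of_mem _ (List.mem_flatMap.2 ⟨a, ha, ?_⟩))
    exact List.mem_cons_of_mem _ (List.mem_append_right _
      (List.mem_map.2 ⟨x, mem_boolTuples _ x, rfl⟩))
  have hLnodup : L.Nodup := by
    refine List.Nodup.of_map App.toAtom ?_
    rw [hL]
    exact nodup_expandApps hΓ H.threshold_le_one hnodup H.atoms_vars_lt hcon
  have hLmem : ∀ a ∈ L, a.con ∈ G ∪ F ∪ unary := by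
    intro a ha
    refine con_expandApps (a := a.toAtom) (e := e) (η := η) (cnt := H.n) (f := f) (l := H.atoms)
      hΓ ?_ ?_
    · intro b hb
      obtain ⟨c, hc, rfl⟩ := List.mem_map.1 hb
      exact H.mem c hc
    · rw [← hL]
      exact List.mem_map_of_mem ha
  refine ⟨⟨n', L, hLnodup, hLmem⟩, ?_, ?_⟩
  · rw [encCSP_eq]
    simp only [CSPInst.atoms, hL]
  · intro ε hε0 hε1 v hv
    obtain ⟨σ', rfl, opt', hopt', -, happ⟩ := hv
    change Fin n' → Bool at σ'
    change (maxProdCSP _).IsApprox _ H ((encAssign σ').takeD H.n 0)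
    rw [takeD_encAssign hnn]
    set σ : Fin H.n → Bool := fun i => σ' (Fin.castLE hnn i) with hσ
    obtain ⟨opt, hopt⟩ := exists_isGreatest_measure H
    have hm : ∀ (τ : Fin H.n → Bool) (ρ : ℕ → Bool), (∀ i : Fin H.n, ρ i = τ i) →
        (maxProdCSP _).measure H τ = listVal H.atoms ρ := fun τ ρ h => prod_map_eq_listVal _ h
    by_cases h0 : opt = 0
    -- If the optimum is zero, every assignment is a solution as required.
    · refine isApprox_zero (P := maxProdCSP _) (y := σ) fun τ => ?_
      have := hopt.2 ⟨τ, rfl⟩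
      rw [h0] at this
      exact le_antisymm this zero_le
    obtain ⟨C, hC, hlow, hup⟩ := exists_expandApps_bounds (e := e)
      (hf η H.threshold_pos H.threshold_le_one) H.threshold_pos
      H.threshold_le_one H.atoms_vars_lt one_le_atomBound (fun a _ => le_atomBound a)
    -- the optimum is not lost
    obtain ⟨τ, hτ⟩ := hopt.1
    obtain ⟨ρ₁, hρ₁, hle⟩ := hlow (fun v => if h : v < H.n then τ ⟨v, h⟩ else false)
    rw [← hm τ _ (by simp), hτ] at hle
    have hCopt : C * opt ≤ opt' := by
      refine hle.trans (hopt'.2 ⟨fun i : Fin n' => ρ₁ i, ?_⟩)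
      refine (prod_map_eq_listVal L (ρ := ρ₁) fun _ => rfl).trans ?_
      rw [hL]
    have hopt'0 : opt' ≠ 0 := ((mul_pos hC (pos_iff_ne_zero.2 h0)).trans_le hCopt).ne'
    -- the error term is below the optimum
    have hgap : η * (H.atoms.map atomBound).prod ≤ opt / 4 := by
      have h1 : listVal H.atoms (fun v => if h : v < H.n then τ ⟨v, h⟩ else false) = opt := by
        rw [← hm τ _ (by simp), hτ]
      have h2 := wordGap_mul_prod_le (l := H.atoms) (h1.symm ▸ h0)
      rw [h1] at h2
      have h3 : wordGap (encCSP H) ≤ wordGap (H.atoms.flatMap encAtom) := by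
        rw [encCSP_eq, ← List.singleton_append, ← List.append_assoc, wordGap_append]
        exact mul_le_of_le_one_left' (wordGap_le_one _)
      rw [hη, CSPInst.threshold, div_mul_eq_mul_div]
      exact div_le_div_of_nonneg_right ((mul_le_mul_left h3 _).trans h2) zero_le
    have hup' := hup (fun v => if h : v < n' then σ' ⟨v, h⟩ else false)
    rw [← hm σ _ (by intro i; simp [hσ, i.2.trans_le hnn, Fin.castLE])] at hup'
    have hmeas : (maxProdCSP _).measure (⟨n', L, hLnodup, hLmem⟩ : CSPInst (G ∪ F ∪ unary)) σ' =
        listVal (expandApps f Γ e η H.n H.atoms)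
          (fun v => if h : v < n' then σ' ⟨v, h⟩ else false) := by
      refine (prod_map_eq_listVal L (ρ := fun v => if h : v < n' then σ' ⟨v, h⟩ else false)
        (fun i => dif_pos i.2)).trans ?_
      rw [hL]
    have h2 : (0 : ℝ) < 2 ^ ε := by positivity
    have h2' : (2 : ℝ) ^ ε < 4 := by
      calc (2 : ℝ) ^ ε < 2 ^ (1 : ℝ) := Real.rpow_lt_rpow_of_exponent_lt (by norm_num) hε1
        _ < 4 := by norm_num
    have h21 : (1 : ℝ) ≤ 2 ^ ε := Real.one_le_rpow (by norm_num) hε0.le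
    have hlb := (happ hopt'0).1
    rw [abs_of_nonneg (by positivity), div_le_div_iff₀ h2 (by positivity), one_mul, hmeas] at hlb
    have hoptpos : (0 : ℝ) < opt := NNReal.coe_pos.2 (pos_iff_ne_zero.2 h0)
    have hCpos : (0 : ℝ) < C := NNReal.coe_pos.2 hC
    -- Otherwise both terms of the maximum in `hup'` stay below `opt` after multiplication by `2 ^
    -- ε`, the error term because of `opt / 4` and `2 ^ ε < 4`. Then `σ'` would be worse than `opt'
    -- / 2 ^ ε`, as `C * opt ≤ opt'`.
    have key : (opt : ℝ) ≤ (maxProdCSP _).measure H σ * 2 ^ ε := by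
      by_contra hcon
      push Not at hcon
      have h4 : (max ((maxProdCSP _).measure H σ) (η * (H.atoms.map atomBound).prod) : ℝ≥0) *
          (2 : ℝ) ^ ε < opt := by
        rcases le_total ((maxProdCSP _).measure H σ) (η * (H.atoms.map atomBound).prod) with h5 | h5
        · rw [max_eq_right h5]
          have h6 : ((η * (H.atoms.map atomBound).prod : ℝ≥0) : ℝ) ≤ opt / 4 := by
            exact_mod_cast hgap
          calc _ ≤ (opt : ℝ) / 4 * 2 ^ ε := mul_le_mul_of_nonneg_right h6 h2.le
            _ < opt / 4 * 4 := mul_lt_mul_of_pos_left h2' (by positivity)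
            _ = opt := by ring
        · rw [max_eq_left h5]
          exact hcon
      have h7 : (listVal (expandApps f Γ e η H.n H.atoms)
          (fun v => if h : v < n' then σ' ⟨v, h⟩ else false) : ℝ) ≤
            C * (max ((maxProdCSP _).measure H σ) (η * (H.atoms.map atomBound).prod) : ℝ≥0) := by
        exact_mod_cast hup'
      have h8 : (C : ℝ) * opt ≤ opt' := by exact_mod_cast hCopt
      have h9 := mul_le_mul_of_nonneg_right h7 h2.le
      have h10 := mul_lt_mul_of_pos_left h4 hCpos
      rw [mul_assoc] at h9
      linarith
    refine ⟨σ, rfl, opt, hopt, fun h => absurd h h0, fun _ => ?_⟩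
    rw [abs_of_nonneg (by positivity)]
    refine ⟨?_, ?_⟩
    · rw [div_le_div_iff₀ h2 hoptpos, one_mul]
      exact key
    · refine (div_le_one_of_le₀ ?_ hoptpos.le).trans h21
      exact_mod_cast hopt.2 ⟨σ, rfl⟩

/-! ### Deterministic computations -/

/-- The effect of an instruction that neither tosses a coin nor calls the oracle. -/
def Instr.det : Instr → Store → Store
  | .const i c, s => s.push i c
  | .pop i, s => Function.update s i (s i).tail
  | .copy i j, s => s.push j (s.top i)
  | .arith o i j l, s => s.push l (o.eval (s.top i) (s.top j))
  | .coin _, s => s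
  | .query, s => s

def Instr.IsDet : Instr → Prop
  | .coin _ => False
  | .query => False
  | _ => True

theorem Instr.exec_of_isDet {a : Instr} (ha : a.IsDet) (M : Oracle) (s : Store) :
    a.exec M s = PMF.pure (a.det s) := by
  cases a <;> first | rfl | exact ha.elim

/-- `Runs p s s' t`: the program `p` leads from store `s` to store `s'` in `t` steps, without coins
and oracle calls. -/
inductive Runs : Prog → Store → Store → ℕ → Prop
  | instr {a : Instr} (ha : a.IsDet) (s : Store) : Runs (.instr a) s (a.det s) 1
  | seq {p q : Prog} {s s' s'' : Store} {t t' : ℕ} (hp : Runs p s s' t) (hq : Runs q s' s'' t') :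
      Runs (.seq p q) s s'' (t + t' + 1)
  | iteTrue {c : Test} {p q : Prog} {s s' : Store} {t : ℕ} (hc : c.holds s) (hp : Runs p s s' t) :
      Runs (.ite c p q) s s' (t + 1)
  | iteFalse {c : Test} {p q : Prog} {s s' : Store} {t : ℕ} (hc : ¬ c.holds s)
      (hq : Runs q s s' t) : Runs (.ite c p q) s s' (t + 1)
  | loopDone {c : Test} {p : Prog} {s : Store} (hc : ¬ c.holds s) : Runs (.loop c p) s s 1
  | loopStep {c : Test} {p : Prog} {s s' s'' : Store} {t t' : ℕ} (hc : c.holds s)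
      (hp : Runs p s s' t) (hl : Runs (.loop c p) s' s'' t') : Runs (.loop c p) s s'' (t + t' + 1)

/-- `c` leads to `c'` in `t` steps, without coins and oracle calls. -/
inductive Reach : ℕ → Config → Config → Prop
  | refl (c : Config) : Reach 0 c c
  | head {t : ℕ} {c d c' : Config} (hq : c.1.head? ≠ some (.instr .query))
      (hs : ∀ M, step M c = PMF.pure d) (h : Reach t d c') : Reach (t + 1) c c'

theorem Reach.trans {t t' : ℕ} {c d c' : Config} (h : Reach t c d) (h' : Reach t' d c') :
    Reach (t + t') c c' := by
  induction h with
  | refl => simpa using h'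
  | head hq hs _ ih => rw [Nat.add_right_comm]; exact .head hq hs (ih h')

theorem Runs.reach {p : Prog} {s s' : Store} {t : ℕ} (h : Runs p s s' t) (r : List Prog) :
    Reach t (p :: r, s) (r, s') := by
  induction h generalizing r with
  | instr ha s =>
    refine .head ?_ (fun M => ?_) (.refl _)
    · rintro h
      simp only [List.head?_cons, Option.some.injEq, Prog.instr.injEq] at h
      subst h
      exact ha
    · simp only [step, Instr.exec_of_isDet ha, PMF.pure_map]
  | seq _ _ ihp ihq => exact .head (by simp) (fun M => rfl) ((ihp _).trans (ihq _))
  | iteTrue hc _ ih => exact .head (by simp) (fun M => by simp only [step, if_pos hc]) (ih _)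
  | iteFalse hc _ ih => exact .head (by simp) (fun M => by simp only [step, if_neg hc]) (ih _)
  | loopDone hc => exact .head (by simp) (fun M => by simp only [step, if_neg hc]) (.refl _)
  | loopStep hc _ _ ihp ihl =>
    exact .head (by simp) (fun M => by simp only [step, if_pos hc]) ((ihp _).trans (ihl _))

/-- `run` adds steps at the end; following a computation from its start requires splitting off the
first step. -/
theorem run_succ (M : Oracle) (t : ℕ) (c : Config) :
    run M (t + 1) c = (step M c).bind (run M t) := by
  induction t generalizing c with
  | zero => simp [run]
  | succ t ih =>
    rw [run, ih, PMF.bind_bind]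
    rfl

theorem Reach.run_add {t : ℕ} {c d : Config} (h : Reach t c d) (M : Oracle) (u : ℕ) :
    run M (t + u) c = run M u d := by
  induction h with
  | refl => simp
  | head _ hs _ ih => rw [Nat.add_right_comm, run_succ, hs, PMF.pure_bind, ih]

theorem Reach.head?_ne {t : ℕ} {c d : Config} (h : Reach t c d) (M : Oracle) {u : ℕ} (hu : u < t)
    {c' : Config} (hc' : c' ∈ (run M u c).support) : c'.1.head? ≠ some (.instr .query) := by
  induction h generalizing u with
  | refl => omega
  | head hq hs _ ih =>
    cases u with
    | zero =>
      simp only [run, PMF.support_pure, Set.mem_singleton_iff] at hc'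
      rwa [hc']
    | succ u =>
      rw [run_succ, hs, PMF.pure_bind] at hc'
      exact ih (by omega) hc'

theorem run_halted (M : Oracle) (t : ℕ) (s : Store) : run M t ([], s) = PMF.pure ([], s) := by
  induction t with
  | zero => rfl
  | succ t ih => rw [run_succ, step, PMF.pure_bind, ih]

theorem Reach.run_of_le {t : ℕ} {c : Config} {s : Store} (h : Reach t c ([], s)) (M : Oracle)
    {u : ℕ} (hu : t ≤ u) : run M u c = PMF.pure ([], s) := by
  obtain ⟨v, rfl⟩ := Nat.exists_eq_add_of_le hu
  rw [h.run_add, run_halted]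

/-- The store after the oracle has answered `v`. -/
def answered (s : Store) (v : List ℝ) : Store := Function.update s answerStack v

/-- A reduction with a single oracle call, made with the given tolerance. -/
theorem aptReduces_of_single_query {P Q : MaxProblem} (pre post : Prog) (K : ℕ)
    (h : ∀ (x : P.Inst) (ε : ℝ), 0 < ε → ε < 1 → ∃ (w : Q.Inst) (s : Store) (t t' : ℕ),
      Runs pre (initial pre (P.encInst x) ε).2 s t ∧ s queryStack = Q.encInst w ∧
      s tolStack = [ε] ∧
      (∀ v, ∃ s' u, u ≤ t' ∧ Runs post (answered s v) s' u ∧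
        (Q.IsApprox ((2 : ℝ) ^ ε) w v → P.IsApprox ((2 : ℝ) ^ ε) x (s' outStack))) ∧
      t + t' + 3 ≤ K * (P.size x + 1)) : APTReduces P Q := by
  -- The tolerance is passed on unchanged, so `1 / δ` is the second variable itself. The two
  -- sequencings and the query account for the three extra steps.
  refine ⟨.seq pre (.seq (.instr .query) post), MvPolynomial.X 1,
    MvPolynomial.C (K : ℝ) * (MvPolynomial.X 0 + 1), fun M hM x ε hε0 hε1 => ?_⟩
  obtain ⟨w, s, t, t', hpre, hq, htol, hpost, hT⟩ := h x ε hε0 hε1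
  choose s' u hu hrun happ using hpost
  set N : Prog := .seq pre (.seq (.instr .query) post)
  have h1 : Reach (t + 2) (initial N (P.encInst x) ε) ([.instr .query, post], s) := by
    have := (hpre.reach [.seq (.instr .query) post]).trans
      (.head (by simp) (fun M => rfl) (.refl ([.instr .query, post], s)))
    exact .head (by simp [initial, N]) (fun M => rfl) this
  have htop : s.top tolStack = ε := by simp [Store.top, htol]
  have h2 : ∀ n, run M (t + 2 + (1 + n)) (initial N (P.encInst x) ε) =
      (M (Q.encInst w) ε).bind (fun v => run M n ([post], answered s v)) := by
    intro n
    rw [h1.run_add, add_comm 1 n, run_succ]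
    simp only [step, Instr.exec, hq, htop, PMF.map_comp, PMF.bind_map]
    rfl
  have h3 : ∀ v, Reach (u v) ([post], answered s v) ([], s' v) := fun v => (hrun v).reach []
  have hfin : run M (t + 2 + (1 + t')) (initial N (P.encInst x) ε) =
      (M (Q.encInst w) ε).map (fun v => (([], s' v) : Config)) := by
    rw [h2, ← PMF.bind_pure_comp]
    congr 1
    funext v
    exact (h3 v).run_of_le M (hu v)
  refine ⟨⟨t + 2 + (1 + t'), ?_, ?_, ?_⟩, ?_⟩
  · have : ((t + t' + 3 : ℕ) : ℝ) ≤ ((K * (P.size x + 1) : ℕ) : ℝ) := Nat.cast_le.2 hT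
    push_cast at this
    simp only [map_mul, MvPolynomial.eval_C, map_add, MvPolynomial.eval_X, map_one,
      Matrix.cons_val_zero]
    push_cast
    linarith
  · intro c hc
    rw [hfin, PMF.support_map] at hc
    obtain ⟨v, -, rfl⟩ := hc
    rfl
  -- The only randomness is the single answer of the oracle, so its success probability carries over
  -- without amplification.
  · rw [hfin, PMF.toOuterMeasure_map_apply]
    refine (hM w ε hε0 hε1).trans ((M (Q.encInst w) ε).toOuterMeasure.mono ?_)
    intro v hv
    exact happ v hv
  · intro n c hc
    -- Before time `t + 2` no query is due, at that time it is the prepared one, and afterwards only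
    -- `post` runs.
    rcases lt_trichotomy n (t + 2) with hn | rfl | hn
    · exact fun h => absurd h (h1.head?_ne M hn hc)
    · rw [← add_zero (t + 2), h1.run_add] at hc
      simp only [run, PMF.support_pure, Set.mem_singleton_iff] at hc
      subst hc
      refine fun _ => ⟨w, ε, hq, htol, hε0, hε1, ?_⟩
      simp
    · obtain ⟨n, rfl⟩ := Nat.exists_eq_add_of_le (show t + 2 + 1 ≤ n by omega)
      rw [add_assoc, h2, PMF.mem_support_bind_iff] at hc
      obtain ⟨v, -, hc⟩ := hc
      intro hcq
      rcases lt_or_ge n (u v) with h4 | h4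
      · exact absurd hcq ((h3 v).head?_ne M h4 hc)
      · rw [(h3 v).run_of_le M h4] at hc
        simp only [PMF.support_pure, Set.mem_singleton_iff] at hc
        subst hc
        simp at hcq

/-! ### Straight-line code -/

/-- `RunsIn p s s' B`: as `Runs`, in at most `B` steps. -/
def RunsIn (p : Prog) (s s' : Store) (B : ℕ) : Prop := ∃ t ≤ B, Runs p s s' t

namespace RunsIn

variable {p q : Prog} {c : Test} {s s' s'' : Store} {B B' : ℕ}

theorem mono (h : RunsIn p s s' B) (hB : B ≤ B') : RunsIn p s s' B' :=
  h.imp fun _ ht => ⟨ht.1.trans hB, ht.2⟩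

theorem seq (hp : RunsIn p s s' B) (hq : RunsIn q s' s'' B') :
    RunsIn (.seq p q) s s'' (B + B' + 1) := by
  obtain ⟨t, ht, h⟩ := hp
  obtain ⟨t', ht', h'⟩ := hq
  exact ⟨_, by omega, h.seq h'⟩

theorem iteTrue (hc : c.holds s) (hp : RunsIn p s s' B) : RunsIn (.ite c p q) s s' (B + 1) := by
  obtain ⟨t, ht, h⟩ := hp
  exact ⟨_, by omega, .iteTrue hc h⟩

theorem iteFalse (hc : ¬ c.holds s) (hq : RunsIn q s s' B) : RunsIn (.ite c p q) s s' (B + 1) := by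
  obtain ⟨t, ht, h⟩ := hq
  exact ⟨_, by omega, .iteFalse hc h⟩

theorem loopDone (hc : ¬ c.holds s) : RunsIn (.loop c p) s s 1 := ⟨1, le_rfl, .loopDone hc⟩

theorem loopStep (hc : c.holds s) (hp : RunsIn p s s' B) (hl : RunsIn (.loop c p) s' s'' B') :
    RunsIn (.loop c p) s s'' (B + B' + 1) := by
  obtain ⟨t, ht, h⟩ := hp
  obtain ⟨t', ht', h'⟩ := hl
  exact ⟨_, by omega, .loopStep hc h h'⟩

end RunsIn

def execL (l : List Instr) (s : Store) : Store := l.foldl (fun s a => a.det s) s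

theorem execL_nil (s : Store) : execL [] s = s := rfl

theorem execL_cons (a : Instr) (l : List Instr) (s : Store) :
    execL (a :: l) s = execL l (a.det s) := rfl

theorem execL_append (l l' : List Instr) (s : Store) :
    execL (l ++ l') s = execL l' (execL l s) := List.foldl_append

theorem update_push_tail (s : Store) (i : ℕ) (a : ℝ) :
    Function.update (s.push i a) i (s.push i a i).tail = s := by
  simp [Store.push]

/-- A push that is undone at once stands in for an idle instruction. -/
def skip : Prog := .seq (.instr (.const 0 0)) (.instr (.pop 0))

theorem runsIn_skip (s : Store) : RunsIn skip s s 3 := by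
  refine ⟨3, le_rfl, ?_⟩
  have := Runs.seq (Runs.instr (a := .const 0 0) trivial s) (Runs.instr (a := .pop 0) trivial _)
  simp only [Instr.det, update_push_tail] at this
  exact this

/-- A list of instructions as a program. -/
def straight : List Instr → Prog
  | [] => skip
  | a :: l => .seq (.instr a) (straight l)

theorem runsIn_straight {l : List Instr} (hl : ∀ a ∈ l, a.IsDet) (s : Store) :
    RunsIn (straight l) s (execL l s) (2 * l.length + 3) := by
  induction l generalizing s with
  | nil => exact runsIn_skip s
  | cons a l ih =>
    have h1 : RunsIn (.instr a) s (a.det s) 1 := ⟨1, le_rfl, .instr (hl a (by simp)) s⟩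
    refine (h1.seq (ih (fun b hb => hl b (by simp [hb])) _)).mono ?_
    simp only [List.length_cons]
    omega

/-- Arithmetic expressions over the tops of the stacks. -/
inductive Ex
  | const (c : ℝ)
  | reg (i : ℕ)
  | op (o : ArithOp) (a b : Ex)

namespace Ex

def eval (s : Store) : Ex → ℝ
  | const c => c
  | reg i => s.top i
  | op o a b => o.eval (a.eval s) (b.eval s)

/-- All stacks used by the expression satisfy `p`. -/
def Uses (p : ℕ → Prop) : Ex → Prop
  | const _ => True
  | reg i => p i
  | op _ a b => a.Uses p ∧ b.Uses p

theorem Uses.mono {p q : ℕ → Prop} (hpq : ∀ i, p i → q i) : ∀ {e : Ex}, e.Uses p → e.Uses q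
  | const _, _ => trivial
  | reg i, h => hpq i h
  | op _ _ _, h => ⟨Uses.mono hpq h.1, Uses.mono hpq h.2⟩

theorem eval_congr {p : ℕ → Prop} {s s' : Store} (h : ∀ i, p i → s i = s' i) :
    ∀ {e : Ex}, e.Uses p → e.eval s = e.eval s'
  | const _, _ => rfl
  | reg i, hi => by simp only [eval, Store.top, h i hi]
  | op _ _ _, he => by simp only [eval, eval_congr h he.1, eval_congr h he.2]

/-- Code that pushes the value of the expression on stack `m`, using the stacks from `m` on. -/
def code : ℕ → Ex → List Instr
  | m, const c => [.const m c]
  | m, reg i => [.copy i m]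
  | m, op o a b => a.code m ++ b.code (m + 1) ++
      [.arith o m (m + 1) (m + 2), .pop m, .pop (m + 1), .copy (m + 2) m, .pop (m + 2)]

theorem code_isDet (m : ℕ) (e : Ex) : ∀ a ∈ e.code m, a.IsDet := by
  induction e generalizing m with
  | const c => simp [code, Instr.IsDet]
  | reg i => simp [code, Instr.IsDet]
  | op o a b iha ihb =>
    intro i hi
    simp only [code, List.mem_append] at hi
    rcases hi with (hi | hi) | hi
    · exact iha _ i hi
    · exact ihb _ i hi
    · simp only [List.mem_cons, List.not_mem_nil, or_false] at hi
      rcases hi with rfl | rfl | rfl | rfl | rfl <;> trivial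

/-- An expression that reads only stacks below `m` is not disturbed by intermediate results, which
live on the stacks from `m` on. -/
theorem execL_code (e : Ex) (m : ℕ) (he : e.Uses (· < m)) (s : Store) :
    execL (e.code m) s = s.push m (e.eval s) := by
  induction e generalizing m s with
  | const c => rfl
  | reg i => rfl
  | op o a b iha ihb =>
    have hb : b.eval (s.push m (a.eval s)) = b.eval s :=
      eval_congr (p := (· < m)) (fun i hi => by simp [Store.push, hi.ne]) he.2
    rw [code, execL_append, execL_append, iha m he.1,
      ihb (m + 1) (he.2.mono fun i hi => Nat.lt_succ_of_lt hi), hb]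
    simp only [execL_cons, execL_nil, Instr.det, eval]
    funext i
    by_cases h1 : i = m
    · subst h1
      simp [Store.push, Store.top]
    · by_cases h2 : i = m + 1
      · subst h2
        simp [Store.push, Store.top]
      · by_cases h3 : i = m + 2
        · subst h3
          simp [Store.push, Store.top]
        · simp [Store.push, Store.top, h1, h2, h3]

end Ex

/-- Code that replaces the top of stack `i` by the value of an expression. -/
def setReg (m i : ℕ) (e : Ex) : List Instr := e.code m ++ [.pop i, .copy m i, .pop m]

theorem execL_setReg {m i : ℕ} {e : Ex} (he : e.Uses (· < m)) (hi : i < m) (s : Store) :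
    execL (setReg m i e) s = Function.update s i (e.eval s :: (s i).tail) := by
  rw [setReg, execL_append, e.execL_code m he]
  simp only [execL_cons, execL_nil, Instr.det]
  funext j
  by_cases h1 : j = m
  · subst h1
    simp [Store.push, Store.top, hi.ne, hi.ne']
  · by_cases h2 : j = i
    · subst h2
      simp [Store.push, Store.top, h1, hi.ne']
    · simp [Store.push, h1, h2]

theorem setReg_isDet (m i : ℕ) (e : Ex) : ∀ a ∈ setReg m i e, a.IsDet := by
  intro a ha
  simp only [setReg, List.mem_append, List.mem_cons, List.not_mem_nil, or_false] at ha
  rcases ha with ha | rfl | rfl | rfl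
  exacts [e.code_isDet m a ha, trivial, trivial, trivial]

/-- Code that puts the values of a list of expressions on stack `2`. -/
def emit (m : ℕ) : List Ex → List Instr
  | [] => []
  -- The last expression is written first, so that the first one ends on top. Expressions must not
  -- read stack `2`, which changes meanwhile.
  | e :: es => emit m es ++ e.code m ++ [.copy m 2, .pop m]

theorem execL_emit {m : ℕ} (hm : 2 < m) {es : List Ex} (he : ∀ e ∈ es, e.Uses (fun i => i < m ∧ i ≠ 2))
    (s : Store) : execL (emit m es) s = Function.update s 2 (es.map (fun e => e.eval s) ++ s 2) := by
  induction es with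
  | nil => simp [emit, execL_nil]
  | cons e es ih =>
    have h1 : e.eval (Function.update s 2 (es.map (fun e => e.eval s) ++ s 2)) = e.eval s :=
      Ex.eval_congr (p := fun i => i < m ∧ i ≠ 2) (fun i hi => by simp [hi.2]) (he e (by simp))
    rw [emit, execL_append, execL_append, ih fun e' he' => he e' (by simp [he']),
      e.execL_code m ((he e (by simp)).mono fun i hi => hi.1), h1]
    simp only [execL_cons, execL_nil, Instr.det]
    funext j
    by_cases h1 : j = m
    · subst h1
      simp [Store.push, hm.ne, hm.ne']
    · by_cases h2 : j = 2
      · subst h2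
        simp [Store.push, Store.top, hm.ne]
      · simp [Store.push, h1, h2]

theorem emit_isDet (m : ℕ) (es : List Ex) : ∀ a ∈ emit m es, a.IsDet := by
  induction es with
  | nil => simp [emit]
  | cons e es ih =>
    intro a ha
    simp only [emit, List.mem_append, List.mem_cons, List.not_mem_nil, or_false] at ha
    rcases ha with (ha | ha) | rfl | rfl
    exacts [ih a ha, e.code_isDet m a ha, trivial, trivial]

/-- Move the contents of stack `i` to stack `j`, in reverse order. -/
def moveLoop (i j : ℕ) : Prog := .loop (.nonempty i) (straight [.copy i j, .pop i])

theorem runsIn_moveLoop {i j : ℕ} (hij : i ≠ j) (l : List ℝ) (s : Store) (hs : s i = l) :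
    RunsIn (moveLoop i j) s (Function.update (Function.update s i []) j (l.reverse ++ s j))
      (8 * l.length + 1) := by
  induction l generalizing s with
  | nil =>
    have : Function.update (Function.update s i []) j ([].reverse ++ s j) = s := by
      have h0 : Function.update s i [] = s := by rw [← hs, Function.update_eq_self]
      rw [h0]
      simp
    rw [this]
    exact .loopDone (by simp [Test.holds, hs])
  | cons a l ih =>
    have h1 := runsIn_straight (l := [.copy i j, .pop i]) (by simp [Instr.IsDet]) s
    have h2 := ih (execL [.copy i j, .pop i] s) (by
      simp [execL, Instr.det, Store.push, hs, hij])
    have h3 : Function.update (Function.update (execL [.copy i j, .pop i] s) i []) j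
        (l.reverse ++ execL [.copy i j, .pop i] s j) =
          Function.update (Function.update s i []) j ((a :: l).reverse ++ s j) := by
      funext b
      by_cases hb : b = j
      · subst hb
        simp [execL, Instr.det, Store.push, Store.top, hs, hij.symm]
      · by_cases hb' : b = i
        · subst hb'
          simp [hb]
        · simp [execL, Instr.det, Store.push, hb, hb']
    rw [h3] at h2
    refine (RunsIn.loopStep (by simp [Test.holds, hs]) h1 h2).mono ?_
    simp only [List.length_cons, List.length_nil]
    omega

/-! ### The stacks of the reduction -/

/-- The contents of the stacks by name. Stack `11` is always empty, and the stacks from `16` on hold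
the variables of an application, followed by scratch space. -/
structure St where
  inp : List ℝ
  eps : List ℝ
  query : List ℝ
  tol : List ℝ
  ans : List ℝ
  out : List ℝ
  vars : List ℝ
  eta : List ℝ
  cnt : List ℝ
  ones : List ℝ
  tmp : List ℝ
  ar : List ℝ
  pw : List ℝ
  flag : List ℝ
  one : List ℝ
  idx : ℕ → List ℝ

namespace St

def store (S : St) : Store
  | 0 => S.inp
  | 1 => S.eps
  | 2 => S.query
  | 3 => S.tol
  | 4 => S.ans
  | 5 => S.out
  | 6 => S.vars
  | 7 => S.eta
  | 8 => S.cnt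
  | 9 => S.ones
  | 10 => S.tmp
  | 11 => []
  | 12 => S.ar
  | 13 => S.pw
  | 14 => S.flag
  | 15 => S.one
  | i + 16 => S.idx i

variable (S : St) (l : List ℝ)

@[simp] theorem store_0 : S.store 0 = S.inp := rfl
@[simp] theorem store_1 : S.store 1 = S.eps := rfl
@[simp] theorem store_2 : S.store 2 = S.query := rfl
@[simp] theorem store_3 : S.store 3 = S.tol := rfl
@[simp] theorem store_4 : S.store 4 = S.ans := rfl
@[simp] theorem store_5 : S.store 5 = S.out := rfl
@[simp] theorem store_6 : S.store 6 = S.vars := rfl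
@[simp] theorem store_7 : S.store 7 = S.eta := rfl
@[simp] theorem store_8 : S.store 8 = S.cnt := rfl
@[simp] theorem store_9 : S.store 9 = S.ones := rfl
@[simp] theorem store_10 : S.store 10 = S.tmp := rfl
@[simp] theorem store_11 : S.store 11 = [] := rfl
@[simp] theorem store_12 : S.store 12 = S.ar := rfl
@[simp] theorem store_13 : S.store 13 = S.pw := rfl
@[simp] theorem store_14 : S.store 14 = S.flag := rfl
@[simp] theorem store_15 : S.store 15 = S.one := rfl
@[simp] theorem store_idx (i : ℕ) : S.store (i + 16) = S.idx i := rfl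

theorem ext_store {s : Store} (h0 : s 0 = S.inp) (h1 : s 1 = S.eps) (h2 : s 2 = S.query)
    (h3 : s 3 = S.tol) (h4 : s 4 = S.ans) (h5 : s 5 = S.out) (h6 : s 6 = S.vars)
    (h7 : s 7 = S.eta) (h8 : s 8 = S.cnt) (h9 : s 9 = S.ones) (h10 : s 10 = S.tmp)
    (h11 : s 11 = []) (h12 : s 12 = S.ar) (h13 : s 13 = S.pw) (h14 : s 14 = S.flag)
    (h15 : s 15 = S.one) (hidx : ∀ i, s (i + 16) = S.idx i) : s = S.store := by
  funext i
  match i with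
  | 0 => exact h0
  | 1 => exact h1
  | 2 => exact h2
  | 3 => exact h3
  | 4 => exact h4
  | 5 => exact h5
  | 6 => exact h6
  | 7 => exact h7
  | 8 => exact h8
  | 9 => exact h9
  | 10 => exact h10
  | 11 => exact h11
  | 12 => exact h12
  | 13 => exact h13
  | 14 => exact h14
  | 15 => exact h15
  | i + 16 => exact hidx i

@[simp] theorem update_0 : Function.update S.store 0 l = { S with inp := l }.store := by
  apply ext_store <;> simp
@[simp] theorem update_2 : Function.update S.store 2 l = { S with query := l }.store := by
  apply ext_store <;> simp
@[simp] theorem update_3 : Function.update S.store 3 l = { S with tol := l }.store := by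
  apply ext_store <;> simp
@[simp] theorem update_4 : Function.update S.store 4 l = { S with ans := l }.store := by
  apply ext_store <;> simp
@[simp] theorem update_6 : Function.update S.store 6 l = { S with vars := l }.store := by
  apply ext_store <;> simp
@[simp] theorem update_7 : Function.update S.store 7 l = { S with eta := l }.store := by
  apply ext_store <;> simp
@[simp] theorem update_8 : Function.update S.store 8 l = { S with cnt := l }.store := by
  apply ext_store <;> simp
@[simp] theorem update_9 : Function.update S.store 9 l = { S with ones := l }.store := by
  apply ext_store <;> simp
@[simp] theorem update_10 : Function.update S.store 10 l = { S with tmp := l }.store := by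
  apply ext_store <;> simp
@[simp] theorem update_12 : Function.update S.store 12 l = { S with ar := l }.store := by
  apply ext_store <;> simp
@[simp] theorem update_13 : Function.update S.store 13 l = { S with pw := l }.store := by
  apply ext_store <;> simp
@[simp] theorem update_14 : Function.update S.store 14 l = { S with flag := l }.store := by
  apply ext_store <;> simp
@[simp] theorem update_15 : Function.update S.store 15 l = { S with one := l }.store := by
  apply ext_store <;> simp
@[simp] theorem update_idx (i : ℕ) :
    Function.update S.store (i + 16) l = { S with idx := Function.update S.idx i l }.store := by
  apply ext_store <;> try simp
  intro j
  by_cases h : j = i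
  · subst h; simp
  · simp [h]

end St

/-! ### Code for the stacks of the reduction -/

def DetL (l : List Instr) : Prop := ∀ a ∈ l, a.IsDet

@[simp] theorem detL_nil : DetL [] := by simp [DetL]

@[simp] theorem detL_cons (a : Instr) (l : List Instr) : DetL (a :: l) ↔ a.IsDet ∧ DetL l := by
  simp [DetL]

@[simp] theorem detL_append (l l' : List Instr) : DetL (l ++ l') ↔ DetL l ∧ DetL l' := by
  simp [DetL, or_imp, forall_and]

@[simp] theorem detL_setReg (m i : ℕ) (e : Ex) : DetL (setReg m i e) := setReg_isDet m i e

@[simp] theorem detL_emit (m : ℕ) (es : List Ex) : DetL (emit m es) := emit_isDet m es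

theorem runsIn_straight_of {l : List Instr} {s s' : Store} {B : ℕ} (hl : DetL l)
    (h : execL l s = s') (hB : 2 * l.length + 3 ≤ B) : RunsIn (straight l) s s' B :=
  h ▸ (runsIn_straight hl s).mono hB

theorem execL_setReg_low {k i : ℕ} {e : Ex} (he : e.Uses (· < 16)) (hi : i < 16) (s : Store) :
    execL (setReg (k + 16) i e) s = Function.update s i (e.eval s :: (s i).tail) :=
  execL_setReg (he.mono fun j hj => by omega) (by omega) s

/-! ### The threshold and the variables -/

section Programs

variable {k : ℕ}

/-- Multiply the threshold by `min v v⁻¹` for every positive entry `v` of the input word. -/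
def gapLoop (k : ℕ) : Prog :=
  .loop (.nonempty 0) (.seq (straight [.copy 0 10])
    -- The top of the empty stack `11` counts as `0`, and stack `15` holds `1`; the entry is copied
    -- to stack `10` so that the word can be restored.
    (.seq (.ite (.lt 11 0)
        (.ite (.lt 0 15) (straight (setReg (k + 16) 7 (.op .mul (.reg 7) (.reg 0))))
          (straight (setReg (k + 16) 7 (.op .div (.reg 7) (.reg 0)))))
        skip)
      (straight [.pop 0])))

theorem coe_shrink_of_lt {v : ℝ} (h0 : 0 < v) (h1 : v < 1) : (shrink v : ℝ) = v := by
  rw [shrink, if_pos h0, min_eq_left, Real.coe_toNNReal _ h0.le]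
  have : v.toNNReal ≤ 1 := Real.toNNReal_le_one.2 h1.le
  exact this.trans ((one_le_inv₀ (Real.toNNReal_pos.2 h0)).2 this)

theorem coe_shrink_of_le {v : ℝ} (h1 : 1 ≤ v) : (shrink v : ℝ) = v⁻¹ := by
  have h0 : 0 < v := zero_lt_one.trans_le h1
  rw [shrink, if_pos h0, min_eq_right, NNReal.coe_inv, Real.coe_toNNReal _ h0.le]
  have : 1 ≤ v.toNNReal := Real.one_le_toNNReal.2 h1
  exact (inv_le_one_of_one_le₀ this).trans this

theorem runsIn_gapLoop (w : List ℝ) (S : St) (r : ℝ) :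
    RunsIn (gapLoop k) { S with inp := w, eta := [r], one := [1] }.store
      { S with
        inp := []
        tmp := w.reverse ++ S.tmp
        eta := [r * wordGap w]
        one := [1] }.store (50 * w.length + 1) := by
  induction w generalizing S r with
  | nil => simpa [wordGap, gapLoop] using RunsIn.loopDone (by simp [Test.holds])
  | cons v w ih =>
    have key : RunsIn (.ite (.lt 11 0)
        (.ite (.lt 0 15) (straight (setReg (k + 16) 7 (.op .mul (.reg 7) (.reg 0))))
          (straight (setReg (k + 16) 7 (.op .div (.reg 7) (.reg 0)))))
        skip) { S with inp := v :: w, tmp := v :: S.tmp, eta := [r], one := [1] }.store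
        { S with inp := v :: w, tmp := v :: S.tmp, eta := [r * shrink v], one := [1] }.store
        25 := by
      by_cases hv : 0 < v
      · refine RunsIn.iteTrue (B := 24) (by simpa [Test.holds, Store.top] using hv) ?_
        by_cases hv1 : v < 1
        · refine RunsIn.iteTrue (B := 23) (by simpa [Test.holds, Store.top] using hv1) ?_
          refine runsIn_straight_of (by simp) ?_ (by simp [setReg, Ex.code])
          rw [execL_setReg_low (by simp [Ex.Uses]) (by simp)]
          simp [Ex.eval, Store.top, ArithOp.eval, coe_shrink_of_lt hv hv1]
        · refine RunsIn.iteFalse (B := 23) (by simpa [Test.holds, Store.top] using hv1) ?_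
          refine runsIn_straight_of (by simp) ?_ (by simp [setReg, Ex.code])
          rw [execL_setReg_low (by simp [Ex.Uses]) (by simp)]
          simp [Ex.eval, Store.top, ArithOp.eval, coe_shrink_of_le (not_lt.1 hv1), div_eq_mul_inv]
      · refine RunsIn.iteFalse (B := 24) (by simpa [Test.holds, Store.top] using hv) ?_
        have : shrink v = 1 := by rw [shrink, if_neg hv]
        rw [this, NNReal.coe_one, mul_one]
        exact (runsIn_skip _).mono (by norm_num)
    have hbody := RunsIn.seq
      (runsIn_straight_of (l := [.copy 0 10]) (B := 5)
        (s := { S with inp := v :: w, eta := [r], one := [1] }.store)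
        (s' := { S with inp := v :: w, tmp := v :: S.tmp, eta := [r], one := [1] }.store)
        (by simp [Instr.IsDet]) (by simp [execL_cons, execL_nil, Instr.det, Store.push, Store.top])
        (by simp))
      (key.seq (runsIn_straight_of (l := [.pop 0]) (B := 5)
        (s' := { S with inp := w, tmp := v :: S.tmp, eta := [r * shrink v], one := [1] }.store)
        (by simp [Instr.IsDet]) (by simp [execL_cons, execL_nil, Instr.det]) (by simp)))
    have := RunsIn.loopStep (c := .nonempty 0) (by simp [Test.holds]) hbody
      (ih { S with tmp := v :: S.tmp } (r * shrink v))
    have h2 := this.mono (B' := 50 * (v :: w).length + 1) (by simp only [List.length_cons]; omega)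
    simpa [wordGap, mul_assoc, gapLoop] using h2

/-- Count the variables. -/
def varLoop (k : ℕ) : Prog :=
  -- The loop stops at the separator `0`. Stack `6` remembers `n` for reading the answer; stack `9`
  -- collects the variables of the new instance in unary.
  .loop (.eq 0 15) (straight ([.copy 0 6, .copy 0 9] ++
    setReg (k + 16) 8 (.op .add (.reg 8) (.const 1)) ++ [.pop 0]))

theorem runsIn_varLoop (n c : ℕ) (w : List ℝ) (S : St) :
    RunsIn (varLoop k)
      { S with
        inp := List.replicate n 1 ++ 0 :: w
        cnt := [(c : ℝ)]
        one := [1] }.store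
      { S with
        inp := 0 :: w
        vars := List.replicate n 1 ++ S.vars
        ones := List.replicate n 1 ++ S.ones
        cnt := [((c + n : ℕ) : ℝ)]
        one := [1] }.store (50 * n + 1) := by
  induction n generalizing c S with
  | zero => simpa [varLoop] using RunsIn.loopDone (by simp [Test.holds, Store.top])
  | succ n ih =>
    have hbody := runsIn_straight_of (l := [.copy 0 6, .copy 0 9] ++
      setReg (k + 16) 8 (.op .add (.reg 8) (.const 1)) ++ [.pop 0]) (B := 40)
      (s := { S with
        inp := List.replicate (n + 1) 1 ++ 0 :: w
        cnt := [(c : ℝ)]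
        one := [1] }.store)
      (s' := { S with
        inp := List.replicate n 1 ++ 0 :: w
        vars := 1 :: S.vars
        ones := 1 :: S.ones
        cnt := [((c + 1 : ℕ) : ℝ)]
        one := [1] }.store)
      (by simp [Instr.IsDet])
      (by
        rw [execL_append, execL_append, execL_setReg_low (by simp [Ex.Uses]) (by simp)]
        simp [execL_cons, execL_nil, Instr.det, Store.push, Store.top, List.replicate_succ, Ex.eval,
          ArithOp.eval])
      (by simp [setReg, Ex.code])
    have := RunsIn.loopStep (c := .eq 0 15) (by simp [Test.holds, Store.top, List.replicate_succ])
      hbody (ih (c + 1) { S with vars := 1 :: S.vars, ones := 1 :: S.ones })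
    have h2 := this.mono (B' := 50 * (n + 1) + 1) (by omega)
    have h3 : ∀ l : List ℝ, List.replicate n 1 ++ 1 :: l = List.replicate (n + 1) 1 ++ l := by
      intro l
      rw [List.replicate_succ', List.append_assoc, List.singleton_append]
    rw [h3, h3] at h2
    rw [add_comm n 1, ← add_assoc c, add_comm 1 n]
    exact h2

/-! ### Reading an application -/

/-- Move an application to stack `10`, with flag `0`. -/
def copyGeneric (k : ℕ) : Prog :=
  .seq (straight [.copy 0 10, .copy 0 12, .pop 0, .const 13 1, .const 14 0])
    -- Stack `12` counts down the arity while stack `13` doubles, so it ends with the length of the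
    -- table.
    (.seq (.loop (.lt 11 12) (straight ([.copy 0 10, .pop 0] ++
        setReg (k + 16) 12 (.op .sub (.reg 12) (.const 1)) ++
        setReg (k + 16) 13 (.op .add (.reg 13) (.reg 13)))))
      (.seq (.loop (.lt 11 13) (straight ([.copy 0 10, .pop 0] ++
          setReg (k + 16) 13 (.op .sub (.reg 13) (.const 1)))))
        (straight [.pop 12, .pop 13])))

theorem runsIn_copyVars (u rest : List ℝ) (p : ℝ) (S : St) :
    RunsIn (.loop (.lt 11 12) (straight ([.copy 0 10, .pop 0] ++
        setReg (k + 16) 12 (.op .sub (.reg 12) (.const 1)) ++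
        setReg (k + 16) 13 (.op .add (.reg 13) (.reg 13)))))
      { S with inp := u ++ rest, ar := (u.length : ℝ) :: S.ar, pw := p :: S.pw }.store
      { S with
        inp := rest
        tmp := u.reverse ++ S.tmp
        ar := 0 :: S.ar
        pw := (p * 2 ^ u.length) :: S.pw }.store (60 * u.length + 1) := by
  induction u generalizing p S with
  | nil => simpa using RunsIn.loopDone (by simp [Test.holds, Store.top])
  | cons v u ih =>
    have hbody := runsIn_straight_of (l := [.copy 0 10, .pop 0] ++
        setReg (k + 16) 12 (.op .sub (.reg 12) (.const 1)) ++
        setReg (k + 16) 13 (.op .add (.reg 13) (.reg 13))) (B := 55)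
      (s := { S with
        inp := (v :: u) ++ rest
        ar := ((v :: u).length : ℝ) :: S.ar
        pw := p :: S.pw }.store)
      (s' := { S with
        inp := u ++ rest
        tmp := v :: S.tmp
        ar := (u.length : ℝ) :: S.ar
        pw := (p * 2) :: S.pw }.store)
      (by simp [Instr.IsDet])
      (by
        rw [execL_append, execL_append, execL_setReg_low (by simp [Ex.Uses]) (by simp),
          execL_setReg_low (by simp [Ex.Uses]) (by simp)]
        simp [execL_cons, execL_nil, Instr.det, Store.push, Store.top, Ex.eval, ArithOp.eval,
          mul_two])
      (by simp [setReg, Ex.code])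
    have := RunsIn.loopStep (c := .lt 11 12)
      (by simp only [Test.holds, Store.top, St.store_11, St.store_12, List.length_cons,
            List.headD_cons, List.headD_nil]
          positivity)
      hbody (ih (p * 2) { S with tmp := v :: S.tmp })
    have h2 := this.mono (B' := 60 * (v :: u).length + 1) (by simp only [List.length_cons]; omega)
    simpa [pow_succ', mul_assoc] using h2

theorem runsIn_copyTable (u rest : List ℝ) (S : St) :
    RunsIn (.loop (.lt 11 13) (straight ([.copy 0 10, .pop 0] ++
        setReg (k + 16) 13 (.op .sub (.reg 13) (.const 1)))))
      { S with inp := u ++ rest, pw := (u.length : ℝ) :: S.pw }.store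
      { S with inp := rest, tmp := u.reverse ++ S.tmp, pw := 0 :: S.pw }.store
      (60 * u.length + 1) := by
  induction u generalizing S with
  | nil => simpa using RunsIn.loopDone (by simp [Test.holds, Store.top])
  | cons v u ih =>
    have hbody := runsIn_straight_of (l := [.copy 0 10, .pop 0] ++
        setReg (k + 16) 13 (.op .sub (.reg 13) (.const 1))) (B := 55)
      (s := { S with inp := (v :: u) ++ rest, pw := ((v :: u).length : ℝ) :: S.pw }.store)
      (s' := { S with inp := u ++ rest, tmp := v :: S.tmp, pw := (u.length : ℝ) :: S.pw }.store)
      (by simp [Instr.IsDet])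
      (by
        rw [execL_append, execL_setReg_low (by simp [Ex.Uses]) (by simp)]
        simp [execL_cons, execL_nil, Instr.det, Store.push, Store.top, Ex.eval, ArithOp.eval])
      (by simp [setReg, Ex.code])
    have := RunsIn.loopStep (c := .lt 11 13)
      (by simp only [Test.holds, Store.top, St.store_11, St.store_13, List.length_cons,
            List.headD_cons, List.headD_nil]
          positivity)
      hbody (ih { S with tmp := v :: S.tmp })
    have h2 := this.mono (B' := 60 * (v :: u).length + 1) (by simp only [List.length_cons]; omega)
    simpa using h2

theorem length_boolTuples : ∀ k, (boolTuples k).length = 2 ^ k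
  | 0 => rfl
  | k + 1 => by simp [boolTuples, length_boolTuples k, pow_succ, mul_two]

theorem length_encAtom (a : Atom ℕ) : (encAtom a).length = a.con.1 + 2 ^ a.con.1 + 1 := by
  simp [encAtom, length_boolTuples]

theorem runsIn_copyGeneric (a : Atom ℕ) (rest : List ℝ) (S : St) :
    RunsIn (copyGeneric k) { S with inp := encAtom a ++ rest }.store
      { S with
        inp := rest
        tmp := (encAtom a).reverse ++ S.tmp
        flag := 0 :: S.flag }.store (100 * (encAtom a).length) := by
  set u := List.ofFn (fun t => ((a.vars t : ℕ) : ℝ)) with hu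
  set v := (boolTuples a.con.1).map (fun x => (a.con.2 x : ℝ)) with hv
  have hul : u.length = a.con.1 := by simp [hu]
  have hvl : v.length = 2 ^ a.con.1 := by simp [hv, length_boolTuples]
  have h1 := runsIn_straight_of (l := [.copy 0 10, .copy 0 12, .pop 0, .const 13 1, .const 14 0])
    (B := 13) (s := { S with inp := encAtom a ++ rest }.store)
    (s' := { S with
      inp := u ++ (v ++ rest)
      tmp := (a.con.1 : ℝ) :: S.tmp
      ar := (u.length : ℝ) :: S.ar
      pw := 1 :: S.pw
      flag := 0 :: S.flag }.store)
    (by simp [Instr.IsDet])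
    (by simp [execL_cons, execL_nil, Instr.det, Store.push, Store.top, encAtom, hul, ← hu, ← hv])
    (by simp)
  have h2 := runsIn_copyVars (k := k) u (v ++ rest) 1
    { S with tmp := (a.con.1 : ℝ) :: S.tmp, flag := 0 :: S.flag }
  have h3 := runsIn_copyTable (k := k) v rest
    { S with
      tmp := u.reverse ++ (a.con.1 : ℝ) :: S.tmp
      ar := 0 :: S.ar
      flag := 0 :: S.flag }
  have h4 := runsIn_straight_of (l := [.pop 12, .pop 13]) (B := 7)
    (s := { S with
      inp := rest
      tmp := v.reverse ++ (u.reverse ++ (a.con.1 : ℝ) :: S.tmp)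
      ar := 0 :: S.ar
      pw := 0 :: S.pw
      flag := 0 :: S.flag }.store)
    (s' := { S with
      inp := rest
      tmp := (encAtom a).reverse ++ S.tmp
      flag := 0 :: S.flag }.store)
    (by simp [Instr.IsDet])
    (by simp [execL_cons, execL_nil, Instr.det, encAtom, ← hu, ← hv])
    (by simp)
  have e1 : (1 : ℝ) * 2 ^ u.length = (v.length : ℝ) := by rw [hul, hvl]; simp
  rw [e1] at h2
  refine (h1.seq (h2.seq (h3.seq h4))).mono ?_
  rw [length_encAtom, hul, hvl]
  omega

/-- Push the entries of a word on consecutive stacks. -/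
def pushAll : ℕ → List ℝ → (ℕ → List ℝ) → ℕ → List ℝ
  | _, [], I => I
  | j, a :: u, I => pushAll (j + 1) u (Function.update I j (a :: I j))

/-- Pop the top of `n` consecutive stacks. -/
def popAll : ℕ → ℕ → (ℕ → List ℝ) → ℕ → List ℝ
  | _, 0, I => I
  | j, n + 1, I => popAll (j + 1) n (Function.update I j (I j).tail)

def readVars : ℕ → ℕ → List Instr
  | _, 0 => []
  | j, n + 1 => .copy 0 (j + 16) :: .copy 0 10 :: .pop 0 :: readVars (j + 1) n

def clearVars : ℕ → ℕ → List Instr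
  | _, 0 => []
  | j, n + 1 => .pop (j + 16) :: clearVars (j + 1) n

@[simp] theorem detL_readVars (j n : ℕ) : DetL (readVars j n) := by
  induction n generalizing j with
  | zero => simp [readVars]
  | succ n ih => simp [readVars, Instr.IsDet, ih]

@[simp] theorem detL_clearVars (j n : ℕ) : DetL (clearVars j n) := by
  induction n generalizing j with
  | zero => simp [clearVars]
  | succ n ih => simp [clearVars, Instr.IsDet, ih]

theorem execL_readVars (u rest : List ℝ) (j : ℕ) (S : St) :
    execL (readVars j u.length) { S with inp := u ++ rest }.store =
      { S with inp := rest, tmp := u.reverse ++ S.tmp, idx := pushAll j u S.idx }.store := by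
  induction u generalizing j S with
  | nil => simp [readVars, execL_nil, pushAll]
  | cons v u ih =>
    have := ih (j + 1) { S with
      tmp := v :: S.tmp
      idx := Function.update S.idx j (v :: S.idx j) }
    simp only [List.length_cons, readVars, execL_cons]
    simpa [Instr.det, Store.push, Store.top, pushAll] using this

theorem execL_clearVars (n j : ℕ) (S : St) :
    execL (clearVars j n) S.store = { S with idx := popAll j n S.idx }.store := by
  induction n generalizing j S with
  | zero => simp [clearVars, execL_nil, popAll]
  | succ n ih =>
    simp only [clearVars, execL_cons]
    simpa [Instr.det, popAll] using
      ih (j + 1) { S with idx := Function.update S.idx j (S.idx j).tail }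

theorem pushAll_of_lt (u : List ℝ) {j i : ℕ} (h : i < j) (I : ℕ → List ℝ) :
    pushAll j u I i = I i := by
  induction u generalizing j I with
  | nil => rfl
  | cons a u ih => rw [pushAll, ih (by omega), Function.update_of_ne h.ne]

theorem pushAll_add (u : List ℝ) (j : ℕ) (I : ℕ → List ℝ) (i : ℕ) (hi : i < u.length) :
    pushAll j u I (j + i) = u[i] :: I (j + i) := by
  induction u generalizing j I i with
  | nil => simp at hi
  | cons a u ih =>
    cases i with
    | zero => rw [pushAll, pushAll_of_lt _ (by omega)]; simp
    | succ i =>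
      rw [pushAll, show j + (i + 1) = j + 1 + i by omega, ih _ _ i (by simpa using hi),
        Function.update_of_ne (by omega)]
      rfl

theorem update_pushAll_of_lt (u : List ℝ) {j i : ℕ} (h : i < j) (l : List ℝ) (I : ℕ → List ℝ) :
    Function.update (pushAll j u I) i l = pushAll j u (Function.update I i l) := by
  induction u generalizing j I with
  | nil => rfl
  | cons a u ih =>
    rw [pushAll, ih (by omega), pushAll, Function.update_of_ne h.ne', Function.update_comm h.ne']

theorem popAll_pushAll (u : List ℝ) (j : ℕ) (I : ℕ → List ℝ) :
    popAll j u.length (pushAll j u I) = I := by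
  induction u generalizing j I with
  | nil => rfl
  | cons a u ih =>
    rw [List.length_cons, popAll, pushAll, update_pushAll_of_lt _ (Nat.lt_succ_self j), ih,
      pushAll_of_lt _ (Nat.lt_succ_self j)]
    simp

theorem popAll_empty (n j : ℕ) : popAll j n (fun _ => []) = fun _ => [] := by
  induction n generalizing j with
  | zero => rfl
  | succ n ih =>
    rw [popAll]
    simpa using ih (j + 1)

/-- Move a word to stack `10`, and clear the flag if it is not the given one. -/
def checkTable (k : ℕ) : List ℝ → Prog
  | [] => skip
  | c :: cs => .seq (straight [.const (k + 16) c])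
      (.seq (.ite (.eq 0 (k + 16)) skip (straight (setReg (k + 16) 14 (.const 0))))
        (.seq (straight [.pop (k + 16), .copy 0 10, .pop 0]) (checkTable k cs)))

theorem runsIn_checkTable (cs vs rest : List ℝ) (h : vs.length = cs.length) (b : ℝ) (S : St) :
    RunsIn (checkTable k cs) { S with inp := vs ++ rest, flag := b :: S.flag }.store
      { S with
        inp := rest
        tmp := vs.reverse ++ S.tmp
        flag := (if vs = cs then b else 0) :: S.flag }.store (50 * cs.length + 3) := by
  induction cs generalizing vs b S with
  | nil =>
    obtain rfl : vs = [] := by simpa using h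
    simpa [checkTable] using runsIn_skip _
  | cons c cs ih =>
    obtain ⟨v, vs, rfl⟩ : ∃ v vs', vs = v :: vs' := by
      cases vs with
      | nil => simp at h
      | cons v vs => exact ⟨v, vs, rfl⟩
    have h1 := runsIn_straight_of (l := [.const (k + 16) c]) (B := 5)
      (s := { S with inp := v :: vs ++ rest, flag := b :: S.flag }.store)
      (s' := { S with
        inp := v :: vs ++ rest
        flag := b :: S.flag
        idx := Function.update S.idx k (c :: S.idx k) }.store)
      (by simp [Instr.IsDet]) (by simp [execL_cons, execL_nil, Instr.det, Store.push]) (by simp)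
    have h2 : RunsIn (.ite (.eq 0 (k + 16)) skip (straight (setReg (k + 16) 14 (.const 0))))
        { S with
          inp := v :: vs ++ rest
          flag := b :: S.flag
          idx := Function.update S.idx k (c :: S.idx k) }.store
        { S with
          inp := v :: vs ++ rest
          flag := (if v = c then b else 0) :: S.flag
          idx := Function.update S.idx k (c :: S.idx k) }.store 12 := by
      by_cases hv : v = c
      · rw [if_pos hv]
        refine RunsIn.iteTrue (B := 11) (by simpa [Test.holds, Store.top] using hv)
          ((runsIn_skip _).mono (by norm_num))
      · rw [if_neg hv]
        refine RunsIn.iteFalse (B := 11) (by simpa [Test.holds, Store.top] using hv) ?_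
        refine runsIn_straight_of (by simp) ?_ (by simp [setReg, Ex.code])
        rw [execL_setReg_low (by simp [Ex.Uses]) (by simp)]
        simp [Ex.eval]
    have h3 := runsIn_straight_of (l := [.pop (k + 16), .copy 0 10, .pop 0]) (B := 9)
      (s := { S with
          inp := v :: vs ++ rest
          flag := (if v = c then b else 0) :: S.flag
          idx := Function.update S.idx k (c :: S.idx k) }.store)
      (s' := { S with
          inp := vs ++ rest
          tmp := v :: S.tmp
          flag := (if v = c then b else 0) :: S.flag }.store)
      (by simp [Instr.IsDet])
      (by simp [execL_cons, execL_nil, Instr.det, Store.push, Store.top]) (by simp)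
    have h4 := ih vs (by simpa using h) (if v = c then b else 0) { S with tmp := v :: S.tmp }
    have h5 : (if vs = cs then (if v = c then b else 0) else 0) =
        if v :: vs = c :: cs then b else 0 := by
      by_cases h6 : v = c <;> by_cases h7 : vs = cs <;> simp [h6, h7]
    rw [h5] at h4
    have h6 := (h1.seq (h2.seq (h3.seq h4))).mono (B' := 50 * (c :: cs).length + 3)
      (by simp only [List.length_cons]; omega)
    simpa [checkTable] using h6

end Programs

/-! ### Writing a gadget -/

section Emission

variable {k A : ℕ} {ι : Type}

/-- The expressions are constants of the program; the instance enters only through the tops of the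
stacks: `η` on `7`, the counter on `8`, the terminals from `16` on. -/
def slotEx (e : ι ≃ Fin A) : Fin k ⊕ ι → Ex
  | .inl t => .reg (t + 16)
  | .inr j => .op .add (.reg 8) (.const ((e j : ℕ) : ℝ))

def atomEx (e : ι ≃ Fin A) (a : Atom (Fin k ⊕ ι)) : List Ex :=
  .const (a.con.1 : ℝ) :: (List.ofFn (fun t => slotEx e (a.vars t)) ++
    (boolTuples a.con.1).map (fun x => .const (a.con.2 x : ℝ)))

/-- The expression `c * η ^ n`. -/
def powEx (c : ℝ) : ℕ → Ex
  | 0 => .const c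
  | n + 1 => .op .mul (powEx c n) (.reg 7)

def softValueEx {V : Type} (m : ℕ) (u : Soft V) (b : Bool) : Ex :=
  .op .mul (.op .add (.op .div (.const 1) (.reg 7)) (.op .add (.reg 8) (.const (m : ℝ))))
    (if b = u.dir then .const 1 else powEx (u.coef : ℝ) u.exp)

def softEx (e : ι ≃ Fin A) : ℕ → List (Soft (Fin k ⊕ ι)) → List Ex
  | _, [] => []
  | m, u :: us => [.const 1, slotEx e u.slot, softValueEx m u false, softValueEx m u true] ++
      softEx e (m + 1) us

def blockEx (e : ι ≃ Fin A) (Γ : Gadget k ι) : List Ex :=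
  Γ.atoms.flatMap (atomEx e) ++ softEx e 0 Γ.softs

theorem uses_slotEx (e : ι ≃ Fin A) (v : Fin k ⊕ ι) :
    (slotEx e v).Uses (fun i => i < k + 16 ∧ i ≠ 2) := by
  rcases v with t | j
  · have := t.2
    simp only [slotEx, Ex.Uses]
    omega
  · simp [slotEx, Ex.Uses]

theorem uses_powEx (c : ℝ) (n : ℕ) : (powEx c n).Uses (fun i => i < k + 16 ∧ i ≠ 2) := by
  induction n with
  | zero => trivial
  | succ n ih => exact ⟨ih, by simp [Ex.Uses]⟩

theorem uses_softValueEx {V : Type} (m : ℕ) (u : Soft V) (b : Bool) :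
    (softValueEx m u b).Uses (fun i => i < k + 16 ∧ i ≠ 2) := by
  refine ⟨by simp [Ex.Uses], ?_⟩
  split_ifs
  exacts [trivial, uses_powEx _ _]

theorem uses_blockEx (e : ι ≃ Fin A) (Γ : Gadget k ι) :
    ∀ x ∈ blockEx e Γ, x.Uses (fun i => i < k + 16 ∧ i ≠ 2) := by
  intro x hx
  rw [blockEx, List.mem_append] at hx
  rcases hx with hx | hx
  · obtain ⟨a, -, hx⟩ := List.mem_flatMap.1 hx
    simp only [atomEx, List.mem_cons, List.mem_append, List.mem_ofFn, List.mem_map] at hx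
    rcases hx with rfl | ⟨t, rfl⟩ | ⟨y, -, rfl⟩
    exacts [trivial, uses_slotEx e _, trivial]
  · generalize Γ.softs = us, 0 = m at hx
    induction us generalizing m with
    | nil => simp [softEx] at hx
    | cons u us ih =>
      simp only [softEx, List.mem_append, List.mem_cons, List.not_mem_nil, or_false] at hx
      rcases hx with (rfl | rfl | rfl | rfl) | hx
      exacts [trivial, uses_slotEx e _, uses_softValueEx m u false, uses_softValueEx m u true,
        ih _ hx]

variable {s : Store} {η : ℝ≥0} {cnt : ℕ} {vars : Fin k → ℕ}

theorem eval_slotEx (e : ι ≃ Fin A) (hc : s.top 8 = cnt)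
    (hv : ∀ t : Fin k, s.top (t + 16) = vars t) (v : Fin k ⊕ ι) :
    (slotEx e v).eval s = ((place e cnt vars v : ℕ) : ℝ) := by
  rcases v with t | j
  · simp [slotEx, Ex.eval, place, hv]
  · simp [slotEx, Ex.eval, place, hc, ArithOp.eval]

theorem eval_powEx (hη : s.top 7 = η) (c : ℝ) (n : ℕ) : (powEx c n).eval s = c * (η : ℝ) ^ n := by
  induction n with
  | zero => simp [powEx, Ex.eval]
  | succ n ih => simp [powEx, Ex.eval, ArithOp.eval, ih, hη, pow_succ, mul_assoc]

theorem eval_softValueEx {V : Type} (hη : s.top 7 = η) (hc : s.top 8 = cnt) (m : ℕ) (u : Soft V)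
    (b : Bool) : (softValueEx m u b).eval s =
      (((η⁻¹ + ((cnt + m : ℕ) : ℝ≥0)) * u.wt η b : ℝ≥0) : ℝ) := by
  have h : (if b = u.dir then Ex.const 1 else powEx (u.coef : ℝ) u.exp).eval s = (u.wt η b : ℝ) := by
    unfold Soft.wt
    split_ifs
    · simp [Ex.eval]
    · simp [eval_powEx hη]
  simp [softValueEx, Ex.eval, ArithOp.eval, h, hη, hc]

theorem encAtom_softAtom (η l : ℝ≥0) (u : Soft ℕ) : encAtom (softAtom η l u) =
    [1, (u.slot : ℝ), ((l * u.wt η false : ℝ≥0) : ℝ), ((l * u.wt η true : ℝ≥0) : ℝ)] := by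
  simp [encAtom, softAtom, boolTuples]

theorem map_eval_blockEx (e : ι ≃ Fin A) (Γ : Gadget k ι) (hη : s.top 7 = η) (hc : s.top 8 = cnt)
    (hv : ∀ t : Fin k, s.top (t + 16) = vars t) :
    (blockEx e Γ).map (fun x => x.eval s) = (block Γ e η cnt vars).flatMap encAtom := by
  rw [blockEx, block, List.map_append, List.flatMap_append]
  congr 1
  · rw [List.map_flatMap, List.flatMap_map]
    congr 1
    funext a
    simp only [atomEx, encAtom, Atom.map, List.map_cons, List.map_append, List.map_ofFn,
      List.map_map, Function.comp_def, Ex.eval, eval_slotEx e hc hv]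
  · have : ∀ m, (softEx e m Γ.softs).map (fun x => x.eval s) =
        (softAtoms η (cnt + m) (Γ.softs.map (Soft.map (place e cnt vars)))).flatMap encAtom := by
      generalize Γ.softs = us
      induction us with
      | nil => simp [softEx, softAtoms]
      | cons u us ih =>
        intro m
        rw [softEx, List.map_append, ih, List.map_cons (l := us), softAtoms, List.flatMap_cons,
          encAtom_softAtom]
        congr 1
        simp only [List.map_cons, List.map_nil, Ex.eval, eval_slotEx e hc hv,
          eval_softValueEx hη hc]
        rfl
    simpa using this 0

/-! ### The replacement of one application -/

/-- Move an application of arity `k` to stack `10` and its variables to the stacks from `16` on, and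
set the flag if its constraint is `f`. -/
def copyMatch (f : Con k) : Prog :=
  .seq (straight ([.copy 0 10, .pop 0, .const 14 1] ++ readVars 0 k))
    (checkTable k ((boolTuples k).map (fun x => (f x : ℝ))))

theorem length_readVars (j n : ℕ) : (readVars j n).length = 3 * n := by
  induction n generalizing j with
  | zero => rfl
  | succ n ih => simp only [readVars, List.length_cons, ih]; omega

theorem length_clearVars (j n : ℕ) : (clearVars j n).length = n := by
  induction n generalizing j with
  | zero => rfl
  | succ n ih => simp only [clearVars, List.length_cons, ih]

open Classical in
theorem runsIn_copyMatch (f g : Con k) (v : Fin k → ℕ) (rest : List ℝ) (S : St) :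
    RunsIn (copyMatch f) { S with inp := encAtom ⟨⟨k, g⟩, v⟩ ++ rest }.store
      { S with
        inp := rest
        tmp := (encAtom ⟨⟨k, g⟩, v⟩).reverse ++ S.tmp
        flag := (if g = f then 1 else 0) :: S.flag
        idx := pushAll 0 (List.ofFn (fun t => (v t : ℝ))) S.idx }.store
      (50 * (encAtom ⟨⟨k, g⟩, v⟩).length) := by
  set u := List.ofFn (fun t => (v t : ℝ)) with hu
  set w := (boolTuples k).map (fun x => (g x : ℝ)) with hw
  set w' := (boolTuples k).map (fun x => (f x : ℝ)) with hw'
  have hul : u.length = k := by simp [hu]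
  have henc : encAtom ⟨⟨k, g⟩, v⟩ = (k : ℝ) :: (u ++ w) := rfl
  have h1 := runsIn_straight_of (l := [.copy 0 10, .pop 0, .const 14 1] ++ readVars 0 k)
    (B := 6 * k + 9)
    (s := { S with inp := encAtom ⟨⟨k, g⟩, v⟩ ++ rest }.store)
    (s' := { S with
      inp := w ++ rest
      tmp := u.reverse ++ (k : ℝ) :: S.tmp
      flag := 1 :: S.flag
      idx := pushAll 0 u S.idx }.store)
    (by simp [Instr.IsDet])
    (by
      have := execL_readVars u (w ++ rest) 0
        { S with tmp := (k : ℝ) :: S.tmp, flag := 1 :: S.flag }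
      rw [hul] at this
      rw [execL_append, ← this, henc]
      simp [execL_cons, execL_nil, Instr.det, Store.push, Store.top])
    (by simp only [List.length_append, List.length_cons, List.length_nil, length_readVars]; omega)
  have h2 := runsIn_checkTable (k := k) w' w rest (by simp [hw, hw']) 1
    { S with tmp := u.reverse ++ (k : ℝ) :: S.tmp, idx := pushAll 0 u S.idx }
  have h3 : w = w' ↔ g = f := by
    constructor
    · intro h
      funext x
      have := List.map_inj_left.1 h x (mem_boolTuples k x)
      exact_mod_cast this
    · rintro rfl
      rfl
  have h4 : (if w = w' then (1 : ℝ) else 0) = if g = f then 1 else 0 := if_congr h3 rfl rfl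
  have h5 : w.reverse ++ (u.reverse ++ (k : ℝ) :: S.tmp) =
      (encAtom ⟨⟨k, g⟩, v⟩).reverse ++ S.tmp := by
    rw [henc]; simp
  simp only [h4, h5] at h2
  refine (h1.seq h2).mono ?_
  rw [length_encAtom]
  simp only [hw', List.length_map, length_boolTuples]
  have := Nat.one_le_two_pow (n := k)
  omega

def clearTmp : Prog := .loop (.nonempty 10) (straight [.pop 10])

theorem runsIn_clearTmp (l : List ℝ) (S : St) :
    RunsIn clearTmp { S with tmp := l }.store { S with tmp := [] }.store (6 * l.length + 1) := by
  induction l with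
  | nil => exact .loopDone (by simp [Test.holds])
  | cons a l ih =>
    have h1 := runsIn_straight_of (l := [.pop 10]) (B := 5)
      (s := { S with tmp := a :: l }.store) (s' := { S with tmp := l }.store)
      (by simp [Instr.IsDet]) (by simp [execL_cons, execL_nil, Instr.det]) (by simp)
    refine (RunsIn.loopStep (by simp [Test.holds]) h1 ih).mono ?_
    simp only [List.length_cons]
    omega

/-- The instructions that write the gadget. -/
def writeGadget (e : ι ≃ Fin A) (Γ : Gadget k ι) : List Instr :=
  emit (k + 16) (blockEx e Γ) ++
    setReg (k + 16) 8 (.op .add (.reg 8) (.const ((stride A Γ : ℕ) : ℝ))) ++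
    List.replicate (stride A Γ) (.const 9 1)

theorem execL_replicate_const (n : ℕ) (S : St) :
    execL (List.replicate n (.const 9 1)) S.store =
      { S with ones := List.replicate n 1 ++ S.ones }.store := by
  induction n generalizing S with
  | zero => simp [execL_nil]
  | succ n ih =>
    rw [List.replicate_succ, execL_cons]
    have := ih { S with ones := 1 :: S.ones }
    rw [show List.replicate n (1 : ℝ) ++ 1 :: S.ones = List.replicate (n + 1) 1 ++ S.ones by
      rw [List.replicate_succ', List.append_assoc, List.singleton_append]] at this
    simpa [Instr.det, Store.push] using this

theorem detL_writeGadget (e : ι ≃ Fin A) (Γ : Gadget k ι) : DetL (writeGadget e Γ) := by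
  simp only [writeGadget, detL_append, detL_emit, detL_setReg, true_and]
  intro a ha
  rw [List.eq_of_mem_replicate ha]
  trivial

theorem execL_writeGadget (e : ι ≃ Fin A) (Γ : Gadget k ι) (η : ℝ≥0) (cnt : ℕ) (vars : Fin k → ℕ)
    (S : St) :
    execL (writeGadget e Γ) { S with
      eta := [(η : ℝ)]
      cnt := [(cnt : ℝ)]
      idx := pushAll 0 (List.ofFn (fun t => (vars t : ℝ))) S.idx }.store =
    { S with
      eta := [(η : ℝ)]
      query := (block Γ e η cnt vars).flatMap encAtom ++ S.query
      cnt := [((cnt + stride A Γ : ℕ) : ℝ)]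
      ones := List.replicate (stride A Γ) 1 ++ S.ones
      idx := pushAll 0 (List.ofFn (fun t => (vars t : ℝ))) S.idx }.store := by
  have hidx : ∀ t : Fin k, pushAll 0 (List.ofFn (fun t => (vars t : ℝ))) S.idx t =
      (vars t : ℝ) :: S.idx t := by
    intro t
    have := pushAll_add (List.ofFn (fun t => (vars t : ℝ))) 0 S.idx t (by simp)
    simpa using this
  rw [writeGadget, execL_append, execL_append, execL_emit (by omega) (uses_blockEx e Γ),
    execL_setReg_low (by simp [Ex.Uses]) (by simp),
    map_eval_blockEx (η := η) (cnt := cnt) (vars := vars) e Γ (by simp [Store.top])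
      (by simp [Store.top]) (by simp [Store.top, hidx])]
  simp only [St.update_2, St.update_8, execL_replicate_const]
  simp [Ex.eval, Store.top, ArithOp.eval]

/-- Read an application, and set the flag if its constraint is `f`. -/
def readApp (f : Con k) : Prog :=
  .seq (straight [.const (k + 16) (k : ℝ)])
    (.ite (.eq 0 (k + 16)) (.seq (straight [.pop (k + 16)]) (copyMatch f))
      (.seq (straight [.pop (k + 16)]) (copyGeneric k)))

-- The variable stacks are filled only if the arity is `k`. Popping an empty stack is harmless, so
-- the same clean-up works in both cases.
open Classical in
theorem runsIn_readApp (f : Con k) (a : Atom ℕ) (rest : List ℝ) (S : St)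
    (hS : S.idx = fun _ => []) :
    ∃ I : ℕ → List ℝ, popAll 0 k I = (fun _ => []) ∧
      (∀ h : a.con = ⟨k, f⟩, I = pushAll 0 (List.ofFn (fun t : Fin k =>
        ((a.vars (Fin.cast (congrArg Sigma.fst h).symm t) : ℕ) : ℝ))) (fun _ => [])) ∧
      RunsIn (readApp f) { S with inp := encAtom a ++ rest }.store
        { S with
          inp := rest
          tmp := (encAtom a).reverse ++ S.tmp
          flag := (if a.con = (⟨k, f⟩ : Constraint) then 1 else 0) :: S.flag
          idx := I }.store (120 * (encAtom a).length) := by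
  have hpos : 1 ≤ (encAtom a).length := by simp [length_encAtom]
  have h1 := runsIn_straight_of (l := [.const (k + 16) (k : ℝ)]) (B := 5)
    (s := { S with inp := encAtom a ++ rest }.store)
    (s' := { S with
      inp := encAtom a ++ rest
      idx := Function.update S.idx k ((k : ℝ) :: S.idx k) }.store)
    (by simp [Instr.IsDet]) (by simp [execL_cons, execL_nil, Instr.det, Store.push]) (by simp)
  have h2 := runsIn_straight_of (l := [.pop (k + 16)]) (B := 5)
    (s := { S with
      inp := encAtom a ++ rest
      idx := Function.update S.idx k ((k : ℝ) :: S.idx k) }.store)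
    (s' := { S with inp := encAtom a ++ rest }.store)
    (by simp [Instr.IsDet]) (by simp [execL_cons, execL_nil, Instr.det]) (by simp)
  have htest : (Test.eq 0 (k + 16)).holds { S with
      inp := encAtom a ++ rest
      idx := Function.update S.idx k ((k : ℝ) :: S.idx k) }.store ↔ a.con.1 = k := by
    simp [Test.holds, Store.top, encAtom]
  by_cases hk : a.con.1 = k
  · have h3 := htest.2 hk
    obtain ⟨⟨k', g⟩, v⟩ := a
    change k' = k at hk
    subst hk
    refine ⟨pushAll 0 (List.ofFn (fun t => (v t : ℝ))) S.idx, ?_, fun _ => by rw [hS]; rfl, ?_⟩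
    · have := popAll_pushAll (List.ofFn (fun t => (v t : ℝ))) 0 S.idx
      rw [List.length_ofFn] at this
      exact this.trans hS
    · have h4 := h1.seq (RunsIn.iteTrue (q := .seq (straight [.pop (k' + 16)]) (copyGeneric k')) h3
        (h2.seq (runsIn_copyMatch f g v rest S)))
      have h5 : ((⟨k', g⟩ : Constraint) = ⟨k', f⟩) ↔ g = f := by simp
      simp only [h5]
      exact h4.mono (by omega)
  · refine ⟨fun _ => [], popAll_empty k 0, fun h => absurd (congrArg Sigma.fst h) hk, ?_⟩
    have h4 := h1.seq (RunsIn.iteFalse (p := .seq (straight [.pop (k + 16)]) (copyMatch f))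
      (mt htest.1 hk) (h2.seq (runsIn_copyGeneric (k := k) a rest S)))
    rw [if_neg fun h => hk (congrArg Sigma.fst h)]
    rw [← hS]
    exact h4.mono (by omega)

/-- Read an application from the input and write it, or the gadget that replaces it. -/
def replaceApp (f : Con k) (e : ι ≃ Fin A) (Γ : Gadget k ι) : Prog :=
  .seq (readApp f)
    -- With flag `1` the gadget is written and the saved code dropped; otherwise the saved code is
    -- itself moved to the query.
    (.seq (.ite (.eq 14 15) (.seq (straight (writeGadget e Γ)) clearTmp) (moveLoop 10 2))
      (straight (.pop 14 :: clearVars 0 k)))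

/-- The state between two applications. -/
structure Clean (S : St) : Prop where
  tmp : S.tmp = []
  flag : S.flag = []
  one : S.one = [1]
  idx : S.idx = fun _ => []

/-- The time for one application, per letter of its code. -/
def appCost (e : ι ≃ Fin A) (Γ : Gadget k ι) : ℕ := 2 * (writeGadget e Γ).length + 2 * k + 150

theorem runsIn_replaceApp (f : Con k) (e : ι ≃ Fin A) (Γ : Gadget k ι) (η : ℝ≥0) (cnt : ℕ)
    (a : Atom ℕ) (rest : List ℝ) (S : St) (hS : Clean S) :
    RunsIn (replaceApp f e Γ)
      { S with
        inp := encAtom a ++ rest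
        eta := [(η : ℝ)]
        cnt := [(cnt : ℝ)]
        ones := List.replicate cnt 1 }.store
      { S with
        inp := rest
        query := (expandApps f Γ e η cnt [a]).flatMap encAtom ++ S.query
        eta := [(η : ℝ)]
        cnt := [((expandCount f (stride A Γ) cnt [a] : ℕ) : ℝ)]
        ones := List.replicate (expandCount f (stride A Γ) cnt [a]) 1 }.store
      (appCost e Γ * (encAtom a).length) := by
  obtain ⟨inp, eps, query, tol, ans, out, vars, eta, cnt', ones, tmp, ar, pw, flag, one, idx⟩ := S
  obtain ⟨htmp, hflag, hone, hidx⟩ := hS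
  dsimp only at htmp hflag hone hidx ⊢
  subst htmp hflag hone hidx
  have hpos : 1 ≤ (encAtom a).length := by simp [length_encAtom]
  obtain ⟨I, hI, hIf, h1⟩ := runsIn_readApp f a rest
    ⟨inp, eps, query, tol, ans, out, vars, [(η : ℝ)], [(cnt : ℝ)], List.replicate cnt 1, [], ar, pw,
      [], [1], fun _ => []⟩ rfl
  dsimp only at h1
  rw [List.append_nil] at h1
  have hcost : 120 * (encAtom a).length + (2 * (writeGadget e Γ).length + 6 * (encAtom a).length +
      8 * (encAtom a).length + 2 * k + 16) ≤ appCost e Γ * (encAtom a).length := by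
    unfold appCost
    nlinarith
  have h3 : ∀ Q C O b, RunsIn (straight (.pop 14 :: clearVars 0 k))
      (St.store ⟨rest, eps, Q, tol, ans, out, vars, [(η : ℝ)], C, O, [], ar, pw, [b], [1], I⟩)
      (St.store ⟨rest, eps, Q, tol, ans, out, vars, [(η : ℝ)], C, O, [], ar, pw, [], [1],
        fun _ => []⟩) (2 * k + 5) := by
    intro Q C O b
    refine runsIn_straight_of (by simp [Instr.IsDet]) ?_ (by simp [length_clearVars]; omega)
    rw [execL_cons]
    simp [Instr.det, execL_clearVars, hI]
  by_cases h : a.con = ⟨k, f⟩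
  · rw [if_pos h] at h1
    have hw := execL_writeGadget e Γ η cnt
      (fun t => a.vars (Fin.cast (congrArg Sigma.fst h).symm t))
      ⟨rest, eps, query, tol, ans, out, vars, [(η : ℝ)], [(cnt : ℝ)], List.replicate cnt 1,
        (encAtom a).reverse, ar, pw, [1], [1], fun _ => []⟩
    rw [← hIf h] at hw
    have h2 := runsIn_straight_of (detL_writeGadget e Γ) hw le_rfl
    have h4 := h1.seq (((h2.seq (runsIn_clearTmp (encAtom a).reverse
      ⟨rest, eps, _, tol, ans, out, vars, [(η : ℝ)], _, _, [],
        ar, pw, [1], [1], I⟩)).iteTrue (q := moveLoop 10 2) (c := .eq 14 15)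
          (by simp [Test.holds, Store.top])).seq (h3 _ _ _ _))
    dsimp only at h4
    rw [← List.replicate_add, add_comm (stride A Γ) cnt] at h4
    simp only [expandApps, expandCount, dif_pos h, if_pos h, List.nil_append]
    exact h4.mono (by rw [List.length_reverse]; omega)
  · rw [if_neg h] at h1
    have h2 := runsIn_moveLoop (i := 10) (j := 2) (by norm_num) (encAtom a).reverse (St.store
      ⟨rest, eps, query, tol, ans, out, vars, [(η : ℝ)], [(cnt : ℝ)], List.replicate cnt 1,
        (encAtom a).reverse, ar, pw, [0], [1], I⟩) rfl
    simp only [St.update_10, St.update_2, St.store_2, List.reverse_reverse] at h2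
    have h4 := h1.seq ((h2.iteFalse (p := .seq (straight (writeGadget e Γ)) clearTmp)
      (c := .eq 14 15) (by simp [Test.holds, Store.top])).seq (h3 _ _ _ _))
    simp only [expandApps, expandCount, dif_neg h, if_neg h, List.nil_append,
      List.flatMap_singleton]
    exact h4.mono (by rw [List.length_reverse]; omega)

/-- Splits off one application, in the form in which one pass of the loop handles it. -/
theorem expandApps_cons (f : Con k) (e : ι ≃ Fin A) (Γ : Gadget k ι) (η : ℝ≥0) (cnt : ℕ)
    (a : Atom ℕ) (l : List (Atom ℕ)) : expandApps f Γ e η cnt (a :: l) =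
      expandApps f Γ e η (expandCount f (stride A Γ) cnt [a]) l ++ expandApps f Γ e η cnt [a] := by
  by_cases h : a.con = ⟨k, f⟩ <;> simp [expandApps, expandCount, h]

theorem expandCount_cons (f : Con k) (s cnt : ℕ) (a : Atom ℕ) (l : List (Atom ℕ)) :
    expandCount f s cnt (a :: l) = expandCount f s (expandCount f s cnt [a]) l := by
  by_cases h : a.con = ⟨k, f⟩ <;> simp [expandCount, h]

/-- Replace all applications. -/
def replaceLoop (f : Con k) (e : ι ≃ Fin A) (Γ : Gadget k ι) : Prog :=
  .loop (.nonempty 0) (replaceApp f e Γ)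

theorem runsIn_replaceLoop (f : Con k) (e : ι ≃ Fin A) (Γ : Gadget k ι) (η : ℝ≥0) (cnt : ℕ)
    (l : List (Atom ℕ)) (S : St) (hS : Clean S) :
    RunsIn (replaceLoop f e Γ)
      { S with
        inp := l.flatMap encAtom
        eta := [(η : ℝ)]
        cnt := [(cnt : ℝ)]
        ones := List.replicate cnt 1 }.store
      { S with
        inp := []
        query := (expandApps f Γ e η cnt l).flatMap encAtom ++ S.query
        eta := [(η : ℝ)]
        cnt := [((expandCount f (stride A Γ) cnt l : ℕ) : ℝ)]
        ones := List.replicate (expandCount f (stride A Γ) cnt l) 1 }.store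
      ((appCost e Γ + 1) * (l.flatMap encAtom).length + 1) := by
  induction l generalizing cnt S with
  | nil => exact .loopDone (by simp [Test.holds])
  | cons a l ih =>
    have hpos : 1 ≤ (encAtom a).length := by simp [length_encAtom]
    have h1 := runsIn_replaceApp f e Γ η cnt a (l.flatMap encAtom) S hS
    have h2 := ih (expandCount f (stride A Γ) cnt [a])
      { S with query := (expandApps f Γ e η cnt [a]).flatMap encAtom ++ S.query }
      ⟨hS.tmp, hS.flag, hS.one, hS.idx⟩
    rw [expandApps_cons, expandCount_cons f _ cnt a l, List.flatMap_cons, List.flatMap_append,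
      List.append_assoc]
    refine (RunsIn.loopStep ?_ h1 h2).mono ?_
    · simp [Test.holds, encAtom]
    · rw [List.length_append]
      nlinarith

end Emission

/-! ### The reduction -/

section Reduction

variable {k A : ℕ} {ι : Type}

theorem length_le_length_flatMap_encAtom (l : List (Atom ℕ)) :
    l.length ≤ (l.flatMap encAtom).length := by
  induction l with
  | nil => simp
  | cons a l ih =>
    have : 1 ≤ (encAtom a).length := by simp [length_encAtom]
    simp only [List.length_cons, List.flatMap_cons, List.length_append]
    omega

/-- Write the reduced instance on the query stack. -/
def writeQuery (f : Con k) (e : ι ≃ Fin A) (Γ : Gadget k ι) : Prog :=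
  .seq (straight [.const 7 1, .const 8 0, .const 15 1])
    (.seq (gapLoop k) (.seq (moveLoop 10 0)
      (.seq (straight (setReg (k + 16) 7 (.op .div (.reg 7) (.const 4))))
        (.seq (varLoop k) (.seq (straight [.pop 0]) (.seq (replaceLoop f e Γ)
          -- The unary number of variables is known only now; it and the separator are put on top of
          -- the applications, where an encoded instance has them.
          (.seq (straight [.const 2 0]) (.seq (moveLoop 9 2) (straight [.copy 1 3])))))))))

theorem runsIn_writeQuery (f : Con k) (e : ι ≃ Fin A) (Γ : Gadget k ι) (n : ℕ)
    (l : List (Atom ℕ)) (ε : ℝ) (w : List ℝ)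
    (hw : w = List.replicate n 1 ++ 0 :: l.flatMap encAtom) (p : Prog) :
    ∃ S : St, S.query = List.replicate (expandCount f (stride A Γ) n l) 1 ++
        0 :: (expandApps f Γ e (wordGap w / 4) n l).flatMap encAtom ∧
      S.tol = [ε] ∧ S.vars = List.replicate n 1 ∧ S.tmp = [] ∧ S.out = [] ∧
      RunsIn (writeQuery f e Γ) (initial p w ε).2 S.store
        ((appCost e Γ + 8 * stride A Γ + 200) * (w.length + 1)) := by
  set c := expandCount f (stride A Γ) n l with hc
  set η := wordGap w / 4 with hη
  have h0 : (initial p w ε).2 = St.store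
      ⟨w, [ε], [], [], [], [], [], [], [], [], [], [], [], [], [], fun _ => []⟩ := by
    apply St.ext_store <;> try rfl
    intro i
    simp [initial, inStack, epsStack]
  have h1 := runsIn_straight_of (l := [.const 7 1, .const 8 0, .const 15 1]) (B := 9)
    (s := (initial p w ε).2)
    (s' := St.store ⟨w, [ε], [], [], [], [], [], [1], [0], [], [], [], [], [], [1], fun _ => []⟩)
    (by simp [Instr.IsDet]) (by simp [h0, execL_cons, execL_nil, Instr.det, Store.push]) (by simp)
  have h2 := runsIn_gapLoop (k := k) w
    ⟨w, [ε], [], [], [], [], [], [1], [0], [], [], [], [], [], [1], fun _ => []⟩ 1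
  simp only [List.append_nil, one_mul] at h2
  have h3 := runsIn_moveLoop (i := 10) (j := 0) (by norm_num) w.reverse (St.store
    ⟨[], [ε], [], [], [], [], [], [(wordGap w : ℝ)], [0], [], w.reverse, [], [], [], [1],
      fun _ => []⟩) rfl
  simp only [St.update_10, St.update_0, St.store_0, List.reverse_reverse, List.append_nil] at h3
  have h4 := runsIn_straight_of (l := setReg (k + 16) 7 (.op .div (.reg 7) (.const 4))) (B := 30)
    (s := St.store ⟨w, [ε], [], [], [], [], [], [(wordGap w : ℝ)], [0], [], [], [], [], [], [1],
      fun _ => []⟩)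
    (s' := St.store ⟨List.replicate n 1 ++ 0 :: l.flatMap encAtom, [ε], [], [], [], [], [],
      [(η : ℝ)], [((0 : ℕ) : ℝ)], [], [], [], [], [], [1], fun _ => []⟩)
    (by simp)
    (by
      rw [execL_setReg_low (by simp [Ex.Uses]) (by simp), ← hw]
      simp [Ex.eval, Store.top, ArithOp.eval, hη])
    (by simp [setReg, Ex.code])
  have h5 := runsIn_varLoop (k := k) n 0 (l.flatMap encAtom) ⟨[], [ε], [], [], [], [], [],
      [(η : ℝ)], [], [], [], [], [], [], [1], fun _ => []⟩
  simp only [List.append_nil, zero_add] at h5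
  have h6 := runsIn_straight_of (l := [.pop 0]) (B := 5)
    (s := St.store ⟨0 :: l.flatMap encAtom, [ε], [], [], [], [], List.replicate n 1,
      [(η : ℝ)], [(n : ℝ)], List.replicate n 1, [], [], [], [], [1], fun _ => []⟩)
    (s' := St.store ⟨l.flatMap encAtom, [ε], [], [], [], [], List.replicate n 1,
      [(η : ℝ)], [(n : ℝ)], List.replicate n 1, [], [], [], [], [1], fun _ => []⟩)
    (by simp [Instr.IsDet]) (by simp [execL_cons, execL_nil, Instr.det]) (by simp)
  have h7 := runsIn_replaceLoop f e Γ η n l ⟨[], [ε], [], [], [], [], List.replicate n 1,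
    [], [], [], [], [], [], [], [1], fun _ => []⟩ ⟨rfl, rfl, rfl, rfl⟩
  simp only [List.append_nil, ← hc] at h7
  set q := (expandApps f Γ e η n l).flatMap encAtom
  have h8 := runsIn_straight_of (l := [.const 2 0]) (B := 5)
    (s := St.store ⟨[], [ε], q, [], [], [], List.replicate n 1,
      [(η : ℝ)], [(c : ℝ)], List.replicate c 1, [], [], [], [], [1], fun _ => []⟩)
    (s' := St.store ⟨[], [ε], 0 :: q, [], [], [], List.replicate n 1,
      [(η : ℝ)], [(c : ℝ)], List.replicate c 1, [], [], [], [], [1], fun _ => []⟩)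
    (by simp [Instr.IsDet]) (by simp [execL_cons, execL_nil, Instr.det, Store.push]) (by simp)
  have h9 := runsIn_moveLoop (i := 9) (j := 2) (by norm_num) (List.replicate c 1) (St.store
    ⟨[], [ε], 0 :: q, [], [], [], List.replicate n 1,
      [(η : ℝ)], [(c : ℝ)], List.replicate c 1, [], [], [], [], [1], fun _ => []⟩) rfl
  simp only [St.update_9, St.update_2, St.store_2, List.reverse_replicate] at h9
  have h10 := runsIn_straight_of (l := [.copy 1 3]) (B := 5)
    (s := St.store ⟨[], [ε], List.replicate c 1 ++ 0 :: q, [], [], [], List.replicate n 1,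
      [(η : ℝ)], [(c : ℝ)], [], [], [], [], [], [1], fun _ => []⟩)
    (s' := St.store ⟨[], [ε], List.replicate c 1 ++ 0 :: q, [ε], [], [], List.replicate n 1,
      [(η : ℝ)], [(c : ℝ)], [], [], [], [], [], [1], fun _ => []⟩)
    (by simp [Instr.IsDet]) (by simp [execL_cons, execL_nil, Instr.det, Store.push, Store.top])
    (by simp)
  refine ⟨_, rfl, rfl, rfl, rfl, rfl, (h1.seq (h2.seq (h3.seq (h4.seq (h5.seq (h6.seq (h7.seq
    (h8.seq (h9.seq h10))))))))).mono ?_⟩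
  have hlen := length_le_length_flatMap_encAtom l
  -- The number of new variables is linear in the input, and so is the time to write them.
  have hcle : c ≤ n + stride A Γ * l.length := expandCount_le _ _ _
  have hwl : w.length = n + ((l.flatMap encAtom).length + 1) := by simp [hw]
  rw [List.length_reverse, List.length_replicate]
  have h11 : stride A Γ * l.length ≤ stride A Γ * w.length :=
    Nat.mul_le_mul_left _ (by omega)
  have h12 : appCost e Γ * (l.flatMap encAtom).length ≤ appCost e Γ * w.length :=
    Nat.mul_le_mul_left _ (by omega)
  have h13 : (appCost e Γ + 8 * stride A Γ + 200) * (w.length + 1) =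
      appCost e Γ * w.length + 8 * (stride A Γ * w.length) + 200 * w.length +
        (appCost e Γ + 8 * stride A Γ + 200) := by ring
  have h14 : (appCost e Γ + 1) * (l.flatMap encAtom).length =
      appCost e Γ * (l.flatMap encAtom).length + (l.flatMap encAtom).length := by ring
  rw [h13, h14]
  omega

/-- Write the values of the original variables on the output stack. -/
def readAnswer : Prog :=
  .seq (.loop (.nonempty 6) (straight [.copy 4 10, .pop 4, .pop 6])) (moveLoop 10 5)

/-- Reading from an exhausted answer stack yields `0`, which is the padding of `takeD`; so the
program also halts in time on malformed answers. -/
theorem runsIn_takeLoop (n : ℕ) (v : List ℝ) (S : St) :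
    RunsIn (.loop (.nonempty 6) (straight [.copy 4 10, .pop 4, .pop 6]))
      { S with ans := v, vars := List.replicate n 1 }.store
      { S with ans := v.drop n, vars := [], tmp := (v.takeD n 0).reverse ++ S.tmp }.store
      (10 * n + 1) := by
  induction n generalizing v S with
  | zero => exact .loopDone (by simp [Test.holds])
  | succ n ih =>
    have h1 := runsIn_straight_of (l := [.copy 4 10, .pop 4, .pop 6]) (B := 9)
      (s := { S with ans := v, vars := List.replicate (n + 1) 1 }.store)
      (s' := { S with
        ans := v.tail
        vars := List.replicate n 1
        tmp := v.headD 0 :: S.tmp }.store)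
      (by simp [Instr.IsDet])
      (by simp [execL_cons, execL_nil, Instr.det, Store.push, Store.top, List.replicate_succ])
      (by simp)
    have h2 := (RunsIn.loopStep (c := .nonempty 6) (by simp [Test.holds]) h1
      (ih v.tail { S with tmp := v.headD 0 :: S.tmp })).mono (B' := 10 * (n + 1) + 1) (by omega)
    have h3 : (v.tail.takeD n 0).reverse ++ v.headD 0 :: S.tmp =
        (v.takeD (n + 1) 0).reverse ++ S.tmp := by
      rw [List.takeD_succ]
      simp
    have h4 : v.tail.drop n = v.drop (n + 1) := by simp
    rwa [h3, h4] at h2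

theorem runsIn_readAnswer (n : ℕ) (v : List ℝ) (S : St) (hv : S.vars = List.replicate n 1)
    (ht : S.tmp = []) (ho : S.out = []) :
    ∃ s' : Store, s' outStack = v.takeD n 0 ∧
      RunsIn readAnswer (answered S.store v) s' (18 * n + 3) := by
  have h1 := runsIn_takeLoop n v S
  have h2 := runsIn_moveLoop (i := 10) (j := 5) (by norm_num) (v.takeD n 0).reverse (St.store
    { S with ans := v.drop n, vars := [], tmp := (v.takeD n 0).reverse }) rfl
  rw [ht, List.append_nil] at h1
  have h3 : answered S.store v = { S with ans := v, vars := List.replicate n 1, tmp := [] }.store := by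
    rw [← hv, ← ht]
    exact S.update_4 v
  rw [h3]
  refine ⟨_, ?_, (h1.seq h2).mono ?_⟩
  · simp [outStack, ho]
  · rw [List.length_reverse, List.takeD_length]
    omega

end Reduction

/-! ### Assembly of the reduction -/

theorem aptReduces_of_softDefinable {k : ℕ} {f : Con k} {G : Set Constraint}
    (hf : SoftDefinable G f) (F : Set Constraint) :
    APTReduces (maxProdCSPStar ({(⟨k, f⟩ : Constraint)} ∪ F)) (maxProdCSPStar (G ∪ F)) := by
  obtain ⟨ι, _, Γ, hΓ, hsim⟩ := hf
  set e := Fintype.equivFin ι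
  refine aptReduces_of_single_query (writeQuery f e Γ) readAnswer
    -- The summand `200` belongs to writing the query; the other `21` pays for `18 * n + 3` steps to
    -- read the answer and three for the query.
    (appCost e Γ + 8 * stride (Fintype.card ι) Γ + 221) fun (H : CSPInst _) ε hε0 hε1 => ?_
  obtain ⟨H', henc, happ⟩ := exists_reduced_instance (F := F) e hΓ hsim H
  obtain ⟨S, hq, htol, hv, ht, ho, t, htB, hrun⟩ := runsIn_writeQuery f e Γ H.n H.atoms ε (encCSP H)
    (encCSP_eq H) (writeQuery f e Γ)
  refine ⟨H', S.store, t, 18 * H.n + 3, hrun, hq.trans henc.symm, htol, fun v => ?_, ?_⟩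
  · obtain ⟨s', hs', u, hu, hrun'⟩ := runsIn_readAnswer H.n v S hv ht ho
    refine ⟨s', u, hu, hrun', fun h => ?_⟩
    rw [hs']
    exact happ ε hε0 hε1 v h
  · have h1 : (maxProdCSPStar ({(⟨k, f⟩ : Constraint)} ∪ F)).size H = (encCSP H).length := rfl
    have h2 : H.n ≤ (encCSP H).length := by rw [encCSP_eq]; simp
    rw [h1]
    set C := appCost e Γ + 8 * stride (Fintype.card ι) Γ with hC
    have h3 : (C + 221) * ((encCSP H).length + 1) =
      (C + 200) * ((encCSP H).length + 1) + 21 * ((encCSP H).length + 1) := by ring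
    rw [h3]
    omega

end ProdCSP

end

theorem mainTheorem7 {k : ℕ} (f : ProdCSP.Con k) (G : Set ProdCSP.Constraint)
    (hf : ProdCSP.TMaxCon G f) (F : Set ProdCSP.Constraint) :
    ProdCSP.APTReduces
      (ProdCSP.maxProdCSPStar ({(⟨k, f⟩ : ProdCSP.Constraint)} ∪ F))
      (ProdCSP.maxProdCSPStar (G ∪ F)) :=
  ProdCSP.aptReduces_of_softDefinable hf.softDefinable F
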